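/- **Setting.** A replicated service consists of one agreement group of $3f_a+1$ replicas, at most $f_a$ of them Byzantine, and $n_e\ge 1$ execution groups of $2f_e+1$ replicas each, at most $f_e$ of them Byzantine in each group; any number of clients may be Byzantine. Let $0\le z<n_e$, checkpoint intervals $k_a,k_e\ge 1$, agreement-window length $\mathrm{AGWIN}\ge k_a$, and subchannel capacities $|c|\ge k_e$ (commit channels) and $|r|\ge 1$ (request channels). Requests are writes; the application is a deterministic state machine. Each client $c$ belongs to one execution group. Correct processes run the following programs, whose code is atomic between blocking calls, and keep taking the steps that stay enabled. *Client.* To write $w$ it increments its counter $t_c$ (initially $0$) and repeatedly broadcasts the signed request $\langle \mathrm{Write},w,c,t_c\rangle$ to its group until $f_e+1$ replicas of the group have answered with the same reply for $t_c$ (only the first answer of each replica counts); it then accepts this reply. It issues no new request before. *Execution replica* of group $E$, with sequence number $s_n=0$, application state, latest replies $u[c]$ and counters $t[c]=0$. On a valid request with $t_c>t[c]$ it sets $t[c]:=t_c$ and calls $\mathrm{move\_window}(c,t_c)$ and $\mathrm{send}(c,t_c,\cdot)$ on the request channel of $E$; otherwise it re-sends the reply if $u[c]$ holds one for $t_c$.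 In a loop it calls $\mathrm{receive}(s_n+1)$ on the commit channel of $E$. If this returns $\langle\mathrm{TooOld},p\rangle$, it calls $\mathrm{fetch\_cp}(p-1)$. If it returns $\langle\mathrm{Execute},r,\cdot\rangle$, it increments $s_n$, executes $r$ unless the counter of $r$ is not larger than the one in $u[c]$, stores the reply in $u[c]$, sends it to $c$ if $c$ belongs to $E$, and creates a checkpoint $(u,\text{app})$ if $k_e\mid s_n$. When a checkpoint for $s$ becomes stable, it calls $\mathrm{move\_window}(s+1)$ on the commit channel and, if $s>s_n$, adopts $s$ and the checkpoint's state and moves the window of each client's request subchannel to the counter in $u[c]$. *Agreement replica*, with $s_n=0$, counters $t[c]=0$, $t^+[c]=1$, the list $hist$ of the last $|c|$ Execute messages, and window $[1,\mathrm{AGWIN}]$. For each group and client it loops: call $\mathrm{receive}(c,t^+[c])$ on the request channel; order a received request and raise $t^+[c]$ above its position; on $\langle\mathrm{TooOld},p\rangle$ raise $t^+[c]$ to at least $p$. On $\mathrm{deliver}(s,r)$ it waits until $s$ does not exceed the window, then (unless a checkpoint has covered $s$ meanwhile) updates $s_n,t,t^+,hist$, calls $\mathrm{send}(s,\langle\mathrm{Execute},r,s\rangle)$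 on all commit channels, waits only until $n_e-z$ of these calls have returned, and creates a checkpoint $(t,hist)$ if $k_a\mid s$. When a checkpoint $(t',hist')$ for $s$ becomes stable, it calls $\mathrm{move\_window}(s-|hist'|+1)$ on all commit channels, lets the black box forget all sequence numbers $\le s$, and, if $s>s_n$, adopts $s$ and the checkpoint's state, sends the messages of $hist'$ that it skipped on all commit channels and waits until this is completed for $n_e-z$ groups; then it sets the window to $[s+1,s+\mathrm{AGWIN}]$. **Assumptions on the components.** *Network:* messages between correct clients and correct replicas cannot be forged, and a message that is sent infinitely often arrives infinitely often. *Agreement black box:* correct replicas deliver the same message for the same sequence number; only requests that were sent by their client (if correct) are delivered; sequence numbers start at $1$ and are delivered in increasing order, each only after all preceding ones were delivered or garbage-collected, and none after it was garbage-collected; a replica delivers only after its previous deliver call has returned; if $2f_a+1$ correct replicas each receive $m$ (they order it, deliver it or skip it by garbage collection), then $f_a+1$ correct replicas each eventually deliver $m$ or skip it by garbage collection, unless one of the replica's own deliver calls never returns. *Checkpoint component:* a stable checkpoint was created by a correct replica; each replica delivers stable checkpoints with increasing sequence numbers, each after its previous callback has returned; if one correct replica of a group delivers a checkpoint, every correct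 replica of the group delivers it or a newer one (unless one of its own callbacks never returns); if $f+1$ correct replicas of a group create the same checkpoint, some correct replica of the group delivers it or a newer one (same proviso); a replica that calls $\mathrm{fetch\_cp}(s)$ obtains a stable checkpoint with sequence number $\ge s$ if some correct replica of some execution group has one. *Channels* (with $f_s$, $f_r$ tolerated faulty senders and receivers; windows start at $1$): receive returns only messages sent by a correct sender, for positions in the receiver's window; it returns $\langle\mathrm{TooOld},p'\rangle$ at position $p$ only if $p'>p$ and a correct sender or receiver has called move_window with a position $\ge p'$; send returns only for positions below $q+\text{capacity}$, where $q=1$ or a correct replica has called move_window with a position $\ge q$; if the sends of the same message at position $p$ have returned at $f_s+1$ correct senders, then receive calls for $p$ return at all correct receivers; if $f_r+1$ correct receivers have moved their windows to $\ge q$, all sends below $q+\text{capacity}$ return; if $f_s+1$ correct senders call move_window with positions $\ge q$, all correct receivers' windows move to $\ge q$, and such moves never exceed what some correct sender requested; receive calls below the receiver's window return. **Claim.** In every such run: 1. (E-Liveness) Every correct client eventually accepts a reply to each request that it issues. 2. Whenever a correct execution replica of a group $E$ receives $\langle\mathrm{TooOld},p\rangle$ on its commit channel, then before that time a correct replica of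 $E$, or a correct replica in each of at least $n_e-z$ execution groups, has obtained a stable execution checkpoint with sequence number $\ge p-1$; the notified replica obtains such a checkpoint as well, and from some time on its sequence number is at least $p-1$. 3. Whenever an agreement checkpoint for $s$ becomes stable at a correct agreement replica, then at every correct execution replica of every group each outstanding commit-channel receive call at a position $p\le s-|c|$ eventually returns (with a message or with TooOld), and from some time on the replica's sequence number is at least $s-|c|$. -/

import Mathlib

namespace Spider

universe u v w x

/-! ### Generic I/O automata: atomic steps of a correct process -/

/-- A deterministic process.  In state `st`, an input `i` that is enabled leads to the state
`(step st i).1` and produces the set of calls / messages `(step st i).2`.  The inputs in `own` are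
steps that the process takes by itself; all others are triggered from outside (a message arrives,
a blocking call returns, a component invokes a callback). -/
structure Automaton (σ : Type u) (ι : Type v) (ω : Type w) where
  init : σ
  enabled : σ → ι → Prop
  step : σ → ι → σ × Set ω
  own : ι → Prop

/-- `st` is the sequence of states of a process that starts in the initial state and performs
the atomic step `inp n` (if any) at time `n`. -/
def Automaton.Follows {σ : Type u} {ι : Type v} {ω : Type w} (A : Automaton σ ι ω)
    (st : ℕ → σ) (inp : ℕ → Option ι) : Prop :=
  st 0 = A.init ∧
  ∀ n, (inp n = none → st (n + 1) = st n) ∧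
    ∀ i, inp n = some i → A.enabled (st n) i ∧ st (n + 1) = (A.step (st n) i).1

/-- Weak fairness: a step of the process's own that stays enabled is eventually taken. -/
def Automaton.Fair {σ : Type u} {ι : Type v} {ω : Type w} (A : Automaton σ ι ω)
    (st : ℕ → σ) (inp : ℕ → Option ι) : Prop :=
  ∀ i, A.own i → ∀ n, (∀ m, n ≤ m → A.enabled (st m) i) → ∃ m, n ≤ m ∧ inp m = some i

/-! ### System parameters -/

/-- `ne` execution groups of `2 * fe + 1` replicas each, one agreement group of `3 * fa + 1`
replicas; agreement replicas wait for `ne - z` groups only.  `ka`, `ke` are the checkpoint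
intervals, `agWin` is the length of the agreement window, `capC` and `capR` are the capacities of
the subchannels of commit and request channels, `home c` is the execution group of client `c`. -/
structure Config (C : Type u) where
  ne : ℕ
  z : ℕ
  fa : ℕ
  fe : ℕ
  ka : ℕ
  ke : ℕ
  agWin : ℕ
  capC : ℕ
  capR : ℕ
  home : C → Fin ne
  z_lt : z < ne
  ka_pos : 1 ≤ ka
  ke_pos : 1 ≤ ke
  capR_pos : 1 ≤ capR
  ka_le : ka ≤ agWin
  ke_le : ke ≤ capC

abbrev Config.Group {C : Type u} (cfg : Config C) : Type := Fin cfg.ne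

/-- Index of an execution replica within its group. -/
abbrev Config.Member {C : Type u} (cfg : Config C) : Type := Fin (2 * cfg.fe + 1)

/-- Execution replicas: group and index. -/
abbrev Config.ExecId {C : Type u} (cfg : Config C) : Type := Fin cfg.ne × Fin (2 * cfg.fe + 1)

/-- Agreement replicas. -/
abbrev Config.AgrId {C : Type u} (cfg : Config C) : Type := Fin (3 * cfg.fa + 1)

/-- The (Byzantine) faulty processes: at most `fa` agreement replicas, at most `fe` replicas of
each execution group, and any set of clients. -/
structure Faults {C : Type u} (cfg : Config C) where
  agr : Finset cfg.AgrId
  exec : cfg.Group → Finset cfg.Member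
  client : Set C
  agr_card : agr.card ≤ cfg.fa
  exec_card : ∀ g, (exec g).card ≤ cfg.fe

/-- The replicated application: a deterministic state machine. -/
structure App (W : Type v) (S : Type w) (U : Type x) where
  init : S
  exec : S → W → S × U

/-- The signed message `⟨Write, op, client, ctr⟩`. -/
structure Request (C : Type u) (W : Type v) where
  op : W
  client : C
  ctr : ℕ

/-- The message `⟨Execute, req, seq⟩`. -/
structure Execute (C : Type u) (W : Type v) where
  req : Request C W
  seq : ℕ

/-! ### Client -/

structure ClientState (W : Type v) (U : Type x) (k : ℕ) where
  /-- the counter `t_c` of the latest request -/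
  ctr : ℕ
  /-- the operation for which a reply is awaited -/
  pending : Option W
  /-- the first reply of each replica of the client's group to the current request -/
  replies : Fin k → Option U

inductive ClientInput (W : Type v) (U : Type x) (k : ℕ) where
  /-- the user of the client invokes `write op` -/
  | write (op : W)
  /-- (re-)send the current request -/
  | resend
  /-- an authenticated reply `⟨Reply, val, t⟩` arrives from replica `i` of the client's group -/
  | reply (i : Fin k) (val : U) (t : ℕ)

inductive ClientOutput (C : Type u) (W : Type v) (U : Type x) where
  /-- broadcast of a request to the client's execution group -/
  | broadcast (r : Request C W)
  /-- the `write` call for the request with counter `t` returns `val` -/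
  | result (t : ℕ) (val : U)

open Classical in
noncomputable def clientAutomaton {C : Type u} (W : Type v) (U : Type x) (cfg : Config C) (c : C) :
    Automaton (ClientState W U (2 * cfg.fe + 1)) (ClientInput W U (2 * cfg.fe + 1))
      (ClientOutput C W U) where
  init := { ctr := 0, pending := none, replies := fun _ => none }
  enabled st i := match i with
    | .write _ => st.pending = none
    | .resend => st.pending ≠ none
    | .reply _ _ _ => True
  own i := match i with
    | .resend => True
    | _ => False
  step st i := match i with
    | .write op => ({ ctr := st.ctr + 1, pending := some op, replies := fun _ => none }, ∅)
    | .resend =>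
        (st, {o | ∃ op, st.pending = some op ∧ o = .broadcast ⟨op, c, st.ctr⟩})
    | .reply i val t =>
        if st.pending ≠ none ∧ t = st.ctr ∧ st.replies i = none then
          let replies' := Function.update st.replies i (some val)
          if cfg.fe + 1 ≤ Set.ncard {j | replies' j = some val} then
            ({ st with pending := none, replies := replies' }, {.result st.ctr val})
          else ({ st with replies := replies' }, ∅)
        else (st, ∅)

/-! ### Execution replica -/

/-- Content of an execution checkpoint: the latest replies `u` and the application state. -/
structure ExecCp (C : Type u) (S : Type w) (U : Type x) where
  last : C → Option (U × ℕ)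
  app : S

structure ExecState (C : Type u) (S : Type w) (U : Type x) where
  /-- `t[c]`: counter of the latest request received from client `c` -/
  ctr : C → ℕ
  /-- `s_n` -/
  seq : ℕ
  app : S
  /-- `u[c]`: reply to and counter of the latest executed request of `c` -/
  last : C → Option (U × ℕ)
  /-- position of the outstanding `receive` call on the commit channel -/
  pending : Option ℕ

inductive ExecInput (C : Type u) (W : Type v) (S : Type w) (U : Type x) where
  /-- a correctly authenticated and signed client request arrives -/
  | request (r : Request C W)
  /-- the main loop calls `receive` on the commit channel -/
  | callReceive
  /-- the outstanding `receive` call returns the message `m` -/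
  | execute (m : Execute C W)
  /-- the outstanding `receive` call returns `⟨TooOld, p⟩` -/
  | tooOld (p : ℕ)
  /-- callback `stable_cp` of the checkpoint component -/
  | stable (s : ℕ) (cp : ExecCp C S U)
  /-- the `send` call for position `p` of subchannel `c` of the request channel returns -/
  | requestSent (c : C) (p : ℕ)
  /-- the commit-channel endpoint internally calls `move_window` with position `p` -/
  | windowMoved (p : ℕ)

inductive ExecOutput (C : Type u) (W : Type v) (S : Type w) (U : Type x) where
  /-- `move_window(c, p)` on the request channel -/
  | requestMove (c : C) (p : ℕ)
  /-- `send(c, p, r)` on the request channel -/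
  | requestSend (c : C) (p : ℕ) (r : Request C W)
  /-- `receive(0, p)` on the commit channel -/
  | receive (p : ℕ)
  /-- `move_window(0, p)` on the commit channel -/
  | commitMove (p : ℕ)
  | genCp (s : ℕ) (cp : ExecCp C S U)
  | fetchCp (s : ℕ)
  /-- `⟨Reply, val, t⟩` is sent to client `c` -/
  | reply (c : C) (val : U) (t : ℕ)

/-- The request is not a duplicate: its counter exceeds that of the client's latest executed
request. -/
def Fresh {C : Type u} {W : Type v} {U : Type x} (last : C → Option (U × ℕ))
    (r : Request C W) : Prop :=
  ∀ val t, last r.client = some (val, t) → t < r.ctr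

open Classical in
/-- Application state and reply table after processing an ordered request. -/
noncomputable def applyRequest {C : Type u} {W : Type v} {S : Type w} {U : Type x}
    (app : App W S U) (cp : ExecCp C S U) (r : Request C W) : ExecCp C S U :=
  if Fresh cp.last r then
    { app := (app.exec cp.app r.op).1
      last := Function.update cp.last r.client (some ((app.exec cp.app r.op).2, r.ctr)) }
  else cp

open Classical in
noncomputable def execAutomaton {C : Type u} {W : Type v} {S : Type w} {U : Type x}
    (cfg : Config C) (app : App W S U) (g : cfg.Group) :
    Automaton (ExecState C S U) (ExecInput C W S U) (ExecOutput C W S U) where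
  init := { ctr := fun _ => 0, seq := 0, app := app.init, last := fun _ => none, pending := none }
  enabled st i := match i with
    | .callReceive => st.pending = none
    | .execute _ => st.pending ≠ none
    | .tooOld _ => st.pending ≠ none
    | _ => True
  own i := match i with
    | .callReceive => True
    | _ => False
  step st i := match i with
    | .request r =>
        if st.ctr r.client < r.ctr then
          ({ st with ctr := Function.update st.ctr r.client r.ctr },
            {.requestMove r.client r.ctr, .requestSend r.client r.ctr r})
        else
          (st, {o | ∃ val, st.last r.client = some (val, r.ctr) ∧ o = .reply r.client val r.ctr})
    | .callReceive => ({ st with pending := some (st.seq + 1) }, {.receive (st.seq + 1)})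
    | .execute m =>
        -- a message for a position that a checkpoint has skipped meanwhile is dropped
        if st.pending = some (st.seq + 1) then
          let cp := applyRequest app ⟨st.last, st.app⟩ m.req
          ({ st with pending := none, seq := st.seq + 1, app := cp.app, last := cp.last },
            {o | (Fresh st.last m.req ∧ cfg.home m.req.client = g ∧
                    o = .reply m.req.client (app.exec st.app m.req.op).2 m.req.ctr) ∨
                 (cfg.ke ∣ st.seq + 1 ∧ o = .genCp (st.seq + 1) cp)})
        else ({ st with pending := none }, ∅)
    | .tooOld p => ({ st with pending := none }, {.fetchCp (p - 1)})
    | .stable s cp =>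
        if st.seq < s then
          ({ st with seq := s, app := cp.app, last := cp.last },
            {o | o = .commitMove (s + 1) ∨
              ∃ c val t, cp.last c = some (val, t) ∧ o = .requestMove c t})
        else (st, {.commitMove (s + 1)})
    | .requestSent _ _ => (st, ∅)
    | .windowMoved _ => (st, ∅)

/-! ### Agreement replica -/

/-- Content of an agreement checkpoint: the counters `t` of the latest agreed requests and the
latest `Execute` messages `hist`. -/
structure AgrCp (C : Type u) (W : Type v) where
  ctr : C → ℕ
  hist : List (Execute C W)

/-- Control state of the (blocking) callback `deliver`. -/
inductive DeliverCall (C : Type u) (W : Type v) where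
  | idle
  /-- `deliver(s, r)` sleeps until `s` is not above the agreement window -/
  | atWindow (s : ℕ) (r : Request C W)
  /-- `deliver(s, r)` sleeps until `ne - z` of its `send` calls have returned; `cp` is the state
  after `r` -/
  | atSend (s : ℕ) (cp : AgrCp C W)

/-- Control state of the (blocking) callback `stable_cp`. -/
inductive StableCall (C : Type u) (W : Type v) where
  | idle
  /-- `stable_cp` for `s` sleeps until the `missing` messages are sent to `ne - z` groups -/
  | atSend (s : ℕ) (missing : List (Execute C W))

structure AgrState {C : Type u} (W : Type v) (cfg : Config C) where
  /-- `s_n` -/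
  seq : ℕ
  /-- `t[c]` -/
  ctr : C → ℕ
  /-- `t⁺[c]`: counter of the next request expected from client `c` -/
  next : C → ℕ
  /-- the last `capC` messages, the latest one first -/
  hist : List (Execute C W)
  /-- the agreement window is `[winLo, winLo + agWin - 1]` -/
  winLo : ℕ
  /-- positions of the outstanding `receive` calls on the request channels -/
  pending : cfg.Group → C → Option ℕ
  /-- positions of the commit channels whose `send` calls have returned -/
  sent : cfg.Group → Set ℕ
  deliver : DeliverCall C W
  stable : StableCall C W

inductive AgrInput {C : Type u} (W : Type v) (cfg : Config C) where
  /-- the loop for client `c` calls `receive` on the request channel of group `g` -/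
  | callReceive (g : cfg.Group) (c : C)
  /-- that call returns the request `r` -/
  | request (g : cfg.Group) (c : C) (r : Request C W)
  /-- that call returns `⟨TooOld, p⟩` -/
  | tooOld (g : cfg.Group) (c : C) (p : ℕ)
  /-- callback `deliver(s, r)` of the agreement black box -/
  | deliver (s : ℕ) (r : Request C W)
  /-- `deliver` passes the window check -/
  | proceed
  /-- `deliver` returns -/
  | finish
  /-- callback `stable_cp` of the checkpoint component -/
  | stable (s : ℕ) (cp : AgrCp C W)
  /-- `stable_cp` returns -/
  | stableFinish
  /-- the `send` call for position `p` of the commit channel of group `g` returns -/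
  | executeSent (g : cfg.Group) (p : ℕ)
  /-- the request-channel endpoint internally calls `move_window(c, p)` -/
  | windowMoved (g : cfg.Group) (c : C) (p : ℕ)

inductive AgrOutput {C : Type u} (W : Type v) (cfg : Config C) where
  /-- `receive(c, p)` on the request channel of group `g` -/
  | receive (g : cfg.Group) (c : C) (p : ℕ)
  /-- the request is handed to the agreement black box for ordering -/
  | order (r : Request C W)
  /-- `send(0, p, m)` on the commit channel of group `g` -/
  | commitSend (g : cfg.Group) (p : ℕ) (m : Execute C W)
  /-- `move_window(0, p)` on the commit channel of group `g` -/
  | commitMove (g : cfg.Group) (p : ℕ)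
  | genCp (s : ℕ) (cp : AgrCp C W)
  /-- the black box may forget all sequence numbers below `s` -/
  | gc (s : ℕ)

open Classical in
noncomputable def agrAutomaton {C : Type u} (W : Type v) (cfg : Config C) :
    Automaton (AgrState W cfg) (AgrInput W cfg) (AgrOutput W cfg) where
  init :=
    { seq := 0, ctr := fun _ => 0, next := fun _ => 1, hist := [], winLo := 1,
      pending := fun _ _ => none, sent := fun _ => ∅, deliver := .idle, stable := .idle }
  enabled st i := match i with
    | .callReceive g c => st.pending g c = none
    | .request g c _ => st.pending g c ≠ none
    | .tooOld g c _ => st.pending g c ≠ none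
    | .deliver _ _ => st.deliver = .idle
    | .proceed => ∃ s r, st.deliver = .atWindow s r ∧ s < st.winLo + cfg.agWin
    | .finish => ∃ s cp, st.deliver = .atSend s cp ∧
        cfg.ne - cfg.z ≤ Set.ncard {g : cfg.Group | s ∈ st.sent g}
    | .stable _ _ => st.stable = .idle
    | .stableFinish => ∃ s missing, st.stable = .atSend s missing ∧
        cfg.ne - cfg.z ≤ Set.ncard {g : cfg.Group | ∀ m ∈ missing, m.seq ∈ st.sent g}
    | .executeSent _ _ => True
    | .windowMoved _ _ _ => True
  own i := match i with
    | .callReceive _ _ => True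
    | .proceed => True
    | .finish => True
    | .stableFinish => True
    | _ => False
  step st i := match i with
    | .callReceive g c =>
        ({ st with
            pending := Function.update st.pending g
              (Function.update (st.pending g) c (some (st.next c))) },
          {.receive g c (st.next c)})
    | .request g c r =>
        ({ st with
            pending := Function.update st.pending g (Function.update (st.pending g) c none)
            next := Function.update st.next c
              (max (st.next c) ((st.pending g c).getD 0 + 1)) },
          {.order r})
    | .tooOld g c p =>
        ({ st with
            pending := Function.update st.pending g (Function.update (st.pending g) c none)
            next := Function.update st.next c (max (st.next c) p) }, ∅)
    | .deliver s r => ({ st with deliver := .atWindow s r }, ∅)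
    | .proceed =>
        match st.deliver with
        | .atWindow s r =>
            if st.seq < s then
              let ctr' := Function.update st.ctr r.client (max (st.ctr r.client) r.ctr)
              let hist' := ((⟨r, s⟩ : Execute C W) :: st.hist).take cfg.capC
              ({ st with
                  seq := s
                  ctr := ctr'
                  next := Function.update st.next r.client (max (st.next r.client) (r.ctr + 1))
                  hist := hist'
                  deliver := .atSend s ⟨ctr', hist'⟩ },
                {o | ∃ g, o = .commitSend g s ⟨r, s⟩})
            else
              -- a checkpoint has covered (and `gc` has dropped) `s` while the call was asleep
              ({ st with deliver := .idle }, ∅)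
        | _ => (st, ∅)
    | .finish =>
        match st.deliver with
        | .atSend s cp =>
            ({ st with deliver := .idle }, {o | cfg.ka ∣ s ∧ o = .genCp s cp})
        | _ => (st, ∅)
    | .stable s cp =>
        if st.seq < s then
          let missing := cp.hist.filter (fun m => decide (st.seq < m.seq))
          ({ st with
              seq := s
              ctr := cp.ctr
              next := fun c => max (st.next c) (cp.ctr c + 1)
              hist := cp.hist
              stable := .atSend s missing },
            {o | (∃ g, o = .commitMove g (s + 1 - cp.hist.length)) ∨ o = .gc (s + 1) ∨
              ∃ g, ∃ m ∈ missing, o = .commitSend g m.seq m})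
        else
          ({ st with winLo := s + 1 },
            {o | (∃ g, o = .commitMove g (s + 1 - cp.hist.length)) ∨ o = .gc (s + 1)})
    | .stableFinish =>
        match st.stable with
        | .atSend s _ => ({ st with winLo := s + 1, stable := .idle }, ∅)
        | _ => (st, ∅)
    | .executeSent g p =>
        ({ st with sent := Function.update st.sent g (insert p (st.sent g)) }, ∅)
    | .windowMoved _ _ _ => (st, ∅)

/-! ### Inter-regional message channels -/

/-- The calls to, and the returns from, the endpoints of a channel with senders `Snd`, receivers
`Rcv`, subchannels `Sub` and messages `M`; the first argument is the time. -/
structure IrmcTrace (Snd : Type*) (Rcv : Type*) (Sub : Type*) (M : Type*) where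
  sendCall : ℕ → Snd → Sub → ℕ → M → Prop
  sendRet : ℕ → Snd → Sub → ℕ → Prop
  senderMove : ℕ → Snd → Sub → ℕ → Prop
  recvCall : ℕ → Rcv → Sub → ℕ → Prop
  /-- `receive(sc, p) = m` -/
  recvMsg : ℕ → Rcv → Sub → ℕ → M → Prop
  /-- `receive(sc, p) = ⟨TooOld, p'⟩` -/
  recvTooOld : ℕ → Rcv → Sub → ℕ → ℕ → Prop
  recvMove : ℕ → Rcv → Sub → ℕ → Prop
  /-- `move_window` called by the receiver endpoint itself, on request of the senders -/
  recvMoveInternal : ℕ → Rcv → Sub → ℕ → Prop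

namespace IrmcTrace

variable {Snd Rcv Sub M : Type*} (tr : IrmcTrace Snd Rcv Sub M)

/-- Before time `n` the window of receiver `j` was placed at `q`; windows initially start
at `1`. -/
def WindowAt (n : ℕ) (j : Rcv) (sc : Sub) (q : ℕ) : Prop :=
  q = 1 ∨ ∃ n', n' < n ∧ (tr.recvMove n' j sc q ∨ tr.recvMoveInternal n' j sc q)

/-- The window of receiver `j` eventually starts at `q` or later. -/
def Reaches (j : Rcv) (sc : Sub) (q : ℕ) : Prop :=
  ∃ n p, q ≤ p ∧ tr.WindowAt n j sc p

/-- Before time `n` a correct sender or a correct receiver called `move_window` with a position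
`≥ q`. -/
def MoveRequested (okS : Set Snd) (okR : Set Rcv) (n : ℕ) (sc : Sub) (q : ℕ) : Prop :=
  ∃ n' p, n' < n ∧ q ≤ p ∧
    ((∃ i ∈ okS, tr.senderMove n' i sc p) ∨ ∃ j ∈ okR, tr.recvMove n' j sc p)

/-- At time `n`, `receive(sc, p)` returns at receiver `j`. -/
def RecvRet (n : ℕ) (j : Rcv) (sc : Sub) (p : ℕ) : Prop :=
  (∃ m, tr.recvMsg n j sc p m) ∨ ∃ p', tr.recvTooOld n j sc p p'

end IrmcTrace

/-- The properties of a channel of capacity `cap` that tolerates `fs` faulty senders and `fr`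
faulty receivers; `okS`, `okR` are the correct senders and receivers. -/
structure IrmcSpec {Snd Rcv Sub M : Type*} (cap fs fr : ℕ) (okS : Set Snd) (okR : Set Rcv)
    (tr : IrmcTrace Snd Rcv Sub M) : Prop where
  /-- Only calls that were made return. -/
  ret_called : ∀ n, ∀ i ∈ okS, ∀ sc p, tr.sendRet n i sc p →
    ∃ n' m, n' < n ∧ tr.sendCall n' i sc p m
  /-- IRMC-Correctness I: only messages sent by a correct sender, at a position within the
  window, are received. -/
  correctness1 : ∀ n, ∀ j ∈ okR, ∀ sc p m, tr.recvMsg n j sc p m →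
    (∃ n', n' < n ∧ ∃ i ∈ okS, tr.sendCall n' i sc p m) ∧
    ∃ q, tr.WindowAt n j sc q ∧ q ≤ p ∧ p < q + cap
  /-- IRMC-Correctness II: skipping positions requires a move request by a correct replica. -/
  correctness2 : ∀ n, ∀ j ∈ okR, ∀ sc p p', tr.recvTooOld n j sc p p' →
    p < p' ∧ tr.MoveRequested okS okR n sc p'
  /-- `send` blocks while the position is above the window, which starts at `1` and is moved only
  on request of a correct replica. -/
  send_blocks : ∀ n, ∀ i ∈ okS, ∀ sc p, tr.sendRet n i sc p →
    p < 1 + cap ∨ ∃ q, tr.MoveRequested okS okR n sc q ∧ p < q + cap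
  /-- IRMC-Liveness I: a message whose `send` has returned at `fs + 1` correct senders causes
  `receive` to return at all correct receivers. -/
  liveness1 : ∀ sc p m, ∀ Q : Finset Snd, fs + 1 ≤ Q.card →
    (∀ i ∈ Q, i ∈ okS ∧ (∃ n, tr.sendCall n i sc p m) ∧ ∃ n, tr.sendRet n i sc p) →
    ∀ n, ∀ j ∈ okR, tr.recvCall n j sc p → ∃ n', n < n' ∧ tr.RecvRet n' j sc p
  /-- IRMC-Liveness II: once `fr + 1` correct receivers have moved their windows to `q` or beyond,
  `send` calls below `q + cap` return. -/
  liveness2 : ∀ sc q, ∀ Q : Finset Rcv, fr + 1 ≤ Q.card →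
    (∀ j ∈ Q, j ∈ okR ∧ tr.Reaches j sc q) →
    ∀ n, ∀ i ∈ okS, ∀ p m, tr.sendCall n i sc p m → p < q + cap →
      ∃ n', n < n' ∧ tr.sendRet n' i sc p
  /-- IRMC-Liveness III, lower bound: move requests of `fs + 1` correct senders to `q` or beyond
  move the windows of all correct receivers to `q` or beyond. -/
  liveness3 : ∀ sc q, ∀ Q : Finset Snd, fs + 1 ≤ Q.card →
    (∀ i ∈ Q, i ∈ okS ∧ ∃ n p, q ≤ p ∧ tr.senderMove n i sc p) →
    ∀ j ∈ okR, tr.Reaches j sc q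
  /-- IRMC-Liveness III, upper bound: an endpoint moves its window by itself at most as far as
  some correct sender has requested. -/
  liveness3_le : ∀ n, ∀ j ∈ okR, ∀ sc q, tr.recvMoveInternal n j sc q →
    ∃ n' p, n' < n ∧ q ≤ p ∧ ∃ i ∈ okS, tr.senderMove n' i sc p
  /-- `receive` does not block for a position below the window of the endpoint. -/
  recv_old : ∀ n, ∀ j ∈ okR, ∀ sc p, tr.recvCall n j sc p → tr.Reaches j sc (p + 1) →
    ∃ n', n < n' ∧ tr.RecvRet n' j sc p

/-! ### Agreement black box -/

structure AgreementTrace (R : Type*) (M : Type*) where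
  order : ℕ → R → M → Prop
  deliver : ℕ → R → ℕ → M → Prop
  /-- `gc(s)`: forget everything before `s` -/
  gc : ℕ → R → ℕ → Prop
  /-- a `deliver` callback has not returned yet -/
  busy : ℕ → R → Prop

namespace AgreementTrace

variable {R M : Type*} (tr : AgreementTrace R M)

/-- Replica `a` delivers `m`, or garbage-collects a sequence number for which a correct replica
delivers `m`. -/
def Passes (ok : Set R) (a : R) (m : M) : Prop :=
  (∃ n s, tr.deliver n a s m) ∨
  ∃ n s s', tr.gc n a s' ∧ s < s' ∧ ∃ b ∈ ok, ∃ k, tr.deliver k b s m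

end AgreementTrace

/-- The properties of the agreement black box with `f` tolerated faults; `ok` are the correct
replicas and `auth n m` says that `m` is a correctly authenticated request at time `n`. -/
structure AgreementSpec {R M : Type*} (f : ℕ) (ok : Set R) (auth : ℕ → M → Prop)
    (tr : AgreementTrace R M) : Prop where
  /-- A-Safety -/
  safety : ∀ a ∈ ok, ∀ b ∈ ok, ∀ n n' s m m',
    tr.deliver n a s m → tr.deliver n' b s m' → m = m'
  /-- A-Validity -/
  validity : ∀ a ∈ ok, ∀ n s m, tr.deliver n a s m → auth n m
  /-- Sequence numbers start at `1`. -/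
  first : ∀ a ∈ ok, ∀ n s m, tr.deliver n a s m → 1 ≤ s
  /-- A-Order: all preceding sequence numbers were delivered or garbage-collected before. -/
  order : ∀ a ∈ ok, ∀ n s m, tr.deliver n a s m → ∀ s', 1 ≤ s' → s' < s →
    (∃ n' m', n' < n ∧ tr.deliver n' a s' m') ∨ ∃ n' s'', n' < n ∧ s' < s'' ∧ tr.gc n' a s''
  /-- A-Order: sequence numbers are delivered in increasing order. -/
  increasing : ∀ a ∈ ok, ∀ n n' s s' m m', n < n' →
    tr.deliver n a s m → tr.deliver n' a s' m' → s < s'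
  /-- Garbage-collected sequence numbers are not delivered. -/
  collected : ∀ a ∈ ok, ∀ n n' s s' m, n < n' →
    tr.gc n a s → tr.deliver n' a s' m → s ≤ s'
  /-- A-Liveness: if `2f + 1` correct replicas receive `m` (for ordering, or already as a decision
  of the group), then `f + 1` correct replicas deliver `m` (or skip it by garbage collection),
  unless their own `deliver` callback never returns. -/
  liveness : ∀ m, ∀ P : Finset R, 2 * f + 1 ≤ P.card →
    (∀ a ∈ P, a ∈ ok ∧ ((∃ n, tr.order n a m) ∨ tr.Passes ok a m)) →
    ∃ Q : Finset R, f + 1 ≤ Q.card ∧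
      ∀ a ∈ Q, a ∈ ok ∧ (tr.Passes ok a m ∨ ∃ n, ∀ n', n ≤ n' → tr.busy n' a)

/-! ### Checkpoint component -/

structure CpTrace (R : Type*) (X : Type*) where
  gen : ℕ → R → ℕ → X → Prop
  /-- callback `stable_cp`: the replica delivers a stable checkpoint -/
  stable : ℕ → R → ℕ → X → Prop
  fetch : ℕ → R → ℕ → Prop
  /-- a `stable_cp` callback has not returned yet -/
  busy : ℕ → R → Prop

namespace CpTrace

variable {R X : Type*} (tr : CpTrace R X)

/-- Replica `j` at some time delivers the checkpoint `(s, x)` or a newer one, unless one of its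
`stable_cp` callbacks never returns. -/
def Gets (j : R) (s : ℕ) (x : X) : Prop :=
  (∃ n, tr.stable n j s x) ∨ (∃ n s' x', s < s' ∧ tr.stable n j s' x') ∨
    ∃ n, ∀ n', n ≤ n' → tr.busy n' j

end CpTrace

/-- The properties of the checkpoint component for replicas in groups `grp`, each with `f`
tolerated faults. -/
structure CpSpec {R G X : Type*} (f : ℕ) (grp : R → G) (ok : Set R)
    (tr : CpTrace R X) : Prop where
  /-- CP-Safety: a stable checkpoint was created by a correct replica. -/
  safety : ∀ n, ∀ i ∈ ok, ∀ s x, tr.stable n i s x → ∃ n', n' < n ∧ ∃ j ∈ ok, tr.gen n' j s x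
  /-- Each replica delivers checkpoints with increasing sequence numbers. -/
  increasing : ∀ n n', ∀ i ∈ ok, ∀ s s' x x', n < n' →
    tr.stable n i s x → tr.stable n' i s' x' → s < s'
  /-- CP-Liveness: what one correct replica of a group delivers, all correct replicas of the group
  deliver. -/
  liveness : ∀ n, ∀ i ∈ ok, ∀ j ∈ ok, ∀ s x, grp i = grp j → tr.stable n i s x → tr.Gets j s x
  /-- CP-Liveness II: a checkpoint created by `f + 1` correct replicas of a group becomes stable
  in that group. -/
  liveness2 : ∀ g s x, ∀ Q : Finset R, f + 1 ≤ Q.card →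
    (∀ i ∈ Q, i ∈ ok ∧ grp i = g ∧ ∃ n, tr.gen n i s x) →
    ∃ j ∈ ok, grp j = g ∧ tr.Gets j s x
  /-- `fetch_cp(s)` succeeds if a correct replica (of any group) has a stable checkpoint with
  sequence number at least `s`. -/
  fetch : ∀ n, ∀ i ∈ ok, ∀ s, tr.fetch n i s →
    (∃ n', ∃ j ∈ ok, ∃ s' x, s ≤ s' ∧ tr.stable n' j s' x) →
    (∃ n' s' x, s ≤ s' ∧ tr.stable n' i s' x) ∨ ∃ n', ∀ n'', n' ≤ n'' → tr.busy n'' i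

/-! ### Runs of the whole system -/

/-- States of all processes over time, and the atomic step (if any) each one takes at each time.
For faulty processes these data are meaningless. -/
structure Run {C : Type u} (W : Type v) (S : Type w) (U : Type x) (cfg : Config C) where
  client : ℕ → C → ClientState W U (2 * cfg.fe + 1)
  clientIn : ℕ → C → Option (ClientInput W U (2 * cfg.fe + 1))
  exec : ℕ → cfg.ExecId → ExecState C S U
  execIn : ℕ → cfg.ExecId → Option (ExecInput C W S U)
  agr : ℕ → cfg.AgrId → AgrState W cfg
  agrIn : ℕ → cfg.AgrId → Option (AgrInput W cfg)

namespace Run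

variable {C : Type u} {W : Type v} {S : Type w} {U : Type x} {cfg : Config C}
  (ρ : Run W S U cfg)

/-- Client `c` performs the output `o` at time `n`. -/
def ClientOut (n : ℕ) (c : C) (o : ClientOutput C W U) : Prop :=
  ∃ i, ρ.clientIn n c = some i ∧ o ∈ ((clientAutomaton W U cfg c).step (ρ.client n c) i).2

/-- Execution replica `e` performs the output `o` at time `n`. -/
def ExecOut (app : App W S U) (n : ℕ) (e : cfg.ExecId) (o : ExecOutput C W S U) : Prop :=
  ∃ i, ρ.execIn n e = some i ∧ o ∈ ((execAutomaton cfg app e.1).step (ρ.exec n e) i).2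

/-- Agreement replica `a` performs the output `o` at time `n`. -/
def AgrOut (n : ℕ) (a : cfg.AgrId) (o : AgrOutput W cfg) : Prop :=
  ∃ i, ρ.agrIn n a = some i ∧ o ∈ ((agrAutomaton W cfg).step (ρ.agr n a) i).2

/-- All correct processes follow their programs and keep taking steps. -/
structure FollowsProtocol (app : App W S U) (F : Faults cfg) : Prop where
  client : ∀ c, c ∉ F.client →
    (clientAutomaton W U cfg c).Follows (ρ.client · c) (ρ.clientIn · c) ∧
    (clientAutomaton W U cfg c).Fair (ρ.client · c) (ρ.clientIn · c)
  exec : ∀ e : cfg.ExecId, e.2 ∉ F.exec e.1 →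
    (execAutomaton cfg app e.1).Follows (ρ.exec · e) (ρ.execIn · e) ∧
    (execAutomaton cfg app e.1).Fair (ρ.exec · e) (ρ.execIn · e)
  agr : ∀ a, a ∉ F.agr →
    (agrAutomaton W cfg).Follows (ρ.agr · a) (ρ.agrIn · a) ∧
    (agrAutomaton W cfg).Fair (ρ.agr · a) (ρ.agrIn · a)

/-- Messages between correct clients and correct execution replicas are authenticated (not
forgeable), and a message that is sent again and again arrives again and again. -/
structure Network (app : App W S U) (F : Faults cfg) : Prop where
  request_auth : ∀ n (e : cfg.ExecId), e.2 ∉ F.exec e.1 → ∀ r : Request C W,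
    r.client ∉ F.client → ρ.execIn n e = some (.request r) →
    e.1 = cfg.home r.client ∧ ∃ n', n' < n ∧ ρ.ClientOut n' r.client (.broadcast r)
  reply_auth : ∀ n c, c ∉ F.client → ∀ i, i ∉ F.exec (cfg.home c) → ∀ val t,
    ρ.clientIn n c = some (.reply i val t) →
    ∃ n', n' < n ∧ ρ.ExecOut app n' (cfg.home c, i) (.reply c val t)
  request_fair : ∀ c, c ∉ F.client → ∀ i, i ∉ F.exec (cfg.home c) → ∀ r : Request C W,
    (∀ n, ∃ n', n ≤ n' ∧ ρ.ClientOut n' c (.broadcast r)) →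
    ∀ n, ∃ n', n ≤ n' ∧ ρ.execIn n' (cfg.home c, i) = some (.request r)
  reply_fair : ∀ c, c ∉ F.client → ∀ i, i ∉ F.exec (cfg.home c) → ∀ val t,
    (∀ n, ∃ n', n ≤ n' ∧ ρ.ExecOut app n' (cfg.home c, i) (.reply c val t)) →
    ∀ n, ∃ n', n ≤ n' ∧ ρ.clientIn n' c = some (.reply i val t)

/-- At time `n`, `r` is correctly authenticated: if its client is correct, that client has sent
it. -/
def Authentic (F : Faults cfg) (n : ℕ) (r : Request C W) : Prop :=
  r.client ∉ F.client → ∃ n', n' < n ∧ ρ.ClientOut n' r.client (.broadcast r)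

/-- The request channel of group `g`: from the replicas of `g` to the agreement group, with one
subchannel for each client. -/
def requestChannel (app : App W S U) (g : cfg.Group) :
    IrmcTrace cfg.Member cfg.AgrId C (Request C W) where
  sendCall n i c p r := ρ.ExecOut app n (g, i) (.requestSend c p r)
  sendRet n i c p := ρ.execIn n (g, i) = some (.requestSent c p)
  senderMove n i c p := ρ.ExecOut app n (g, i) (.requestMove c p)
  recvCall n a c p := ρ.AgrOut n a (.receive g c p)
  recvMsg n a c p r := (ρ.agr n a).pending g c = some p ∧ ρ.agrIn n a = some (.request g c r)
  recvTooOld n a c p p' :=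
    (ρ.agr n a).pending g c = some p ∧ ρ.agrIn n a = some (.tooOld g c p')
  recvMove _ _ _ _ := False
  recvMoveInternal n a c p := ρ.agrIn n a = some (.windowMoved g c p)

/-- The commit channel of group `g`: from the agreement group to the replicas of `g`, with a
single subchannel. -/
def commitChannel (app : App W S U) (g : cfg.Group) :
    IrmcTrace cfg.AgrId cfg.Member Unit (Execute C W) where
  sendCall n a _ p m := ρ.AgrOut n a (.commitSend g p m)
  sendRet n a _ p := ρ.agrIn n a = some (.executeSent g p)
  senderMove n a _ p := ρ.AgrOut n a (.commitMove g p)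
  recvCall n i _ p := ρ.ExecOut app n (g, i) (.receive p)
  recvMsg n i _ p m :=
    (ρ.exec n (g, i)).pending = some p ∧ ρ.execIn n (g, i) = some (.execute m)
  recvTooOld n i _ p p' :=
    (ρ.exec n (g, i)).pending = some p ∧ ρ.execIn n (g, i) = some (.tooOld p')
  recvMove n i _ p := ρ.ExecOut app n (g, i) (.commitMove p)
  recvMoveInternal n i _ p := ρ.execIn n (g, i) = some (.windowMoved p)

/-- The use of the agreement black box by the agreement group. -/
def agreement : AgreementTrace cfg.AgrId (Request C W) where
  order n a r := ρ.AgrOut n a (.order r)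
  deliver n a s r := ρ.agrIn n a = some (.deliver s r)
  gc n a s := ρ.AgrOut n a (.gc s)
  busy n a := (ρ.agr n a).deliver ≠ .idle

/-- The use of the checkpoint component by the agreement group. -/
def agrCheckpoints : CpTrace cfg.AgrId (AgrCp C W) where
  gen n a s cp := ρ.AgrOut n a (.genCp s cp)
  stable n a s cp := ρ.agrIn n a = some (.stable s cp)
  fetch _ _ _ := False
  busy n a := (ρ.agr n a).stable ≠ .idle

/-- The use of the checkpoint component by the execution groups. -/
def execCheckpoints (app : App W S U) : CpTrace cfg.ExecId (ExecCp C S U) where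
  gen n e s cp := ρ.ExecOut app n e (.genCp s cp)
  stable n e s cp := ρ.execIn n e = some (.stable s cp)
  fetch n e s := ρ.ExecOut app n e (.fetchCp s)
  busy _ _ := False

/-- The agreement black box, the checkpoint components and all channels have their specified
properties in this run. -/
structure Components (app : App W S U) (F : Faults cfg) : Prop where
  agreement : AgreementSpec cfg.fa {a | a ∉ F.agr} (ρ.Authentic F) ρ.agreement
  agrCheckpoints :
    CpSpec cfg.fa (fun _ : cfg.AgrId => ()) {a | a ∉ F.agr} ρ.agrCheckpoints
  execCheckpoints :
    CpSpec cfg.fe (fun e : cfg.ExecId => e.1) {e | e.2 ∉ F.exec e.1} (ρ.execCheckpoints app)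
  requestChannel : ∀ g, IrmcSpec cfg.capR cfg.fe cfg.fa {i | i ∉ F.exec g} {a | a ∉ F.agr}
    (ρ.requestChannel app g)
  commitChannel : ∀ g, IrmcSpec cfg.capC cfg.fa cfg.fe {a | a ∉ F.agr} {i | i ∉ F.exec g}
    (ρ.commitChannel app g)

/-- E-Liveness: a correct client that has issued a request eventually accepts a reply to it. -/
def ELiveness (F : Faults cfg) : Prop :=
  ∀ c, c ∉ F.client → ∀ n op, (ρ.client n c).pending = some op →
    ∃ n' val, n ≤ n' ∧ ρ.ClientOut n' c (.result (ρ.client n c).ctr val)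

/-- Before time `n`, some correct replica of group `g` has obtained a stable execution checkpoint
with sequence number at least `s`. -/
def HasCheckpoint (F : Faults cfg) (n : ℕ) (g : cfg.Group) (s : ℕ) : Prop :=
  ∃ j, j ∉ F.exec g ∧ ∃ n' s' cp, n' < n ∧ s ≤ s' ∧ ρ.execIn n' (g, j) = some (.stable s' cp)

end Run

end Spider

/-! ### Agreement replicas: atomic steps and outputs. -/

namespace Spider

universe u v w x

namespace Run

variable {C : Type u} {W : Type v} {S : Type w} {U : Type x} {cfg : Config C}
  {ρ : Run W S U cfg} {app : App W S U} {F : Faults cfg}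

/-! Safety first. By A-Safety every sequence number has at most one decided request, so there are
canonical states `agrCanon` and `execCanon` after `s` decisions. Induction on time (`agr_inv`,
`exec_inv`) shows that a correct replica with sequence number `s` is in the canonical state, also
after it has adopted a checkpoint, since some correct replica created that checkpoint earlier. Hence
correct replicas send equal messages at equal commit positions and create equal checkpoints for
equal numbers. This is what lets the quorum properties of channels and checkpoint components be
applied.

Skipped positions are accounted for by `ncard_hasCheckpoint_of_stable`. The creator of an agreement
checkpoint for `s` had `ne - z` returned sends at position `s`. Such a send returns beyond the
initial window only after somebody requested a window move: either an execution replica of that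
group, which then has a checkpoint for at least `s - capC`, or an agreement replica, which then has
a stable checkpoint for at least `s`; the latter case is handled by induction on time. So whatever
an agreement checkpoint drops is held as an execution checkpoint by `ne - z` groups, and `z < ne`
gives `fetch_cp` a source. The same count shows that `stable_cp` calls of agreement replicas return
(`stable_returns`), which removes the proviso from the liveness of agreement checkpoints.

For progress, agreement waits for sends, sends wait for execution checkpoints, and execution waits
for agreement. The circle is broken by induction on the sequence number in `exec_reaches`: if `fa +
1` correct agreement replicas reach `x`, then all correct execution replicas of all groups reach
`x`. When a group has reached `x`, its latest checkpoint leaves room for position `x + 1` because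
`ke ≤ capC` (`commitSend_returns`). Positions that agreement has dropped are crossed by TooOld and
fetching.

The black box promises a set of `fa + 1` correct replicas that pass a request or have a `deliver`
call that never returns. In such a set, the slowest member cannot block forever
(`not_deliver_busy`): the others reach every number that it reaches, so the execution groups do too,
its sends return, and agreement checkpoints become stable often enough, by `ka ≤ agWin`, to move its
window. So it passes the request (`exists_decision`).

E-Liveness is proved by contradiction. If a client waits forever for a reply to `r` (`Waiting`),
then `r` is its last request and no correct process uses a larger counter for it. Its group forwards
`r`, every correct agreement replica orders, delivers or skips it (`waiting_next`,
`waiting_ordered`), it is decided and executed, and the stored reply is never overwritten.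
Retransmission then brings `fe + 1` equal replies to the client. -/

/-- Runs in which the correct processes follow their programs, and network and components have
their specified properties. -/
structure Admissible (ρ : Run W S U cfg) (app : App W S U) (F : Faults cfg) : Prop where
  prot : ρ.FollowsProtocol app F
  net : ρ.Network app F
  comp : ρ.Components app F

/-! ### The transition function of agreement replicas -/

section

variable (st : AgrState W cfg) (g : cfg.Group) (c : C) (r : Request C W) (s p : ℕ) (cp : AgrCp C W)

open Classical in
theorem agr_step_callReceive : (agrAutomaton W cfg).step st (.callReceive g c) =
    ({ st with
        pending := Function.update st.pending g
          (Function.update (st.pending g) c (some (st.next c))) },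
      {.receive g c (st.next c)}) := rfl

open Classical in
theorem agr_step_request : (agrAutomaton W cfg).step st (.request g c r) =
    ({ st with
        pending := Function.update st.pending g (Function.update (st.pending g) c none)
        next := Function.update st.next c (max (st.next c) ((st.pending g c).getD 0 + 1)) },
      {.order r}) := rfl

open Classical in
theorem agr_step_tooOld : (agrAutomaton W cfg).step st (.tooOld g c p) =
    ({ st with
        pending := Function.update st.pending g (Function.update (st.pending g) c none)
        next := Function.update st.next c (max (st.next c) p) }, ∅) := rfl

theorem agr_step_deliver : (agrAutomaton W cfg).step st (.deliver s r) =
    ({ st with deliver := .atWindow s r }, ∅) := rfl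

open Classical in
theorem agr_step_proceed (hd : st.deliver = .atWindow s r) (hlt : st.seq < s) :
    (agrAutomaton W cfg).step st .proceed =
    ({ st with
        seq := s
        ctr := Function.update st.ctr r.client (max (st.ctr r.client) r.ctr)
        next := Function.update st.next r.client (max (st.next r.client) (r.ctr + 1))
        hist := ((⟨r, s⟩ : Execute C W) :: st.hist).take cfg.capC
        deliver := .atSend s ⟨Function.update st.ctr r.client (max (st.ctr r.client) r.ctr),
          ((⟨r, s⟩ : Execute C W) :: st.hist).take cfg.capC⟩ },
      {o | ∃ g, o = .commitSend g s ⟨r, s⟩}) := by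
  unfold agrAutomaton
  simp only [hd, hlt, if_true]

theorem agr_step_proceed_drop (hd : st.deliver = .atWindow s r) (hlt : ¬ st.seq < s) :
    (agrAutomaton W cfg).step st .proceed = ({ st with deliver := .idle }, ∅) := by
  unfold agrAutomaton
  simp only [hd, hlt, if_false]

theorem agr_step_finish (hd : st.deliver = .atSend s cp) :
    (agrAutomaton W cfg).step st .finish =
      ({ st with deliver := .idle }, {o | cfg.ka ∣ s ∧ o = .genCp s cp}) := by
  unfold agrAutomaton
  simp only [hd]

theorem agr_step_stable (hlt : st.seq < s) : (agrAutomaton W cfg).step st (.stable s cp) =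
    ({ st with
        seq := s
        ctr := cp.ctr
        next := fun c => max (st.next c) (cp.ctr c + 1)
        hist := cp.hist
        stable := .atSend s (cp.hist.filter (fun m => decide (st.seq < m.seq))) },
      {o | (∃ g, o = .commitMove g (s + 1 - cp.hist.length)) ∨ o = .gc (s + 1) ∨
        ∃ g, ∃ m ∈ cp.hist.filter (fun m => decide (st.seq < m.seq)),
          o = .commitSend g m.seq m}) := by
  unfold agrAutomaton
  simp only [hlt, if_true]

theorem agr_step_stable_old (hlt : ¬ st.seq < s) :
    (agrAutomaton W cfg).step st (.stable s cp) =
    ({ st with winLo := s + 1 },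
      {o | (∃ g, o = .commitMove g (s + 1 - cp.hist.length)) ∨ o = .gc (s + 1)}) := by
  unfold agrAutomaton
  simp only [hlt, if_false]

theorem agr_step_stableFinish {l : List (Execute C W)} (hd : st.stable = .atSend s l) :
    (agrAutomaton W cfg).step st .stableFinish =
      ({ st with winLo := s + 1, stable := .idle }, ∅) := by
  unfold agrAutomaton
  simp only [hd]

open Classical in
theorem agr_step_executeSent : (agrAutomaton W cfg).step st (.executeSent g p) =
    ({ st with sent := Function.update st.sent g (insert p (st.sent g)) }, ∅) := rfl

theorem agr_step_windowMoved :
    (agrAutomaton W cfg).step st (.windowMoved g c p) = (st, ∅) := rfl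

end

namespace Admissible

/-! ### Atomic steps of agreement replicas -/

theorem agr_none (h : Admissible ρ app F) {a : cfg.AgrId} (ha : a ∉ F.agr) {n : ℕ}
    (hi : ρ.agrIn n a = none) : ρ.agr (n + 1) a = ρ.agr n a :=
  ((h.prot.agr a ha).1.2 n).1 hi

theorem agr_some (h : Admissible ρ app F) {a : cfg.AgrId} (ha : a ∉ F.agr) {n : ℕ}
    {i : AgrInput W cfg} (hi : ρ.agrIn n a = some i) :
    (agrAutomaton W cfg).enabled (ρ.agr n a) i ∧
      ρ.agr (n + 1) a = ((agrAutomaton W cfg).step (ρ.agr n a) i).1 :=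
  ((h.prot.agr a ha).1.2 n).2 i hi

theorem agr_zero (h : Admissible ρ app F) {a : cfg.AgrId} (ha : a ∉ F.agr) :
    ρ.agr 0 a = (agrAutomaton W cfg).init :=
  (h.prot.agr a ha).1.1

-- The step function is unfolded only in case lists such as this one, each following one part of the
-- state; the later invariants are inductions along these lists. A sequence number changes in two
-- ways only: by processing a delivery or by adopting a checkpoint.
open Classical in
theorem agr_state_step (h : Admissible ρ app F) {a : cfg.AgrId} (ha : a ∉ F.agr) (n : ℕ) :
    ((ρ.agr (n + 1) a).seq = (ρ.agr n a).seq ∧ (ρ.agr (n + 1) a).ctr = (ρ.agr n a).ctr ∧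
      (ρ.agr (n + 1) a).hist = (ρ.agr n a).hist) ∨
    (∃ r, (ρ.agr n a).deliver = .atWindow (ρ.agr (n + 1) a).seq r ∧
      (ρ.agr n a).seq < (ρ.agr (n + 1) a).seq ∧
      (ρ.agr (n + 1) a).ctr =
        Function.update (ρ.agr n a).ctr r.client (max ((ρ.agr n a).ctr r.client) r.ctr) ∧
      (ρ.agr (n + 1) a).hist =
        ((⟨r, (ρ.agr (n + 1) a).seq⟩ : Execute C W) :: (ρ.agr n a).hist).take cfg.capC ∧
      (ρ.agr (n + 1) a).deliver =
        .atSend (ρ.agr (n + 1) a).seq ⟨(ρ.agr (n + 1) a).ctr, (ρ.agr (n + 1) a).hist⟩ ∧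
      ∀ g, ρ.AgrOut n a (.commitSend g (ρ.agr (n + 1) a).seq ⟨r, (ρ.agr (n + 1) a).seq⟩)) ∨
    (∃ cp, ρ.agrIn n a = some (.stable (ρ.agr (n + 1) a).seq cp) ∧
      (ρ.agr n a).seq < (ρ.agr (n + 1) a).seq ∧
      (ρ.agr (n + 1) a).ctr = cp.ctr ∧ (ρ.agr (n + 1) a).hist = cp.hist) := by
  classical
  rcases hi : ρ.agrIn n a with _ | i
  · rw [h.agr_none ha hi]; simp
  obtain ⟨he, hs⟩ := h.agr_some ha hi
  have hout : ∀ o, o ∈ ((agrAutomaton W cfg).step (ρ.agr n a) i).2 → ρ.AgrOut n a o :=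
    fun o ho => ⟨i, hi, ho⟩
  rw [hs]
  cases i with
  | proceed =>
    obtain ⟨s, r, hd, hw⟩ := he
    by_cases hlt : (ρ.agr n a).seq < s
    · refine Or.inr (Or.inl ⟨r, ?_⟩)
      simp only [agr_step_proceed _ _ _ hd hlt, true_and] at hout ⊢
      exact ⟨hd, hlt, fun g => hout _ ⟨g, rfl⟩⟩
    · left
      simp [agr_step_proceed_drop _ _ _ hd hlt]
  | finish =>
    obtain ⟨s, cp, hd, -⟩ := he
    left
    simp [agr_step_finish _ _ _ hd]
  | stable s cp =>
    by_cases hlt : (ρ.agr n a).seq < s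
    · refine Or.inr (Or.inr ⟨cp, ?_⟩)
      simp [agr_step_stable _ _ _ hlt, hlt]
    · left
      simp [agr_step_stable_old _ _ _ hlt]
  | stableFinish =>
    obtain ⟨s, m, hd, -⟩ := he
    left
    simp [agr_step_stableFinish _ _ hd]
  | _ => exact Or.inl ⟨rfl, rfl, rfl⟩

theorem agr_deliver_step (h : Admissible ρ app F) {a : cfg.AgrId} (ha : a ∉ F.agr) (n : ℕ) :
    (ρ.agr (n + 1) a).deliver = (ρ.agr n a).deliver ∨
    (∃ s r, ρ.agrIn n a = some (.deliver s r) ∧ (ρ.agr n a).deliver = .idle ∧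
      (ρ.agr (n + 1) a).deliver = .atWindow s r) ∨
    (∃ s r, (ρ.agr n a).deliver = .atWindow s r ∧ (ρ.agr n a).seq < s ∧
      (ρ.agr (n + 1) a).seq = s ∧
      (ρ.agr (n + 1) a).deliver =
        .atSend s ⟨(ρ.agr (n + 1) a).ctr, (ρ.agr (n + 1) a).hist⟩) ∨
    (∃ s r, (ρ.agr n a).deliver = .atWindow s r ∧ s ≤ (ρ.agr n a).seq ∧
      (ρ.agr (n + 1) a).deliver = .idle) ∨
    (∃ s cp, ρ.agrIn n a = some .finish ∧ (ρ.agr n a).deliver = .atSend s cp ∧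
      (ρ.agr (n + 1) a).deliver = .idle) := by
  classical
  rcases hi : ρ.agrIn n a with _ | i
  · rw [h.agr_none ha hi]; simp
  obtain ⟨he, hs⟩ := h.agr_some ha hi
  rw [hs]
  cases i with
  | deliver s r =>
    refine Or.inr (Or.inl ⟨s, r, rfl, he, ?_⟩)
    simp [agr_step_deliver]
  | proceed =>
    obtain ⟨s, r, hd, hw⟩ := he
    by_cases hlt : (ρ.agr n a).seq < s
    · refine Or.inr (Or.inr (Or.inl ⟨s, r, hd, hlt, ?_⟩))
      simp [agr_step_proceed _ _ _ hd hlt]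
    · refine Or.inr (Or.inr (Or.inr (Or.inl ⟨s, r, hd, not_lt.1 hlt, ?_⟩)))
      simp [agr_step_proceed_drop _ _ _ hd hlt]
  | finish =>
    obtain ⟨s, cp, hd, -⟩ := he
    refine Or.inr (Or.inr (Or.inr (Or.inr ⟨s, cp, rfl, hd, ?_⟩)))
    simp [agr_step_finish _ _ _ hd]
  | stable s cp =>
    left
    by_cases hlt : (ρ.agr n a).seq < s
    · simp [agr_step_stable _ _ _ hlt]
    · simp [agr_step_stable_old _ _ _ hlt]
  | stableFinish =>
    obtain ⟨s, m, hd, -⟩ := he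
    left
    simp [agr_step_stableFinish _ _ hd]
  | _ => exact Or.inl rfl

/-- A checkpoint that is not ahead of the replica moves the window in the same step and never makes
the callback sleep; only a checkpoint that is ahead leads to `atSend`. -/
theorem agr_stable_step (h : Admissible ρ app F) {a : cfg.AgrId} (ha : a ∉ F.agr) (n : ℕ) :
    ((ρ.agr (n + 1) a).stable = (ρ.agr n a).stable ∧
      (ρ.agr (n + 1) a).winLo = (ρ.agr n a).winLo) ∨
    (∃ s cp, ρ.agrIn n a = some (.stable s cp) ∧ (ρ.agr n a).stable = .idle ∧
      ((∃ l, (ρ.agr (n + 1) a).stable = .atSend s l ∧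
          (∀ m ∈ l, m ∈ cp.hist ∧ ∀ g, ρ.AgrOut n a (.commitSend g m.seq m)) ∧
          (ρ.agr (n + 1) a).winLo = (ρ.agr n a).winLo) ∨
        ((ρ.agr (n + 1) a).stable = .idle ∧ (ρ.agr (n + 1) a).winLo = s + 1))) ∨
    (∃ s l, ρ.agrIn n a = some .stableFinish ∧ (ρ.agr n a).stable = .atSend s l ∧
      (ρ.agr (n + 1) a).stable = .idle ∧ (ρ.agr (n + 1) a).winLo = s + 1) := by
  classical
  rcases hi : ρ.agrIn n a with _ | i
  · rw [h.agr_none ha hi]; simp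
  obtain ⟨he, hs⟩ := h.agr_some ha hi
  have hout : ∀ o, o ∈ ((agrAutomaton W cfg).step (ρ.agr n a) i).2 → ρ.AgrOut n a o :=
    fun o ho => ⟨i, hi, ho⟩
  rw [hs]
  cases i with
  | proceed =>
    obtain ⟨s, r, hd, hw⟩ := he
    left
    by_cases hlt : (ρ.agr n a).seq < s
    · simp [agr_step_proceed _ _ _ hd hlt]
    · simp [agr_step_proceed_drop _ _ _ hd hlt]
  | finish =>
    obtain ⟨s, cp, hd, -⟩ := he
    left
    simp [agr_step_finish _ _ _ hd]
  | stable s cp =>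
    refine Or.inr (Or.inl ⟨s, cp, rfl, he, ?_⟩)
    by_cases hlt : (ρ.agr n a).seq < s
    · left
      simp only [agr_step_stable _ _ _ hlt] at hout ⊢
      refine ⟨_, rfl, fun m hm => ⟨(List.mem_filter.1 hm).1, fun g => ?_⟩, trivial⟩
      exact hout _ (Or.inr (Or.inr ⟨g, m, hm, rfl⟩))
    · right
      have he' : (ρ.agr n a).stable = .idle := he
      simp [agr_step_stable_old _ _ _ hlt, he']
  | stableFinish =>
    obtain ⟨s, m, hd, -⟩ := he
    refine Or.inr (Or.inr ⟨s, m, rfl, hd, ?_⟩)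
    simp [agr_step_stableFinish _ _ hd]
  | _ => exact Or.inl ⟨rfl, rfl⟩

theorem agr_sent_step (h : Admissible ρ app F) {a : cfg.AgrId} (ha : a ∉ F.agr) (n : ℕ)
    (g : cfg.Group) (p : ℕ) :
    p ∈ (ρ.agr (n + 1) a).sent g ↔
      p ∈ (ρ.agr n a).sent g ∨ ρ.agrIn n a = some (.executeSent g p) := by
  classical
  rcases hi : ρ.agrIn n a with _ | i
  · rw [h.agr_none ha hi]; simp
  obtain ⟨he, hs⟩ := h.agr_some ha hi
  rw [hs]
  cases i with
  | proceed =>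
    obtain ⟨s, r, hd, hw⟩ := he
    by_cases hlt : (ρ.agr n a).seq < s
    · simp [agr_step_proceed _ _ _ hd hlt]
    · simp [agr_step_proceed_drop _ _ _ hd hlt]
  | finish =>
    obtain ⟨s, cp, hd, -⟩ := he
    simp [agr_step_finish _ _ _ hd]
  | stable s cp =>
    by_cases hlt : (ρ.agr n a).seq < s
    · simp [agr_step_stable _ _ _ hlt]
    · simp [agr_step_stable_old _ _ _ hlt]
  | stableFinish =>
    obtain ⟨s, m, hd, -⟩ := he
    simp [agr_step_stableFinish _ _ hd]
  | executeSent g' p' =>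
    by_cases hg : g' = g
    · subst hg
      simp only [agr_step_executeSent, Function.update_self, Set.mem_insert_iff, Option.some.injEq,
        AgrInput.executeSent.injEq, true_and]
      rw [or_comm, eq_comm]
    · simp [agr_step_executeSent, Function.update_of_ne (Ne.symm hg), hg]
  | _ => exact ⟨Or.inl, fun h => h.resolve_right (by simp)⟩

theorem agr_next_step (h : Admissible ρ app F) {a : cfg.AgrId} (ha : a ∉ F.agr) (n : ℕ) (c : C) :
    (ρ.agr (n + 1) a).next c = (ρ.agr n a).next c ∨
    (∃ g r p, ρ.agrIn n a = some (.request g c r) ∧ (ρ.agr n a).pending g c = some p ∧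
      (ρ.agr (n + 1) a).next c = max ((ρ.agr n a).next c) (p + 1)) ∨
    (∃ g p, ρ.agrIn n a = some (.tooOld g c p) ∧
      (ρ.agr (n + 1) a).next c = max ((ρ.agr n a).next c) p) ∨
    (∃ s r, (ρ.agr n a).deliver = .atWindow s r ∧ r.client = c ∧
      (ρ.agr (n + 1) a).next c = max ((ρ.agr n a).next c) (r.ctr + 1)) ∨
    (∃ s cp, ρ.agrIn n a = some (.stable s cp) ∧
      (ρ.agr (n + 1) a).next c = max ((ρ.agr n a).next c) (cp.ctr c + 1)) := by
  classical
  rcases hi : ρ.agrIn n a with _ | i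
  · rw [h.agr_none ha hi]; simp
  obtain ⟨he, hs⟩ := h.agr_some ha hi
  rw [hs]
  cases i with
  | request g c' r =>
    by_cases hc : c = c'
    · subst hc
      obtain ⟨p, hp⟩ := Option.ne_none_iff_exists'.1 he
      refine Or.inr (Or.inl ⟨g, r, p, rfl, hp, ?_⟩)
      simp [agr_step_request, hp]
    · left
      simp [agr_step_request, Function.update_of_ne hc]
  | tooOld g c' p =>
    by_cases hc : c = c'
    · subst hc
      refine Or.inr (Or.inr (Or.inl ⟨g, p, rfl, ?_⟩))
      simp [agr_step_tooOld]
    · left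
      simp [agr_step_tooOld, Function.update_of_ne hc]
  | proceed =>
    obtain ⟨s, r, hd, hw⟩ := he
    by_cases hlt : (ρ.agr n a).seq < s
    · by_cases hc : c = r.client
      · refine Or.inr (Or.inr (Or.inr (Or.inl ⟨s, r, hd, hc.symm, ?_⟩)))
        simp [agr_step_proceed _ _ _ hd hlt, hc]
      · left
        simp [agr_step_proceed _ _ _ hd hlt, Function.update_of_ne hc]
    · left
      simp [agr_step_proceed_drop _ _ _ hd hlt]
  | finish =>
    obtain ⟨s, cp, hd, -⟩ := he
    left
    simp [agr_step_finish _ _ _ hd]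
  | stable s cp =>
    by_cases hlt : (ρ.agr n a).seq < s
    · refine Or.inr (Or.inr (Or.inr (Or.inr ⟨s, cp, rfl, ?_⟩)))
      simp [agr_step_stable _ _ _ hlt]
    · left
      simp [agr_step_stable_old _ _ _ hlt]
  | stableFinish =>
    obtain ⟨s, m, hd, -⟩ := he
    left
    simp [agr_step_stableFinish _ _ hd]
  | _ => exact Or.inl rfl

theorem agr_pending_step (h : Admissible ρ app F) {a : cfg.AgrId} (ha : a ∉ F.agr) (n : ℕ)
    (g : cfg.Group) (c : C) :
    ((ρ.agr (n + 1) a).pending g c = (ρ.agr n a).pending g c ∧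
      (∀ r, ρ.agrIn n a ≠ some (.request g c r)) ∧ ∀ p, ρ.agrIn n a ≠ some (.tooOld g c p)) ∨
    (ρ.agrIn n a = some (.callReceive g c) ∧ (ρ.agr n a).pending g c = none ∧
      (ρ.agr (n + 1) a).pending g c = some ((ρ.agr n a).next c) ∧
      ρ.AgrOut n a (.receive g c ((ρ.agr n a).next c))) ∨
    ((ρ.agr n a).pending g c ≠ none ∧ (ρ.agr (n + 1) a).pending g c = none ∧
      ((∃ r, ρ.agrIn n a = some (.request g c r)) ∨
        ∃ p, ρ.agrIn n a = some (.tooOld g c p))) := by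
  classical
  rcases hi : ρ.agrIn n a with _ | i
  · rw [h.agr_none ha hi]; simp
  obtain ⟨he, hs⟩ := h.agr_some ha hi
  have hout : ∀ o, o ∈ ((agrAutomaton W cfg).step (ρ.agr n a) i).2 → ρ.AgrOut n a o :=
    fun o ho => ⟨i, hi, ho⟩
  rw [hs]
  have hupd : ∀ (g' : cfg.Group) (c' : C) (v : Option ℕ), ¬ (g' = g ∧ c' = c) →
      Function.update (ρ.agr n a).pending g'
        (Function.update ((ρ.agr n a).pending g') c' v) g c =
        (ρ.agr n a).pending g c := by
    intro g' c' v hne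
    by_cases hg : g = g'
    · subst hg
      have hc : c ≠ c' := fun hc => hne ⟨rfl, hc.symm⟩
      simp [Function.update_of_ne hc]
    · simp [Function.update_of_ne hg]
  cases i with
  | callReceive g' c' =>
    by_cases hgc : g' = g ∧ c' = c
    · obtain ⟨rfl, rfl⟩ := hgc
      refine Or.inr (Or.inl ⟨rfl, he, ?_, hout _ (by simp [agr_step_callReceive])⟩)
      simp [agr_step_callReceive]
    · exact Or.inl ⟨hupd _ _ _ hgc, by simp, by simp⟩
  | request g' c' r =>
    by_cases hgc : g' = g ∧ c' = c
    · obtain ⟨rfl, rfl⟩ := hgc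
      refine Or.inr (Or.inr ⟨he, ?_, Or.inl ⟨r, rfl⟩⟩)
      simp [agr_step_request]
    · exact Or.inl ⟨hupd _ _ _ hgc, by simpa using fun a b => hgc ⟨a, b⟩, by simp⟩
  | tooOld g' c' p =>
    by_cases hgc : g' = g ∧ c' = c
    · obtain ⟨rfl, rfl⟩ := hgc
      refine Or.inr (Or.inr ⟨he, ?_, Or.inr ⟨p, rfl⟩⟩)
      simp [agr_step_tooOld]
    · exact Or.inl ⟨hupd _ _ _ hgc, by simp, by simpa using fun a b => hgc ⟨a, b⟩⟩
  | proceed =>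
    obtain ⟨s, r, hd, hw⟩ := he
    left
    by_cases hlt : (ρ.agr n a).seq < s
    · simp [agr_step_proceed _ _ _ hd hlt]
    · simp [agr_step_proceed_drop _ _ _ hd hlt]
  | finish =>
    obtain ⟨s, cp, hd, -⟩ := he
    left
    simp [agr_step_finish _ _ _ hd]
  | stable s cp =>
    left
    by_cases hlt : (ρ.agr n a).seq < s
    · simp [agr_step_stable _ _ _ hlt]
    · simp [agr_step_stable_old _ _ _ hlt]
  | stableFinish =>
    obtain ⟨s, m, hd, -⟩ := he
    left
    simp [agr_step_stableFinish _ _ hd]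
  | _ => exact Or.inl ⟨rfl, by simp, by simp⟩

/-! ### Outputs of agreement replicas -/

theorem agrOut_commitSend (h : Admissible ρ app F) {a : cfg.AgrId} (ha : a ∉ F.agr) {n : ℕ}
    {g : cfg.Group} {p : ℕ} {m : Execute C W} (ho : ρ.AgrOut n a (.commitSend g p m)) :
    m.seq = p ∧ ((∃ r, m = ⟨r, p⟩ ∧ (ρ.agr n a).deliver = .atWindow p r) ∨
      ∃ s cp, ρ.agrIn n a = some (.stable s cp) ∧ m ∈ cp.hist) := by
  obtain ⟨i, hi, ho⟩ := ho
  obtain ⟨he, -⟩ := h.agr_some ha hi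
  cases i with
  | proceed =>
    obtain ⟨s, r, hd, hw⟩ := he
    by_cases hlt : (ρ.agr n a).seq < s
    · simp only [agr_step_proceed _ _ _ hd hlt, Set.mem_ofPred_eq, AgrOutput.commitSend.injEq] at ho
      obtain ⟨g', -, rfl, rfl⟩ := ho
      exact ⟨rfl, Or.inl ⟨r, rfl, hd⟩⟩
    · simp [agr_step_proceed_drop _ _ _ hd hlt] at ho
  | finish =>
    obtain ⟨s, cp, hd, -⟩ := he
    simp [agr_step_finish _ _ _ hd] at ho
  | stable s cp =>
    by_cases hlt : (ρ.agr n a).seq < s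
    · simp [agr_step_stable _ _ _ hlt] at ho
      obtain ⟨hm, -, rfl⟩ := ho
      exact ⟨rfl, Or.inr ⟨s, cp, hi, hm.1⟩⟩
    · simp [agr_step_stable_old _ _ _ hlt] at ho
  | stableFinish =>
    obtain ⟨s, m, hd, -⟩ := he
    simp [agr_step_stableFinish _ _ hd] at ho
  | callReceive => simp [agr_step_callReceive] at ho
  | request => simp [agr_step_request] at ho
  | tooOld => simp [agr_step_tooOld] at ho
  | deliver => simp [agr_step_deliver] at ho
  | executeSent => simp [agr_step_executeSent] at ho
  | windowMoved => simp [agr_step_windowMoved] at ho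

theorem agrOut_commitMove (h : Admissible ρ app F) {a : cfg.AgrId} (ha : a ∉ F.agr) {n : ℕ}
    {g : cfg.Group} {q : ℕ} (ho : ρ.AgrOut n a (.commitMove g q)) :
    ∃ s cp, ρ.agrIn n a = some (.stable s cp) ∧ q = s + 1 - cp.hist.length := by
  obtain ⟨i, hi, ho⟩ := ho
  obtain ⟨he, -⟩ := h.agr_some ha hi
  cases i with
  | proceed =>
    obtain ⟨s, r, hd, hw⟩ := he
    by_cases hlt : (ρ.agr n a).seq < s
    · simp [agr_step_proceed _ _ _ hd hlt] at ho
    · simp [agr_step_proceed_drop _ _ _ hd hlt] at ho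
  | finish =>
    obtain ⟨s, cp, hd, -⟩ := he
    simp [agr_step_finish _ _ _ hd] at ho
  | stable s cp =>
    refine ⟨s, cp, hi, ?_⟩
    by_cases hlt : (ρ.agr n a).seq < s
    · simpa [agr_step_stable _ _ _ hlt] using ho
    · simpa [agr_step_stable_old _ _ _ hlt] using ho
  | stableFinish =>
    obtain ⟨s, m, hd, -⟩ := he
    simp [agr_step_stableFinish _ _ hd] at ho
  | callReceive => simp [agr_step_callReceive] at ho
  | request => simp [agr_step_request] at ho
  | tooOld => simp [agr_step_tooOld] at ho
  | deliver => simp [agr_step_deliver] at ho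
  | executeSent => simp [agr_step_executeSent] at ho
  | windowMoved => simp [agr_step_windowMoved] at ho

theorem agrOut_gc (h : Admissible ρ app F) {a : cfg.AgrId} (ha : a ∉ F.agr) {n q : ℕ}
    (ho : ρ.AgrOut n a (.gc q)) : ∃ s cp, ρ.agrIn n a = some (.stable s cp) ∧ q = s + 1 := by
  obtain ⟨i, hi, ho⟩ := ho
  obtain ⟨he, -⟩ := h.agr_some ha hi
  cases i with
  | proceed =>
    obtain ⟨s, r, hd, hw⟩ := he
    by_cases hlt : (ρ.agr n a).seq < s
    · simp [agr_step_proceed _ _ _ hd hlt] at ho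
    · simp [agr_step_proceed_drop _ _ _ hd hlt] at ho
  | finish =>
    obtain ⟨s, cp, hd, -⟩ := he
    simp [agr_step_finish _ _ _ hd] at ho
  | stable s cp =>
    refine ⟨s, cp, hi, ?_⟩
    by_cases hlt : (ρ.agr n a).seq < s
    · simpa [agr_step_stable _ _ _ hlt] using ho
    · simpa [agr_step_stable_old _ _ _ hlt] using ho
  | stableFinish =>
    obtain ⟨s, m, hd, -⟩ := he
    simp [agr_step_stableFinish _ _ hd] at ho
  | callReceive => simp [agr_step_callReceive] at ho
  | request => simp [agr_step_request] at ho
  | tooOld => simp [agr_step_tooOld] at ho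
  | deliver => simp [agr_step_deliver] at ho
  | executeSent => simp [agr_step_executeSent] at ho
  | windowMoved => simp [agr_step_windowMoved] at ho

/-- The count of returned sends is the source of every later statement about `ne - z` groups. -/
theorem agrOut_genCp (h : Admissible ρ app F) {a : cfg.AgrId} (ha : a ∉ F.agr) {n s : ℕ}
    {cp : AgrCp C W} (ho : ρ.AgrOut n a (.genCp s cp)) :
    (ρ.agr n a).deliver = .atSend s cp ∧ cfg.ka ∣ s ∧
      cfg.ne - cfg.z ≤ Set.ncard {g : cfg.Group | s ∈ (ρ.agr n a).sent g} := by
  obtain ⟨i, hi, ho⟩ := ho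
  obtain ⟨he, -⟩ := h.agr_some ha hi
  cases i with
  | proceed =>
    obtain ⟨s, r, hd, hw⟩ := he
    by_cases hlt : (ρ.agr n a).seq < s
    · simp [agr_step_proceed _ _ _ hd hlt] at ho
    · simp [agr_step_proceed_drop _ _ _ hd hlt] at ho
  | finish =>
    obtain ⟨s', cp', hd, hc⟩ := he
    simp only [agr_step_finish _ _ _ hd, Set.mem_ofPred_eq, AgrOutput.genCp.injEq] at ho
    obtain ⟨hk, rfl, rfl⟩ := ho
    exact ⟨hd, hk, hc⟩
  | stable s cp =>
    by_cases hlt : (ρ.agr n a).seq < s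
    · simp [agr_step_stable _ _ _ hlt] at ho
    · simp [agr_step_stable_old _ _ _ hlt] at ho
  | stableFinish =>
    obtain ⟨s, m, hd, -⟩ := he
    simp [agr_step_stableFinish _ _ hd] at ho
  | callReceive => simp [agr_step_callReceive] at ho
  | request => simp [agr_step_request] at ho
  | tooOld => simp [agr_step_tooOld] at ho
  | deliver => simp [agr_step_deliver] at ho
  | executeSent => simp [agr_step_executeSent] at ho
  | windowMoved => simp [agr_step_windowMoved] at ho

theorem stable_outputs {a : cfg.AgrId} {n s : ℕ}
    {cp : AgrCp C W} (hi : ρ.agrIn n a = some (.stable s cp)) :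
    ρ.AgrOut n a (.gc (s + 1)) ∧
      ∀ g, ρ.AgrOut n a (.commitMove g (s + 1 - cp.hist.length)) := by
  by_cases hlt : (ρ.agr n a).seq < s
  · refine ⟨⟨_, hi, ?_⟩, fun g => ⟨_, hi, ?_⟩⟩ <;> simp [agr_step_stable _ _ _ hlt]
  · refine ⟨⟨_, hi, ?_⟩, fun g => ⟨_, hi, ?_⟩⟩ <;> simp [agr_step_stable_old _ _ _ hlt]

theorem finish_outputs {a : cfg.AgrId} {n s : ℕ} {cp : AgrCp C W}
    (hi : ρ.agrIn n a = some .finish) (hd : (ρ.agr n a).deliver = .atSend s cp)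
    (hk : cfg.ka ∣ s) : ρ.AgrOut n a (.genCp s cp) :=
  ⟨_, hi, by simp [agr_step_finish _ _ _ hd, hk]⟩

theorem request_outputs {a : cfg.AgrId} {n : ℕ} {g : cfg.Group} {c : C} {r : Request C W}
    (hi : ρ.agrIn n a = some (.request g c r)) : ρ.AgrOut n a (.order r) :=
  ⟨_, hi, by simp [agr_step_request]⟩

end Admissible
end Run
end Spider

/-! ### The canonical sequence of decisions and states, and the safety of agreement. -/

namespace Spider

universe u v w x

namespace Run

variable {C : Type u} {W : Type v} {S : Type w} {U : Type x} {cfg : Config C}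
  {ρ : Run W S U cfg} {app : App W S U} {F : Faults cfg}

/-! ### The agreed sequence of requests -/

/-- Some correct agreement replica delivers `r` with sequence number `s`. -/
def Decided (ρ : Run W S U cfg) (F : Faults cfg) (s : ℕ) (r : Request C W) : Prop :=
  ∃ a, a ∉ F.agr ∧ ∃ n, ρ.agrIn n a = some (.deliver s r)

open Classical in
/-- The request with sequence number `s`. -/
noncomputable def decision (ρ : Run W S U cfg) (F : Faults cfg) (s : ℕ) : Option (Request C W) :=
  if h : ∃ r, ρ.Decided F s r then some h.choose else none

open Classical in
/-- The agreement checkpoint after the first `s` decisions. -/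
noncomputable def agrCanon (ρ : Run W S U cfg) (F : Faults cfg) : ℕ → AgrCp C W
  | 0 => ⟨fun _ => 0, []⟩
  | s + 1 => match ρ.decision F (s + 1) with
    | none => agrCanon ρ F s
    | some r =>
      ⟨Function.update (agrCanon ρ F s).ctr r.client (max ((agrCanon ρ F s).ctr r.client) r.ctr),
        ((⟨r, s + 1⟩ : Execute C W) :: (agrCanon ρ F s).hist).take cfg.capC⟩

/-- The execution checkpoint after the first `s` decisions. -/
noncomputable def execCanon (ρ : Run W S U cfg) (app : App W S U) (F : Faults cfg) :
    ℕ → ExecCp C S U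
  | 0 => ⟨fun _ => none, app.init⟩
  | s + 1 => match ρ.decision F (s + 1) with
    | none => execCanon ρ app F s
    | some r => applyRequest app (execCanon ρ app F s) r

open Classical in
theorem agrCanon_succ {s : ℕ} {r : Request C W} (hr : ρ.decision F (s + 1) = some r) :
    ρ.agrCanon F (s + 1) =
      ⟨Function.update (ρ.agrCanon F s).ctr r.client (max ((ρ.agrCanon F s).ctr r.client) r.ctr),
        ((⟨r, s + 1⟩ : Execute C W) :: (ρ.agrCanon F s).hist).take cfg.capC⟩ := by
  rw [agrCanon]; simp only [hr]

theorem execCanon_succ {s : ℕ} {r : Request C W} (hr : ρ.decision F (s + 1) = some r) :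
    ρ.execCanon app F (s + 1) = applyRequest app (ρ.execCanon app F s) r := by
  rw [execCanon]; simp only [hr]

theorem decided_of_decision {s : ℕ} {r : Request C W} (hr : ρ.decision F s = some r) :
    ρ.Decided F s r := by
  unfold decision at hr
  split at hr
  · next hex =>
    cases hr
    exact hex.choose_spec
  · cases hr

/-- The exact length determines where a stable checkpoint for `s` moves the commit windows: to `1`
if `s ≤ capC`, and to `s + 1 - capC` otherwise. -/
theorem agrCanon_hist_length {s : ℕ} (hd : ∀ p, 1 ≤ p → p ≤ s → ρ.decision F p ≠ none) :
    (ρ.agrCanon F s).hist.length = min s cfg.capC := by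
  induction s with
  | zero => simp [agrCanon]
  | succ s ih =>
    obtain ⟨r, hr⟩ := Option.ne_none_iff_exists'.1 (hd (s + 1) (by omega) le_rfl)
    have ih := ih fun p hp hps => hd p hp (by omega)
    rw [agrCanon_succ hr]
    simp only [List.length_take, List.length_cons, ih]
    omega

theorem mem_agrCanon_hist {s : ℕ} {m : Execute C W} (hm : m ∈ (ρ.agrCanon F s).hist) :
    1 ≤ m.seq ∧ m.seq ≤ s ∧ ρ.decision F m.seq = some m.req := by
  induction s with
  | zero => simp [agrCanon] at hm
  | succ s ih =>
    rcases hr : ρ.decision F (s + 1) with _ | r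
    · rw [agrCanon] at hm
      simp only [hr] at hm
      obtain ⟨h1, h2, h3⟩ := ih hm
      exact ⟨h1, by omega, h3⟩
    · rw [agrCanon_succ hr] at hm
      rcases List.mem_cons.1 (List.mem_of_mem_take hm) with rfl | hm
      · exact ⟨by simp, le_rfl, hr⟩
      · obtain ⟨h1, h2, h3⟩ := ih hm
        exact ⟨h1, by omega, h3⟩

/-- The history holds the latest `capC` decisions. -/
theorem agrCanon_hist_getElem? {s : ℕ} (hd : ∀ p, 1 ≤ p → p ≤ s → ρ.decision F p ≠ none) (i : ℕ)
    (hi : i < s) (hc : i < cfg.capC) :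
    ∃ r, ρ.decision F (s - i) = some r ∧ (ρ.agrCanon F s).hist[i]? = some ⟨r, s - i⟩ := by
  induction s generalizing i with
  | zero => omega
  | succ s ih =>
    obtain ⟨r, hr⟩ := Option.ne_none_iff_exists'.1 (hd (s + 1) (by omega) le_rfl)
    rw [agrCanon_succ hr]
    cases i with
    | zero => exact ⟨r, hr, by simp [hc]⟩
    | succ i =>
      obtain ⟨r', hr', hg⟩ := ih (fun p hp hps => hd p hp (by omega)) i (by omega) (by omega)
      have he : s + 1 - (i + 1) = s - i := by omega
      rw [he]
      exact ⟨r', hr', by simp [hc, hg]⟩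

theorem exists_mem_agrCanon_hist {s : ℕ} (hd : ∀ p, 1 ≤ p → p ≤ s → ρ.decision F p ≠ none)
    {p : ℕ} (hp : 1 ≤ p) (hps : p ≤ s) (hpc : s < p + cfg.capC) :
    ∃ m ∈ (ρ.agrCanon F s).hist, m.seq = p := by
  -- The newest message comes first, so position `p` has index `s - p`.
  obtain ⟨r, -, hg⟩ := agrCanon_hist_getElem? hd (s - p) (by omega) (by omega)
  refine ⟨_, List.mem_of_getElem? hg, ?_⟩
  simp only
  omega

/-- The counters of an agreement checkpoint are counters of decided requests. -/
theorem exists_decision_of_agrCanon_ctr {s : ℕ} {c : C} (hc : 1 ≤ (ρ.agrCanon F s).ctr c) :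
    ∃ p r, 1 ≤ p ∧ p ≤ s ∧ ρ.decision F p = some r ∧ r.client = c ∧
      r.ctr = (ρ.agrCanon F s).ctr c := by
  classical
  induction s with
  | zero => simp [agrCanon] at hc
  | succ s ih =>
    have lift : 1 ≤ (ρ.agrCanon F s).ctr c → ∃ p r, 1 ≤ p ∧ p ≤ s + 1 ∧
        ρ.decision F p = some r ∧ r.client = c ∧ r.ctr = (ρ.agrCanon F s).ctr c := fun h1 => by
      obtain ⟨p, r, hp, hps, h⟩ := ih h1
      exact ⟨p, r, hp, by omega, h⟩
    rcases hr : ρ.decision F (s + 1) with _ | r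
    · rw [agrCanon] at hc ⊢
      simp only [hr] at hc ⊢
      exact lift hc
    · rw [agrCanon_succ hr] at hc ⊢
      by_cases hrc : c = r.client
      · subst hrc
        simp only [Function.update_self] at hc ⊢
        rcases le_total r.ctr ((ρ.agrCanon F s).ctr r.client) with hle | hle
        · rw [max_eq_left hle] at hc ⊢
          exact lift hc
        · rw [max_eq_right hle]
          exact ⟨s + 1, r, by omega, le_rfl, hr, rfl, rfl⟩
      · simp only [Function.update_of_ne hrc] at hc ⊢
        exact lift hc

namespace Admissible

/-- A-Safety makes the arbitrary choice inside `decision` irrelevant. -/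
theorem decision_eq (h : Admissible ρ app F) {a : cfg.AgrId} (ha : a ∉ F.agr) {n s : ℕ}
    {r : Request C W} (hd : ρ.agrIn n a = some (.deliver s r)) : ρ.decision F s = some r := by
  have hex : ∃ r, ρ.Decided F s r := ⟨r, a, ha, n, hd⟩
  unfold decision
  rw [dif_pos hex]
  obtain ⟨b, hb, k, hk⟩ := hex.choose_spec
  exact congrArg some (h.comp.agreement.safety b hb a ha _ _ _ _ _ hk hd)

/-! ### Invariants of agreement replicas -/

theorem agr_seq_mono (h : Admissible ρ app F) {a : cfg.AgrId} (ha : a ∉ F.agr) :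
    Monotone fun n => (ρ.agr n a).seq := by
  refine monotone_nat_of_le_succ fun n => ?_
  rcases h.agr_state_step ha n with h1 | ⟨_, -, h1, -⟩ | ⟨_, -, h1, -⟩
  · exact h1.1.ge
  · exact h1.le
  · exact h1.le

theorem agr_seq_stable (h : Admissible ρ app F) {a : cfg.AgrId} (ha : a ∉ F.agr) {n s : ℕ}
    {cp : AgrCp C W} (hi : ρ.agrIn n a = some (.stable s cp)) {m : ℕ} (hm : n < m) :
    s ≤ (ρ.agr m a).seq := by
  refine le_trans ?_ (h.agr_seq_mono ha hm)
  have hs := (h.agr_some ha hi).2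
  by_cases hlt : (ρ.agr n a).seq < s
  · simp [hs, agr_step_stable _ _ _ hlt]
  · simpa [hs, agr_step_stable_old _ _ _ hlt] using hlt

/-- A request that was delivered has been processed unless its `deliver` call still waits for the
window. -/
theorem delivered_le_seq (h : Admissible ρ app F) {a : cfg.AgrId} (ha : a ∉ F.agr) {n s : ℕ}
    {r : Request C W} (hd : ρ.agrIn n a = some (.deliver s r)) {m : ℕ} (hm : n < m) :
    s ≤ (ρ.agr m a).seq ∨ (ρ.agr m a).deliver = .atWindow s r := by
  induction m, hm using Nat.le_induction with
  | base =>
    right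
    rw [(h.agr_some ha hd).2, agr_step_deliver]
  | succ m hm ih =>
    rcases ih with ih | ih
    · exact Or.inl (ih.trans (h.agr_seq_mono ha (Nat.le_succ m)))
    · rcases h.agr_deliver_step ha m with h1 | ⟨s', r', -, h1, -⟩ | ⟨s', r', h1, -, h2, -⟩ |
        ⟨s', r', h1, h2, -⟩ | ⟨s', cp, -, h1, -⟩
      · exact Or.inr (h1.trans ih)
      · simp [ih] at h1
      · rw [ih] at h1
        cases h1
        exact Or.inl h2.ge
      · rw [ih] at h1
        cases h1
        exact Or.inl (h2.trans (h.agr_seq_mono ha (Nat.le_succ m)))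
      · simp [ih] at h1

/-- There are no gaps. By A-Order the predecessor `s - 1` was delivered or collected before. In the
first case it has been processed, since no `deliver` call is open any more; in the second a stable
checkpoint covers it. -/
theorem le_seq_of_deliver (h : Admissible ρ app F) {a : cfg.AgrId} (ha : a ∉ F.agr) {n s : ℕ}
    {r : Request C W} (hd : ρ.agrIn n a = some (.deliver s r)) : s ≤ (ρ.agr n a).seq + 1 := by
  by_contra! hlt
  have hidle : (ρ.agr n a).deliver = .idle := (h.agr_some ha hd).1
  rcases h.comp.agreement.order a ha n s r hd (s - 1) (by omega) (by omega) with
    ⟨k, r', hk, hd'⟩ | ⟨k, q, hk, hq, hg⟩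
  · rcases h.delivered_le_seq ha hd' hk with h1 | h1
    · omega
    · simp [hidle] at h1
  · obtain ⟨s', cp, hs', rfl⟩ := h.agrOut_gc ha hg
    have := h.agr_seq_stable ha hs' hk
    omega

/-- The bound of `le_seq_of_deliver` survives the sleep because `seq` only grows. Together with the
test `seq < s` on waking it gives `s = seq + 1`, so decisions are processed one at a time. -/
theorem agr_atWindow (h : Admissible ρ app F) {a : cfg.AgrId} (ha : a ∉ F.agr) {n s : ℕ}
    {r : Request C W} (hd : (ρ.agr n a).deliver = .atWindow s r) :
    1 ≤ s ∧ s ≤ (ρ.agr n a).seq + 1 ∧ (∃ k, k < n ∧ ρ.agrIn k a = some (.deliver s r)) ∧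
      ρ.decision F s = some r := by
  induction n with
  | zero => simp [h.agr_zero ha, agrAutomaton] at hd
  | succ n ih =>
    have hmono : (ρ.agr n a).seq ≤ (ρ.agr (n + 1) a).seq := h.agr_seq_mono ha (Nat.le_succ n)
    rcases h.agr_deliver_step ha n with h1 | ⟨s', r', h1, -, h2⟩ | ⟨s', r', -, -, -, h1⟩ |
        ⟨s', r', -, -, h1⟩ | ⟨s', cp, -, -, h1⟩
    · obtain ⟨h2, h3, ⟨k, hk, h4⟩, h5⟩ := ih (h1 ▸ hd)
      exact ⟨h2, by omega, ⟨k, by omega, h4⟩, h5⟩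
    · rw [h2] at hd
      cases hd
      have := h.le_seq_of_deliver ha h1
      exact ⟨h.comp.agreement.first a ha _ _ _ h1, by omega, ⟨n, by omega, h1⟩,
        h.decision_eq ha h1⟩
    all_goals simp [h1] at hd

/-- State of an agreement replica after `s` decisions. -/
structure AgrInv (ρ : Run W S U cfg) (F : Faults cfg) (st : AgrState W cfg) : Prop where
  ctr : st.ctr = (ρ.agrCanon F st.seq).ctr
  hist : st.hist = (ρ.agrCanon F st.seq).hist
  decided : ∀ p, 1 ≤ p → p ≤ st.seq → ρ.decision F p ≠ none
  atSend : ∀ s cp, st.deliver = .atSend s cp → 1 ≤ s ∧ s ≤ st.seq ∧ cp = ρ.agrCanon F s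

/-- The induction is strong and covers all replicas at once, because an adopted checkpoint refers to
the state of its creator at an earlier time. A checkpoint may raise `seq` while `deliver` sleeps in
`atSend`; therefore the checkpoint stored there is compared with the canonical one for its own `s`,
not for `seq`. -/
theorem agr_inv (h : Admissible ρ app F) (n : ℕ) :
    ∀ a, a ∉ F.agr → AgrInv ρ F (ρ.agr n a) := by
  induction n using Nat.strong_induction_on with
  | _ n ih =>
  intro a ha
  cases n with
  | zero =>
    rw [h.agr_zero ha]
    constructor <;> simp [agrAutomaton, agrCanon]
    intro p h1 h2; omega
  | succ n =>
    have ihn := ih n (Nat.lt_succ_self n) a ha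
    have hmono : (ρ.agr n a).seq ≤ (ρ.agr (n + 1) a).seq := h.agr_seq_mono ha (Nat.le_succ n)
    have key : (ρ.agr (n + 1) a).ctr = (ρ.agrCanon F (ρ.agr (n + 1) a).seq).ctr ∧
        (ρ.agr (n + 1) a).hist = (ρ.agrCanon F (ρ.agr (n + 1) a).seq).hist ∧
        ∀ p, 1 ≤ p → p ≤ (ρ.agr (n + 1) a).seq → ρ.decision F p ≠ none := by
      rcases h.agr_state_step ha n with ⟨h1, h2, h3⟩ | ⟨r, h1, h2, h3, h4, -⟩ |
        ⟨cp, h1, h2, h3, h4⟩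
      · rw [h1, h2, h3]
        exact ⟨ihn.ctr, ihn.hist, ihn.decided⟩
      · obtain ⟨-, hle, -, hdec⟩ := h.agr_atWindow ha h1
        have hs : (ρ.agr (n + 1) a).seq = (ρ.agr n a).seq + 1 := by omega
        rw [hs] at hdec
        rw [h3, h4, hs, agrCanon_succ hdec, ihn.ctr, ihn.hist]
        refine ⟨rfl, rfl, fun p hp hps => ?_⟩
        rcases Nat.lt_or_ge (ρ.agr n a).seq p with hlt | hge
        · have : p = (ρ.agr n a).seq + 1 := by omega
          simp [this, hdec]
        · exact ihn.decided p hp hge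
      · obtain ⟨k, hk, b, hb, hgen⟩ := h.comp.agrCheckpoints.safety n a ha _ _ h1
        obtain ⟨hd, -, -⟩ := h.agrOut_genCp hb hgen
        have ihb := ih k (by omega) b hb
        obtain ⟨-, hle, hcp⟩ := ihb.atSend _ _ hd
        refine ⟨by rw [h3, hcp], by rw [h4, hcp], fun p hp hps => ihb.decided p hp (by omega)⟩
    refine ⟨key.1, key.2.1, key.2.2, fun s cp hd => ?_⟩
    rcases h.agr_deliver_step ha n with h1 | ⟨s', r', -, -, h1⟩ | ⟨s', r', -, hlt, hs, h1⟩ |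
        ⟨s', r', -, -, h1⟩ | ⟨s', cp, -, -, h1⟩
    · obtain ⟨h2, h3, h4⟩ := ihn.atSend s cp (h1 ▸ hd)
      exact ⟨h2, by omega, h4⟩
    · simp [h1] at hd
    · rw [h1] at hd
      cases hd
      refine ⟨by omega, hs.ge, ?_⟩
      rw [key.1, key.2.1, hs]
    all_goals simp [h1] at hd

theorem agr_genCp (h : Admissible ρ app F) {a : cfg.AgrId} (ha : a ∉ F.agr) {n s : ℕ}
    {cp : AgrCp C W} (ho : ρ.AgrOut n a (.genCp s cp)) :
    1 ≤ s ∧ cp = ρ.agrCanon F s ∧ cfg.ka ∣ s ∧ s ≤ (ρ.agr n a).seq := by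
  obtain ⟨hd, hk, -⟩ := h.agrOut_genCp ha ho
  obtain ⟨h1, h2, h3⟩ := (h.agr_inv n a ha).atSend _ _ hd
  exact ⟨h1, h3, hk, h2⟩

theorem agr_stable (h : Admissible ρ app F) {a : cfg.AgrId} (ha : a ∉ F.agr) {n s : ℕ}
    {cp : AgrCp C W} (hi : ρ.agrIn n a = some (.stable s cp)) :
    1 ≤ s ∧ cp = ρ.agrCanon F s ∧ cfg.ka ∣ s ∧ (∀ p, 1 ≤ p → p ≤ s → ρ.decision F p ≠ none) ∧
      cp.hist.length = min s cfg.capC ∧ ∃ k b, k < n ∧ b ∉ F.agr ∧ ρ.AgrOut k b (.genCp s cp) := by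
  obtain ⟨k, hk, b, hb, hgen⟩ := h.comp.agrCheckpoints.safety n a ha _ _ hi
  obtain ⟨h1, h2, h3, h4⟩ := h.agr_genCp hb hgen
  have hd : ∀ p, 1 ≤ p → p ≤ s → ρ.decision F p ≠ none :=
    fun p hp hps => (h.agr_inv k b hb).decided p hp (hps.trans h4)
  exact ⟨h1, h2, h3, hd, by rw [h2, agrCanon_hist_length hd], k, b, hk, hb, hgen⟩

/-- Whether a message stems from a delivery or from the history of a checkpoint, its content depends
on the position alone. -/
theorem commitSend_eq (h : Admissible ρ app F) {a : cfg.AgrId} (ha : a ∉ F.agr) {n : ℕ}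
    {g : cfg.Group} {p : ℕ} {m : Execute C W} (ho : ρ.AgrOut n a (.commitSend g p m)) :
    m.seq = p ∧ ρ.decision F p = some m.req := by
  obtain ⟨rfl, ⟨r, hm, hd⟩ | ⟨s, cp, hi, hm⟩⟩ := h.agrOut_commitSend ha ho
  · refine ⟨rfl, ?_⟩
    rw [(h.agr_atWindow ha hd).2.2.2, hm]
  · rw [(h.agr_stable ha hi).2.1] at hm
    exact ⟨rfl, (mem_agrCanon_hist hm).2.2⟩

/-- Every position up to the sequence number was sent on all commit channels, or it was dropped by
a checkpoint. -/
theorem commitSend_of_le_seq (h : Admissible ρ app F) {a : cfg.AgrId} (ha : a ∉ F.agr) {n p : ℕ}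
    (hp : 1 ≤ p) (hpn : p ≤ (ρ.agr n a).seq) :
    (∃ k s cp, ρ.agrIn k a = some (.stable s cp) ∧ p + cfg.capC ≤ s) ∨
      ∀ g, ∃ k m, ρ.AgrOut k a (.commitSend g p m) := by
  induction n with
  | zero => simp [h.agr_zero ha, agrAutomaton] at hpn; omega
  | succ n ih =>
    rcases Nat.lt_or_ge (ρ.agr n a).seq p with hlt | hge
    · rcases h.agr_state_step ha n with h1 | ⟨r, h1, h2, h3, h4, -, hout⟩ | ⟨cp, h1, h2, h3, h4⟩
      · omega
      · have := (h.agr_atWindow ha h1).2.1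
        have hs : p = (ρ.agr (n + 1) a).seq := by omega
        exact Or.inr fun g => ⟨n, _, hs ▸ hout g⟩
      · by_cases hcap : p + cfg.capC ≤ (ρ.agr (n + 1) a).seq
        · exact Or.inl ⟨n, _, cp, h1, hcap⟩
        · right
          intro g
          have hst := h.agr_stable ha h1
          obtain ⟨m, hm, rfl⟩ := exists_mem_agrCanon_hist hst.2.2.2.1 hp hpn (by omega)
          rw [← hst.2.1] at hm
          refine ⟨n, m, _, h1, ?_⟩
          rw [agr_step_stable _ _ _ h2]
          -- The position lies above the old sequence number, so the message passes the filter for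
          -- skipped messages and is sent.
          exact Or.inr (Or.inr ⟨g, m, by simp [hm, hlt], rfl⟩)
    · exact ih hge

theorem sent_mono (h : Admissible ρ app F) {a : cfg.AgrId} (ha : a ∉ F.agr) (g : cfg.Group)
    {n m : ℕ} (hnm : n ≤ m) : (ρ.agr n a).sent g ⊆ (ρ.agr m a).sent g :=
  monotone_nat_of_le_succ (f := fun n => (ρ.agr n a).sent g)
    (fun n _ hp => (h.agr_sent_step ha n g _).2 (Or.inl hp)) hnm

theorem sendRet_of_mem_sent (h : Admissible ρ app F) {a : cfg.AgrId} (ha : a ∉ F.agr)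
    {g : cfg.Group} {n p : ℕ} (hp : p ∈ (ρ.agr n a).sent g) :
    ∃ k, k < n ∧ ρ.agrIn k a = some (.executeSent g p) := by
  induction n with
  | zero => simp [h.agr_zero ha, agrAutomaton] at hp
  | succ n ih =>
    rcases (h.agr_sent_step ha n g p).1 hp with h1 | h1
    · obtain ⟨k, hk, h2⟩ := ih h1
      exact ⟨k, by omega, h2⟩
    · exact ⟨n, by omega, h1⟩

end Admissible
end Run
end Spider

/-! ### Execution replicas: atomic steps, outputs and safety. -/

namespace Spider

universe u v w x

namespace Run

variable {C : Type u} {W : Type v} {S : Type w} {U : Type x} {cfg : Config C}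
  {ρ : Run W S U cfg} {app : App W S U} {F : Faults cfg}

/-! ### The transition function of execution replicas -/

section

variable (st : ExecState C S U) (g : cfg.Group) (r : Request C W) (m : Execute C W) (s p : ℕ)
  (c : C) (cp : ExecCp C S U)

open Classical in
theorem exec_step_request (hlt : st.ctr r.client < r.ctr) :
    (execAutomaton cfg app g).step st (.request r) =
      ({ st with ctr := Function.update st.ctr r.client r.ctr },
        {.requestMove r.client r.ctr, .requestSend r.client r.ctr r}) := by
  unfold execAutomaton
  simp only [hlt, if_true]

theorem exec_step_request_old (hlt : ¬ st.ctr r.client < r.ctr) :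
    (execAutomaton cfg app g).step st (.request r) =
      (st, {o | ∃ val, st.last r.client = some (val, r.ctr) ∧
        o = .reply r.client val r.ctr}) := by
  unfold execAutomaton
  simp only [hlt, if_false]

theorem exec_step_callReceive :
    (execAutomaton cfg app g).step st (.callReceive : ExecInput C W S U) =
      ({ st with pending := some (st.seq + 1) }, {.receive (st.seq + 1)}) := rfl

theorem exec_step_execute (hp : st.pending = some (st.seq + 1)) :
    (execAutomaton cfg app g).step st (.execute m) =
      ({ st with
          pending := none
          seq := st.seq + 1
          app := (applyRequest app ⟨st.last, st.app⟩ m.req).app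
          last := (applyRequest app ⟨st.last, st.app⟩ m.req).last },
        {o | (Fresh st.last m.req ∧ cfg.home m.req.client = g ∧
                o = .reply m.req.client (app.exec st.app m.req.op).2 m.req.ctr) ∨
             (cfg.ke ∣ st.seq + 1 ∧
                o = .genCp (st.seq + 1) (applyRequest app ⟨st.last, st.app⟩ m.req))}) := by
  unfold execAutomaton
  simp only [hp, if_true]

theorem exec_step_execute_drop (hp : st.pending ≠ some (st.seq + 1)) :
    (execAutomaton cfg app g).step st (.execute m) = ({ st with pending := none }, ∅) := by
  unfold execAutomaton
  simp only [hp, if_false]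

theorem exec_step_tooOld : (execAutomaton cfg app g).step st (.tooOld p : ExecInput C W S U) =
    ({ st with pending := none }, {.fetchCp (p - 1)}) := rfl

theorem exec_step_stable (hlt : st.seq < s) :
    (execAutomaton cfg app g).step st (.stable s cp : ExecInput C W S U) =
      ({ st with seq := s, app := cp.app, last := cp.last },
        {o | o = .commitMove (s + 1) ∨
          ∃ c val t, cp.last c = some (val, t) ∧ o = .requestMove c t}) := by
  unfold execAutomaton
  simp only [hlt, if_true]

theorem exec_step_stable_old (hlt : ¬ st.seq < s) :
    (execAutomaton cfg app g).step st (.stable s cp : ExecInput C W S U) =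
      (st, {.commitMove (s + 1)}) := by
  unfold execAutomaton
  simp only [hlt, if_false]

theorem exec_step_requestSent :
    (execAutomaton cfg app g).step st (.requestSent c p : ExecInput C W S U) = (st, ∅) := rfl

theorem exec_step_windowMoved :
    (execAutomaton cfg app g).step st (.windowMoved p : ExecInput C W S U) = (st, ∅) := rfl

end

namespace Admissible

/-! ### Atomic steps of execution replicas -/

theorem exec_none (h : Admissible ρ app F) {e : cfg.ExecId} (he : e.2 ∉ F.exec e.1) {n : ℕ}
    (hi : ρ.execIn n e = none) : ρ.exec (n + 1) e = ρ.exec n e :=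
  ((h.prot.exec e he).1.2 n).1 hi

theorem exec_some (h : Admissible ρ app F) {e : cfg.ExecId} (he : e.2 ∉ F.exec e.1) {n : ℕ}
    {i : ExecInput C W S U} (hi : ρ.execIn n e = some i) :
    (execAutomaton cfg app e.1).enabled (ρ.exec n e) i ∧
      ρ.exec (n + 1) e = ((execAutomaton cfg app e.1).step (ρ.exec n e) i).1 :=
  ((h.prot.exec e he).1.2 n).2 i hi

theorem exec_zero (h : Admissible ρ app F) {e : cfg.ExecId} (he : e.2 ∉ F.exec e.1) :
    ρ.exec 0 e = (execAutomaton (W := W) cfg app e.1).init :=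
  (h.prot.exec e he).1.1

theorem exec_state_step (h : Admissible ρ app F) {e : cfg.ExecId} (he : e.2 ∉ F.exec e.1)
    (n : ℕ) :
    ((ρ.exec (n + 1) e).seq = (ρ.exec n e).seq ∧ (ρ.exec (n + 1) e).app = (ρ.exec n e).app ∧
      (ρ.exec (n + 1) e).last = (ρ.exec n e).last) ∨
    (∃ m, ρ.execIn n e = some (.execute m) ∧
      (ρ.exec n e).pending = some ((ρ.exec n e).seq + 1) ∧
      (ρ.exec (n + 1) e).seq = (ρ.exec n e).seq + 1 ∧
      (⟨(ρ.exec (n + 1) e).last, (ρ.exec (n + 1) e).app⟩ : ExecCp C S U) =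
        applyRequest app ⟨(ρ.exec n e).last, (ρ.exec n e).app⟩ m.req) ∨
    (∃ cp, ρ.execIn n e = some (.stable (ρ.exec (n + 1) e).seq cp) ∧
      (ρ.exec n e).seq < (ρ.exec (n + 1) e).seq ∧
      (ρ.exec (n + 1) e).app = cp.app ∧ (ρ.exec (n + 1) e).last = cp.last) := by
  classical
  rcases hi : ρ.execIn n e with _ | i
  · rw [h.exec_none he hi]; simp
  obtain ⟨hen, hs⟩ := h.exec_some he hi
  rw [hs]
  cases i with
  | request r =>
    left
    by_cases hlt : (ρ.exec n e).ctr r.client < r.ctr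
    · simp [exec_step_request _ _ _ hlt]
    · simp [exec_step_request_old _ _ _ hlt]
  | execute m =>
    by_cases hp : (ρ.exec n e).pending = some ((ρ.exec n e).seq + 1)
    · refine Or.inr (Or.inl ⟨m, rfl, hp, ?_⟩)
      rw [exec_step_execute _ _ _ hp]
      exact ⟨rfl, rfl⟩
    · left
      simp [exec_step_execute_drop _ _ _ hp]
  | stable s cp =>
    by_cases hlt : (ρ.exec n e).seq < s
    · refine Or.inr (Or.inr ⟨cp, ?_⟩)
      simp [exec_step_stable _ _ _ _ hlt, hlt]
    · left
      simp [exec_step_stable_old _ _ _ _ hlt]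
  | _ => exact Or.inl ⟨rfl, rfl, rfl⟩

theorem exec_pending_step (h : Admissible ρ app F) {e : cfg.ExecId} (he : e.2 ∉ F.exec e.1)
    (n : ℕ) :
    ((ρ.exec (n + 1) e).pending = (ρ.exec n e).pending ∧
      (∀ m, ρ.execIn n e ≠ some (.execute m)) ∧ ∀ p, ρ.execIn n e ≠ some (.tooOld p)) ∨
    (ρ.execIn n e = some .callReceive ∧ (ρ.exec n e).pending = none ∧
      (ρ.exec (n + 1) e).pending = some ((ρ.exec n e).seq + 1) ∧
      (ρ.exec (n + 1) e).seq = (ρ.exec n e).seq ∧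
      ρ.ExecOut app n e (.receive ((ρ.exec n e).seq + 1))) ∨
    ((ρ.exec n e).pending ≠ none ∧ (ρ.exec (n + 1) e).pending = none ∧
      ((∃ m, ρ.execIn n e = some (.execute m)) ∨
        ∃ p, ρ.execIn n e = some (.tooOld p))) := by
  classical
  rcases hi : ρ.execIn n e with _ | i
  · rw [h.exec_none he hi]; simp
  obtain ⟨hen, hs⟩ := h.exec_some he hi
  rw [hs]
  cases i with
  | request r =>
    left
    by_cases hlt : (ρ.exec n e).ctr r.client < r.ctr
    · simp [exec_step_request _ _ _ hlt]
    · simp [exec_step_request_old _ _ _ hlt]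
  | callReceive =>
    exact Or.inr (Or.inl ⟨rfl, hen, rfl, rfl, _, hi, by simp [exec_step_callReceive]⟩)
  | execute m =>
    refine Or.inr (Or.inr ⟨hen, ?_, Or.inl ⟨m, rfl⟩⟩)
    by_cases hp : (ρ.exec n e).pending = some ((ρ.exec n e).seq + 1)
    · simp [exec_step_execute _ _ _ hp]
    · simp [exec_step_execute_drop _ _ _ hp]
  | tooOld p => exact Or.inr (Or.inr ⟨hen, rfl, Or.inr ⟨p, rfl⟩⟩)
  | stable s cp =>
    left
    by_cases hlt : (ρ.exec n e).seq < s
    · simp [exec_step_stable _ _ _ _ hlt]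
    · simp [exec_step_stable_old _ _ _ _ hlt]
  | _ => exact Or.inl ⟨rfl, by simp, by simp⟩

theorem exec_ctr_step (h : Admissible ρ app F) {e : cfg.ExecId} (he : e.2 ∉ F.exec e.1)
    (n : ℕ) (c : C) :
    (ρ.exec (n + 1) e).ctr c = (ρ.exec n e).ctr c ∨
    ∃ r, ρ.execIn n e = some (.request r) ∧ r.client = c ∧ (ρ.exec (n + 1) e).ctr c = r.ctr ∧
      (ρ.exec n e).ctr c < r.ctr ∧
      ρ.ExecOut app n e (.requestMove c r.ctr) ∧ ρ.ExecOut app n e (.requestSend c r.ctr r) := by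
  classical
  rcases hi : ρ.execIn n e with _ | i
  · rw [h.exec_none he hi]; simp
  obtain ⟨hen, hs⟩ := h.exec_some he hi
  rw [hs]
  cases i with
  | request r =>
    by_cases hlt : (ρ.exec n e).ctr r.client < r.ctr
    · by_cases hc : c = r.client
      · subst hc
        right
        refine ⟨r, rfl, rfl, ?_, hlt, ⟨_, hi, ?_⟩, _, hi, ?_⟩ <;>
          simp [exec_step_request _ _ _ hlt]
      · left
        simp [exec_step_request _ _ _ hlt, Function.update_of_ne hc]
    · left
      simp [exec_step_request_old _ _ _ hlt]
  | execute m =>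
    left
    by_cases hp : (ρ.exec n e).pending = some ((ρ.exec n e).seq + 1)
    · simp [exec_step_execute _ _ _ hp]
    · simp [exec_step_execute_drop _ _ _ hp]
  | stable s cp =>
    left
    by_cases hlt : (ρ.exec n e).seq < s
    · simp [exec_step_stable _ _ _ _ hlt]
    · simp [exec_step_stable_old _ _ _ _ hlt]
  | _ => exact Or.inl rfl

/-! ### Outputs of execution replicas -/

theorem execOut_commitMove {e : cfg.ExecId} {n q : ℕ} (ho : ρ.ExecOut app n e (.commitMove q)) :
    ∃ s cp, ρ.execIn n e = some (.stable s cp) ∧ q = s + 1 := by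
  classical
  obtain ⟨i, hi, ho⟩ := ho
  cases i with
  | request r =>
    by_cases hlt : (ρ.exec n e).ctr r.client < r.ctr
    · simp [exec_step_request _ _ _ hlt] at ho
    · simp [exec_step_request_old _ _ _ hlt] at ho
  | execute m =>
    by_cases hp : (ρ.exec n e).pending = some ((ρ.exec n e).seq + 1)
    · simp [exec_step_execute _ _ _ hp] at ho
    · simp [exec_step_execute_drop _ _ _ hp] at ho
  | stable s cp =>
    refine ⟨s, cp, hi, ?_⟩
    by_cases hlt : (ρ.exec n e).seq < s
    · simpa [exec_step_stable _ _ _ _ hlt] using ho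
    · simpa [exec_step_stable_old _ _ _ _ hlt] using ho
  | callReceive => simp [exec_step_callReceive] at ho
  | tooOld => simp [exec_step_tooOld] at ho
  | requestSent => simp [exec_step_requestSent] at ho
  | windowMoved => simp [exec_step_windowMoved] at ho

theorem execOut_genCp {e : cfg.ExecId} {n s : ℕ} {cp : ExecCp C S U}
    (ho : ρ.ExecOut app n e (.genCp s cp)) :
    ∃ m, ρ.execIn n e = some (.execute m) ∧
      (ρ.exec n e).pending = some ((ρ.exec n e).seq + 1) ∧ s = (ρ.exec n e).seq + 1 ∧
      cp = applyRequest app ⟨(ρ.exec n e).last, (ρ.exec n e).app⟩ m.req := by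
  classical
  obtain ⟨i, hi, ho⟩ := ho
  cases i with
  | request r =>
    by_cases hlt : (ρ.exec n e).ctr r.client < r.ctr
    · simp [exec_step_request _ _ _ hlt] at ho
    · simp [exec_step_request_old _ _ _ hlt] at ho
  | execute m =>
    by_cases hp : (ρ.exec n e).pending = some ((ρ.exec n e).seq + 1)
    · refine ⟨m, hi, hp, ?_⟩
      simp [exec_step_execute _ _ _ hp] at ho
      exact ho.2
    · simp [exec_step_execute_drop _ _ _ hp] at ho
  | stable s cp =>
    by_cases hlt : (ρ.exec n e).seq < s
    · simp [exec_step_stable _ _ _ _ hlt] at ho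
    · simp [exec_step_stable_old _ _ _ _ hlt] at ho
  | callReceive => simp [exec_step_callReceive] at ho
  | tooOld => simp [exec_step_tooOld] at ho
  | requestSent => simp [exec_step_requestSent] at ho
  | windowMoved => simp [exec_step_windowMoved] at ho

theorem execOut_requestSend {e : cfg.ExecId} {n p : ℕ} {c : C} {r : Request C W}
    (ho : ρ.ExecOut app n e (.requestSend c p r)) :
    ρ.execIn n e = some (.request r) ∧ r.client = c ∧ r.ctr = p := by
  classical
  obtain ⟨i, hi, ho⟩ := ho
  cases i with
  | request r =>
    by_cases hlt : (ρ.exec n e).ctr r.client < r.ctr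
    · simp [exec_step_request _ _ _ hlt] at ho
      obtain ⟨rfl, rfl, rfl⟩ := ho
      exact ⟨hi, rfl, rfl⟩
    · simp [exec_step_request_old _ _ _ hlt] at ho
  | execute m =>
    by_cases hp : (ρ.exec n e).pending = some ((ρ.exec n e).seq + 1)
    · simp [exec_step_execute _ _ _ hp] at ho
    · simp [exec_step_execute_drop _ _ _ hp] at ho
  | stable s cp =>
    by_cases hlt : (ρ.exec n e).seq < s
    · simp [exec_step_stable _ _ _ _ hlt] at ho
    · simp [exec_step_stable_old _ _ _ _ hlt] at ho
  | callReceive => simp [exec_step_callReceive] at ho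
  | tooOld => simp [exec_step_tooOld] at ho
  | requestSent => simp [exec_step_requestSent] at ho
  | windowMoved => simp [exec_step_windowMoved] at ho

theorem execOut_requestMove {e : cfg.ExecId} {n p : ℕ} {c : C}
    (ho : ρ.ExecOut app n e (.requestMove c p)) :
    (∃ r, ρ.execIn n e = some (.request r) ∧ r.client = c ∧ r.ctr = p) ∨
      ∃ s cp val, ρ.execIn n e = some (.stable s cp) ∧ cp.last c = some (val, p) := by
  classical
  obtain ⟨i, hi, ho⟩ := ho
  cases i with
  | request r =>
    by_cases hlt : (ρ.exec n e).ctr r.client < r.ctr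
    · simp [exec_step_request _ _ _ hlt] at ho
      obtain ⟨rfl, rfl⟩ := ho
      exact Or.inl ⟨r, hi, rfl, rfl⟩
    · simp [exec_step_request_old _ _ _ hlt] at ho
  | execute m =>
    by_cases hp : (ρ.exec n e).pending = some ((ρ.exec n e).seq + 1)
    · simp [exec_step_execute _ _ _ hp] at ho
    · simp [exec_step_execute_drop _ _ _ hp] at ho
  | stable s cp =>
    by_cases hlt : (ρ.exec n e).seq < s
    · simp [exec_step_stable _ _ _ _ hlt] at ho
      obtain ⟨val, hv⟩ := ho
      exact Or.inr ⟨s, cp, val, hi, hv⟩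
    · simp [exec_step_stable_old _ _ _ _ hlt] at ho
  | callReceive => simp [exec_step_callReceive] at ho
  | tooOld => simp [exec_step_tooOld] at ho
  | requestSent => simp [exec_step_requestSent] at ho
  | windowMoved => simp [exec_step_windowMoved] at ho

theorem execOut_reply {e : cfg.ExecId} {n t : ℕ} {c : C} {val : U}
    (ho : ρ.ExecOut app n e (.reply c val t)) :
    (ρ.exec n e).last c = some (val, t) ∨
      ∃ m, ρ.execIn n e = some (.execute m) ∧
        (ρ.exec n e).pending = some ((ρ.exec n e).seq + 1) ∧
        (applyRequest app ⟨(ρ.exec n e).last, (ρ.exec n e).app⟩ m.req).last c =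
          some (val, t) := by
  classical
  obtain ⟨i, hi, ho⟩ := ho
  cases i with
  | request r =>
    by_cases hlt : (ρ.exec n e).ctr r.client < r.ctr
    · simp [exec_step_request _ _ _ hlt] at ho
    · simp [exec_step_request_old _ _ _ hlt] at ho
      obtain ⟨hv, rfl, rfl⟩ := ho
      exact Or.inl hv
  | execute m =>
    by_cases hp : (ρ.exec n e).pending = some ((ρ.exec n e).seq + 1)
    · refine Or.inr ⟨m, hi, hp, ?_⟩
      simp [exec_step_execute _ _ _ hp] at ho
      obtain ⟨hf, -, rfl, rfl, rfl⟩ := ho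
      simp [applyRequest, hf]
    · simp [exec_step_execute_drop _ _ _ hp] at ho
  | stable s cp =>
    by_cases hlt : (ρ.exec n e).seq < s
    · simp [exec_step_stable _ _ _ _ hlt] at ho
    · simp [exec_step_stable_old _ _ _ _ hlt] at ho
  | callReceive => simp [exec_step_callReceive] at ho
  | tooOld => simp [exec_step_tooOld] at ho
  | requestSent => simp [exec_step_requestSent] at ho
  | windowMoved => simp [exec_step_windowMoved] at ho

theorem execStable_outputs {e : cfg.ExecId} {n s : ℕ} {cp : ExecCp C S U}
    (hi : ρ.execIn n e = some (.stable s cp)) : ρ.ExecOut app n e (.commitMove (s + 1)) := by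
  refine ⟨_, hi, ?_⟩
  by_cases hlt : (ρ.exec n e).seq < s
  · simp [exec_step_stable _ _ _ _ hlt]
  · simp [exec_step_stable_old _ _ _ _ hlt]

/-! ### Invariants of execution replicas -/

theorem exec_seq_mono (h : Admissible ρ app F) {e : cfg.ExecId} (he : e.2 ∉ F.exec e.1) :
    Monotone fun n => (ρ.exec n e).seq := by
  refine monotone_nat_of_le_succ fun n => ?_
  rcases h.exec_state_step he n with h1 | ⟨_, -, -, h1, -⟩ | ⟨_, -, h1, -⟩
  · exact h1.1.ge
  · exact h1.symm ▸ Nat.le_succ _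
  · exact h1.le

theorem exec_seq_stable (h : Admissible ρ app F) {e : cfg.ExecId} (he : e.2 ∉ F.exec e.1)
    {n s : ℕ} {cp : ExecCp C S U} (hi : ρ.execIn n e = some (.stable s cp)) {m : ℕ} (hm : n < m) :
    s ≤ (ρ.exec m e).seq := by
  refine le_trans ?_ (h.exec_seq_mono he hm)
  have hs := (h.exec_some he hi).2
  by_cases hlt : (ρ.exec n e).seq < s
  · simp [hs, exec_step_stable _ _ _ _ hlt]
  · simpa [hs, exec_step_stable_old _ _ _ _ hlt] using hlt

/-- Channel properties speak of calls, the automaton of its `pending` field. The last clause says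
that the call has not been answered yet, so a return promised by the channel must still lie ahead.
-/
theorem exec_pending_call (h : Admissible ρ app F) {e : cfg.ExecId} (he : e.2 ∉ F.exec e.1)
    {n p : ℕ} (hp : (ρ.exec n e).pending = some p) :
    ∃ k, k < n ∧ ρ.ExecOut app k e (.receive p) ∧ (ρ.exec (k + 1) e).seq + 1 = p ∧
      ∀ m, k < m → m < n → (∀ x, ρ.execIn m e ≠ some (.execute x)) ∧
        ∀ q, ρ.execIn m e ≠ some (.tooOld q) := by
  induction n with
  | zero => simp [h.exec_zero he, execAutomaton] at hp
  | succ n ih =>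
    rcases h.exec_pending_step he n with ⟨h1, h2, h3⟩ | ⟨-, -, h2, h3, h4⟩ | ⟨-, h1, -⟩
    · obtain ⟨k, hk, ho, hs, hm⟩ := ih (h1 ▸ hp)
      refine ⟨k, by omega, ho, hs, fun m hkm hmn => ?_⟩
      rcases Nat.lt_or_ge m n with hlt | hge
      · exact hm m hkm hlt
      · have : m = n := by omega
        subst this
        exact ⟨h2, h3⟩
    · rw [h2] at hp
      cases hp
      exact ⟨n, by omega, h4, by rw [h3], fun m h5 h6 => by omega⟩
    · simp [h1] at hp

theorem exec_pending_le (h : Admissible ρ app F) {e : cfg.ExecId} (he : e.2 ∉ F.exec e.1)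
    {n p : ℕ} (hp : (ρ.exec n e).pending = some p) : 1 ≤ p ∧ p ≤ (ρ.exec n e).seq + 1 := by
  obtain ⟨k, hk, -, hs, -⟩ := h.exec_pending_call he hp
  have := h.exec_seq_mono he hk
  simp only [Nat.succ_eq_add_one] at this
  omega

/-- An outstanding `receive` call at a skipped position: a checkpoint has covered it. -/
theorem exec_pending_stale (h : Admissible ρ app F) {e : cfg.ExecId} (he : e.2 ∉ F.exec e.1)
    {n p : ℕ} (hp : (ρ.exec n e).pending = some p) (hle : p ≤ (ρ.exec n e).seq) :
    ∃ k s cp, ρ.execIn k e = some (.stable s cp) ∧ p ≤ s := by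
  induction n with
  | zero => simp [h.exec_zero he, execAutomaton] at hp
  | succ n ih =>
    rcases h.exec_state_step he n with ⟨h1, -⟩ | ⟨m, h1, h2, -⟩ | ⟨cp, h1, -⟩
    · rcases h.exec_pending_step he n with ⟨h2, -⟩ | ⟨-, -, h2, -⟩ | ⟨-, h2, -⟩
      · exact ih (h2 ▸ hp) (h1 ▸ hle)
      · rw [h2] at hp
        cases hp
        omega
      · simp [h2] at hp
    · have := (h.exec_some he h1).2
      rw [this, exec_step_execute _ _ _ h2] at hp
      simp at hp
    · exact ⟨n, _, cp, h1, hle⟩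

/-- IRMC-Correctness I traces the message back to a correct sender, to which `commitSend_eq`
applies. -/
theorem exec_received (h : Admissible ρ app F) {g : cfg.Group} {i : cfg.Member}
    (he : i ∉ F.exec g) {n p : ℕ} {m : Execute C W}
    (hi : ρ.execIn n (g, i) = some (.execute m)) (hp : (ρ.exec n (g, i)).pending = some p) :
    ρ.decision F p = some m.req := by
  obtain ⟨⟨k, -, a, ha, hs⟩, -⟩ :=
    (h.comp.commitChannel g).correctness1 n i he () p m ⟨hp, hi⟩
  exact (h.commitSend_eq ha hs).2

/-- As for agreement replicas, strong induction on time is needed for the adoption of a checkpoint: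
its creator was in the canonical state before the step that produced it. -/
theorem exec_inv (h : Admissible ρ app F) (n : ℕ) :
    ∀ e : cfg.ExecId, e.2 ∉ F.exec e.1 →
      (⟨(ρ.exec n e).last, (ρ.exec n e).app⟩ : ExecCp C S U) =
        ρ.execCanon app F (ρ.exec n e).seq := by
  induction n using Nat.strong_induction_on with
  | _ n ih =>
  intro e he
  cases n with
  | zero => rw [h.exec_zero he]; rfl
  | succ n =>
    rcases h.exec_state_step he n with ⟨h1, h2, h3⟩ | ⟨m, h1, h2, h3, h4⟩ | ⟨cp, h1, h2, h3, h4⟩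
    · rw [h1, h2, h3]
      exact ih n (Nat.lt_succ_self n) e he
    · rw [h4, h3, execCanon_succ (h.exec_received he h1 h2), ih n (Nat.lt_succ_self n) e he]
    · obtain ⟨k, hk, b, hb, hgen⟩ := h.comp.execCheckpoints.safety n e he _ _ h1
      obtain ⟨m, h5, h6, h7, h8⟩ := execOut_genCp hgen
      rw [h3, h4, h7, execCanon_succ (h.exec_received hb h5 h6), ← ih k (by omega) b hb, ← h8]

theorem exec_genCp (h : Admissible ρ app F) {e : cfg.ExecId} (he : e.2 ∉ F.exec e.1)
    {n s : ℕ} {cp : ExecCp C S U} (ho : ρ.ExecOut app n e (.genCp s cp)) :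
    cp = ρ.execCanon app F s := by
  obtain ⟨m, h5, h6, h7, h8⟩ := execOut_genCp ho
  rw [h7, execCanon_succ (h.exec_received he h5 h6), ← h.exec_inv n e he, ← h8]

theorem exec_stable (h : Admissible ρ app F) {e : cfg.ExecId} (he : e.2 ∉ F.exec e.1)
    {n s : ℕ} {cp : ExecCp C S U} (hi : ρ.execIn n e = some (.stable s cp)) :
    cp = ρ.execCanon app F s := by
  obtain ⟨k, hk, b, hb, hgen⟩ := h.comp.execCheckpoints.safety n e he _ _ hi
  exact h.exec_genCp hb hgen

end Admissible
end Run
end Spider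

/-! ### Skipped positions, and the progress of execution groups. -/

namespace Spider

universe u v w x

/-- A monotone sequence that starts below `y` and reaches `y` crosses `y` at some step. -/
theorem exists_crossing {f : ℕ → ℕ} {y n : ℕ} (h0 : f 0 < y) (hn : y ≤ f n) :
    ∃ m, f m < y ∧ y ≤ f (m + 1) := by
  induction n with
  | zero => omega
  | succ n ih =>
    rcases Nat.lt_or_ge (f n) y with hlt | hge
    · exact ⟨n, hlt, hn⟩
    · exact ih hge

namespace Faults

variable {C : Type u} {cfg : Config C} (F : Faults cfg)

/-- The correct replicas of an execution group. -/
def okExec (g : cfg.Group) : Finset cfg.Member := Finset.univ.filter (· ∉ F.exec g)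

/-- The correct agreement replicas. -/
def okAgr : Finset cfg.AgrId := Finset.univ.filter (· ∉ F.agr)

variable {F}

theorem mem_okExec {g : cfg.Group} {i : cfg.Member} : i ∈ F.okExec g ↔ i ∉ F.exec g := by
  simp [okExec]

theorem mem_okAgr {a : cfg.AgrId} : a ∈ F.okAgr ↔ a ∉ F.agr := by
  simp [okAgr]

theorem card_okExec (g : cfg.Group) : cfg.fe + 1 ≤ (F.okExec g).card := by
  have h1 : F.okExec g = (F.exec g)ᶜ := by ext; simp [okExec]
  have h2 := F.exec_card g
  rw [h1, Finset.card_compl, Fintype.card_fin]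
  omega

theorem card_okAgr : 2 * cfg.fa + 1 ≤ F.okAgr.card := by
  have h1 : F.okAgr = F.agrᶜ := by ext; simp [okAgr]
  have h2 := F.agr_card
  rw [h1, Finset.card_compl, Fintype.card_fin]
  omega

end Faults

namespace Run

variable {C : Type u} {W : Type v} {S : Type w} {U : Type x} {cfg : Config C}
  {ρ : Run W S U cfg} {app : App W S U} {F : Faults cfg}

theorem HasCheckpoint.mono {n n' s s' : ℕ} {g : cfg.Group} (hc : ρ.HasCheckpoint F n g s)
    (hn : n ≤ n') (hs : s' ≤ s) : ρ.HasCheckpoint F n' g s' := by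
  obtain ⟨j, hj, k, t, cp, hk, ht, hi⟩ := hc
  exact ⟨j, hj, k, t, cp, by omega, by omega, hi⟩

theorem ncard_hasCheckpoint_mono {n n' s s' : ℕ} (hn : n ≤ n') (hs : s' ≤ s) :
    Set.ncard {g : cfg.Group | ρ.HasCheckpoint F n g s} ≤
      Set.ncard {g : cfg.Group | ρ.HasCheckpoint F n' g s'} :=
  Set.ncard_le_ncard (fun _ hg => HasCheckpoint.mono hg hn hs) (Set.toFinite _)

namespace Admissible

/-! ### Skipped positions are covered by execution checkpoints -/

/-- A stable agreement checkpoint for `s` implies that `ne - z` execution groups have checkpoints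
for at least `s - capC`. -/
theorem ncard_hasCheckpoint_of_stable (h : Admissible ρ app F) (n : ℕ) :
    ∀ a, a ∉ F.agr → ∀ s cp, ρ.agrIn n a = some (.stable s cp) → cfg.capC < s →
      cfg.ne - cfg.z ≤ Set.ncard {g : cfg.Group | ρ.HasCheckpoint F n g (s - cfg.capC)} := by
  induction n using Nat.strong_induction_on with
  | _ n ih =>
  intro a ha s cp hi hs
  obtain ⟨-, -, -, -, -, k, b, hk, hb, hgen⟩ := h.agr_stable ha hi
  obtain ⟨-, -, hcard⟩ := h.agrOut_genCp hb hgen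
  -- Either an earlier stable agreement checkpoint reaches at least `s`, and the induction
  -- hypothesis for it suffices, or none does. In the latter case only execution replicas can have
  -- opened the windows for position `s`.
  by_cases hex : ∃ n', n' < n ∧ ∃ a, a ∉ F.agr ∧ ∃ s' cp',
      ρ.agrIn n' a = some (.stable s' cp') ∧ s ≤ s'
  · obtain ⟨n', hn', a', ha', s', cp', hi', hs'⟩ := hex
    exact (ih n' hn' a' ha' s' cp' hi' (by omega)).trans
      (ncard_hasCheckpoint_mono hn'.le (by omega))
  · refine hcard.trans (Set.ncard_le_ncard (fun g hg => ?_) (Set.toFinite _))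
    obtain ⟨l, hl, hret⟩ := h.sendRet_of_mem_sent hb hg
    rcases (h.comp.commitChannel g).send_blocks l b hb () s hret with hlt | ⟨q, hq, hlt⟩
    · omega
    · obtain ⟨n', p, hn', hqp, ⟨a', ha', hm⟩ | ⟨j, hj, hm⟩⟩ := hq
      -- Since `s > capC`, a move of this size can only come from a checkpoint with `s' ≥ s`, which
      -- `hex` excludes.
      · obtain ⟨s', cp', hi', rfl⟩ := h.agrOut_commitMove ha' hm
        have hlen := (h.agr_stable ha' hi').2.2.2.2.1
        exact (hex ⟨n', by omega, a', ha', s', cp', hi', by omega⟩).elim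
      · obtain ⟨s', cp', hi', rfl⟩ := execOut_commitMove hm
        exact ⟨j, hj, n', s', cp', by omega, by omega, hi'⟩

/-- By IRMC-Correctness II some correct replica has asked for the skip. If it belongs to the group
itself, it holds a checkpoint; if it is an agreement replica, its stable checkpoint is covered by
`ne - z` groups. -/
theorem hasCheckpoint_of_tooOld (h : Admissible ρ app F) {g : cfg.Group} {i : cfg.Member}
    (hi : i ∉ F.exec g) {n p : ℕ} (ht : ρ.execIn n (g, i) = some (.tooOld p)) :
    ρ.HasCheckpoint F n g (p - 1) ∨
      cfg.ne - cfg.z ≤ Set.ncard {g' : cfg.Group | ρ.HasCheckpoint F n g' (p - 1)} := by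
  obtain ⟨p₀, hp₀⟩ := Option.ne_none_iff_exists'.1 (h.exec_some (e := (g, i)) hi ht).1
  have hpos := (h.exec_pending_le (e := (g, i)) hi hp₀).1
  obtain ⟨hlt, n', q, hn', hq, ⟨a, ha, hm⟩ | ⟨j, hj, hm⟩⟩ :=
    (h.comp.commitChannel g).correctness2 n i hi () p₀ p ⟨hp₀, ht⟩
  · obtain ⟨s, cp, hs, rfl⟩ := h.agrOut_commitMove ha hm
    have hlen := (h.agr_stable ha hs).2.2.2.2.1
    -- As `p > p₀ ≥ 1`, the move goes beyond `1`, so the history was full and `s > capC`; the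
    -- requested position is `s + 1 - capC`, hence `p - 1 ≤ s - capC`.
    exact Or.inr ((h.ncard_hasCheckpoint_of_stable n' a ha s cp hs (by omega)).trans
      (ncard_hasCheckpoint_mono hn'.le (by omega)))
  · obtain ⟨s, cp, hs, rfl⟩ := execOut_commitMove hm
    exact Or.inl ⟨j, hj, n', s, cp, hn', by omega, hs⟩

/-- A single holder in any group is enough for `fetch_cp`, and `z < ne` provides one even if it is
not in the replica's own group. Callbacks of execution replicas never sleep, so the proviso of the
component is void. -/
theorem stable_of_tooOld (h : Admissible ρ app F) {g : cfg.Group} {i : cfg.Member}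
    (hi : i ∉ F.exec g) {n p : ℕ} (ht : ρ.execIn n (g, i) = some (.tooOld p)) :
    ∃ n' s cp, p - 1 ≤ s ∧ ρ.execIn n' (g, i) = some (.stable s cp) := by
  have hex : ∃ g', ρ.HasCheckpoint F n g' (p - 1) := by
    rcases h.hasCheckpoint_of_tooOld hi ht with h1 | h1
    · exact ⟨g, h1⟩
    · have hz := cfg.z_lt
      have hne : Set.ncard {g' : cfg.Group | ρ.HasCheckpoint F n g' (p - 1)} ≠ 0 := by omega
      exact Set.nonempty_of_ncard_ne_zero hne
  obtain ⟨g', j, hj, n', s', cp, -, hs', hst⟩ := hex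
  have hfetch : ρ.ExecOut app n (g, i) (.fetchCp (p - 1)) :=
    ⟨_, ht, by simp [exec_step_tooOld]⟩
  rcases h.comp.execCheckpoints.fetch n (g, i) hi _ hfetch ⟨n', (g', j), hj, s', cp, hs', hst⟩ with
    h1 | ⟨k, hk⟩
  · exact h1
  · exact (hk k le_rfl).elim

theorem seq_of_tooOld (h : Admissible ρ app F) {g : cfg.Group} {i : cfg.Member}
    (hi : i ∉ F.exec g) {n p : ℕ} (ht : ρ.execIn n (g, i) = some (.tooOld p)) :
    ∃ n', ∀ k, n' ≤ k → p - 1 ≤ (ρ.exec k (g, i)).seq := by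
  obtain ⟨n', s, cp, hs, hst⟩ := h.stable_of_tooOld hi ht
  exact ⟨n' + 1, fun k hk => hs.trans (h.exec_seq_stable (e := (g, i)) hi hst hk)⟩

/-! ### Execution checkpoints open the commit channels -/

/-- A checkpoint that is stable at one correct replica of an execution group moves the windows of
all of them. -/
theorem reaches_of_stable (h : Admissible ρ app F) {g : cfg.Group} {i j : cfg.Member}
    (hi : i ∉ F.exec g) (hj : j ∉ F.exec g) {n s : ℕ} {cp : ExecCp C S U}
    (hst : ρ.execIn n (g, i) = some (.stable s cp)) :
    (ρ.commitChannel app g).Reaches j () (s + 1) := by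
  rcases h.comp.execCheckpoints.liveness n (g, i) hi (g, j) hj s cp rfl hst with
    ⟨k, hk⟩ | ⟨k, s', cp', hs', hk⟩ | ⟨k, hk⟩
  · exact ⟨k + 1, s + 1, le_rfl, Or.inr ⟨k, by omega, Or.inl (execStable_outputs hk)⟩⟩
  · exact ⟨k + 1, s' + 1, by omega, Or.inr ⟨k, by omega, Or.inl (execStable_outputs hk)⟩⟩
  · exact (hk k le_rfl).elim

/-- The windows of all correct receivers of the group start at `s + 1` or later, for `s = 0` already
initially. There are at least `fe + 1` such receivers, so IRMC-Liveness II releases all positions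
below `s + 1 + capC`. -/
theorem commitSend_returns_of_stable (h : Admissible ρ app F) {g : cfg.Group} {s : ℕ}
    (hs : s = 0 ∨ ∃ i, i ∉ F.exec g ∧ ∃ n s' cp, s ≤ s' ∧
      ρ.execIn n (g, i) = some (.stable s' cp)) {a : cfg.AgrId} (ha : a ∉ F.agr) {n p : ℕ}
    {m : Execute C W} (hc : ρ.AgrOut n a (.commitSend g p m)) (hp : p ≤ s + cfg.capC) :
    ∃ k, ρ.agrIn k a = some (.executeSent g p) := by
  have hreach : ∀ j ∈ F.okExec g,
      j ∉ F.exec g ∧ (ρ.commitChannel app g).Reaches j () (s + 1) := by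
    refine fun j hj => ⟨Faults.mem_okExec.1 hj, ?_⟩
    rcases hs with rfl | ⟨i, hi, l, s', cp, hs', hst⟩
    · exact ⟨0, 1, le_rfl, Or.inl rfl⟩
    · obtain ⟨x, q, hq, hw⟩ := h.reaches_of_stable hi (Faults.mem_okExec.1 hj) hst
      exact ⟨x, q, by omega, hw⟩
  obtain ⟨k, -, hk⟩ := (h.comp.commitChannel g).liveness2 () (s + 1) (F.okExec g)
    (Faults.card_okExec g) hreach n a ha p m hc (by omega)
  exact ⟨k, hk⟩

/-! ### `stable_cp` calls of agreement replicas return -/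

theorem exists_mem_sent (h : Admissible ρ app F) {a : cfg.AgrId} (ha : a ∉ F.agr)
    {g : cfg.Group} {l : List ℕ}
    (hl : ∀ p ∈ l, ∃ k, ρ.agrIn k a = some (.executeSent g p)) :
    ∃ N, ∀ n, N ≤ n → ∀ p ∈ l, p ∈ (ρ.agr n a).sent g := by
  induction l with
  | nil => exact ⟨0, by simp⟩
  | cons p l ih =>
    obtain ⟨N, hN⟩ := ih fun q hq => hl q (List.mem_cons_of_mem _ hq)
    obtain ⟨k, hk⟩ := hl p List.mem_cons_self
    refine ⟨max N (k + 1), fun n hn q hq => ?_⟩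
    rcases List.mem_cons.1 hq with rfl | hq
    · exact h.sent_mono ha g (le_of_max_le_right hn)
        ((h.agr_sent_step ha k g q).2 (Or.inr hk))
    · exact hN n (le_of_max_le_left hn) q hq

/-- If the `send` calls for the positions in `l` return at the groups in `G`, then at some time
all of them have returned. -/
theorem exists_sent_groups (h : Admissible ρ app F) {a : cfg.AgrId} (ha : a ∉ F.agr)
    {G : Set cfg.Group} {l : List ℕ}
    (hl : ∀ g ∈ G, ∀ p ∈ l, ∃ k, ρ.agrIn k a = some (.executeSent g p)) :
    ∃ N, ∀ n, N ≤ n → G ⊆ {g | ∀ p ∈ l, p ∈ (ρ.agr n a).sent g} := by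
  have hN : ∀ g : cfg.Group, ∃ N, g ∈ G → ∀ n, N ≤ n → ∀ p ∈ l, p ∈ (ρ.agr n a).sent g := by
    intro g
    by_cases hg : g ∈ G
    · obtain ⟨N, hN⟩ := h.exists_mem_sent ha (hl g hg)
      exact ⟨N, fun _ => hN⟩
    · exact ⟨0, fun hg' => (hg hg').elim⟩
  choose N hN using hN
  exact ⟨Finset.univ.sup N, fun n hn g hg =>
    hN g hg n ((Finset.le_sup (Finset.mem_univ g)).trans hn)⟩

theorem stable_call_info (h : Admissible ρ app F) {a : cfg.AgrId} (ha : a ∉ F.agr) {n s : ℕ}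
    {l : List (Execute C W)} (hst : (ρ.agr n a).stable = .atSend s l) :
    ∃ k cp, k < n ∧ ρ.agrIn k a = some (.stable s cp) ∧
      ∀ m ∈ l, m ∈ cp.hist ∧ ∀ g, ρ.AgrOut k a (.commitSend g m.seq m) := by
  induction n with
  | zero => simp [h.agr_zero ha, agrAutomaton] at hst
  | succ n ih =>
    rcases h.agr_stable_step ha n with ⟨h1, -⟩ | ⟨s', cp, hi, -, ⟨l', h1, h2, -⟩ | ⟨h1, -⟩⟩ |
      ⟨s', l', -, -, h1, -⟩
    · obtain ⟨k, cp, hk, h2⟩ := ih (h1 ▸ hst)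
      exact ⟨k, cp, by omega, h2⟩
    · rw [h1] at hst
      cases hst
      exact ⟨n, cp, by omega, hi, h2⟩
    · simp [h1] at hst
    · simp [h1] at hst

/-- The skipped messages have positions at most `s`, and `ne - z` groups hold execution checkpoints
for at least `s - capC`, so the sends to these groups return. Weak fairness then ends the call. -/
theorem stable_returns (h : Admissible ρ app F) {a : cfg.AgrId} (ha : a ∉ F.agr) {n s : ℕ}
    {l : List (Execute C W)} (hst : (ρ.agr n a).stable = .atSend s l) :
    ∃ m, n ≤ m ∧ ρ.agrIn m a = some .stableFinish ∧ (ρ.agr m a).stable = .atSend s l := by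
  by_contra! hno
  have hstay : ∀ m, n ≤ m → (ρ.agr m a).stable = .atSend s l := by
    intro m hm
    induction m, hm using Nat.le_induction with
    | base => exact hst
    | succ m hm ih =>
      rcases h.agr_stable_step ha m with ⟨h1, -⟩ | ⟨s', cp, hi, h1, -⟩ | ⟨s', l', h1, h2, -⟩
      · exact h1.trans ih
      · simp [ih] at h1
      · exact (hno m hm h1 ih).elim
  obtain ⟨k, cp, -, hi, hl⟩ := h.stable_call_info ha hst
  have hcp := h.agr_stable ha hi
  obtain ⟨G, hG, hret⟩ : ∃ G : Set cfg.Group, cfg.ne - cfg.z ≤ G.ncard ∧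
      ∀ g ∈ G, ∀ p ∈ l.map (·.seq), ∃ k, ρ.agrIn k a = some (.executeSent g p) := by
    have hle : ∀ m ∈ l, m.seq ≤ s := fun m hm => by
      have hm' := (hl m hm).1
      rw [hcp.2.1] at hm'
      exact (mem_agrCanon_hist hm').2.1
    rcases Nat.lt_or_ge cfg.capC s with hlt | hge
    · refine ⟨_, h.ncard_hasCheckpoint_of_stable k a ha s cp hi hlt, fun g hg p hp => ?_⟩
      obtain ⟨m, hm, rfl⟩ := List.mem_map.1 hp
      obtain ⟨j, hj, n', s', cp', -, hs', hst'⟩ := hg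
      exact h.commitSend_returns_of_stable (s := s - cfg.capC)
        (Or.inr ⟨j, hj, n', s', cp', hs', hst'⟩) ha ((hl m hm).2 g)
        (by have := hle m hm; omega)
    · refine ⟨Set.univ, by simp [Set.ncard_univ], fun g hg p hp => ?_⟩
      obtain ⟨m, hm, rfl⟩ := List.mem_map.1 hp
      exact h.commitSend_returns_of_stable (s := 0) (Or.inl rfl) ha ((hl m hm).2 g)
        (by have := hle m hm; omega)
  obtain ⟨N, hN⟩ := h.exists_sent_groups ha hret
  obtain ⟨m, hm, hfin⟩ := (h.prot.agr a ha).2 .stableFinish trivial (max n N) fun m hm => by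
    refine ⟨s, l, hstay m (le_of_max_le_left hm), hG.trans ?_⟩
    refine Set.ncard_le_ncard (fun g hg x hx => ?_) (Set.toFinite _)
    exact hN m (le_of_max_le_right hm) hg _ (List.mem_map_of_mem hx)
  exact hno m (le_of_max_le_left hm) hfin (hstay m (le_of_max_le_left hm))

/-- This discharges the proviso in the liveness properties of the agreement checkpoint component. -/
theorem not_stable_busy (h : Admissible ρ app F) {a : cfg.AgrId} (ha : a ∉ F.agr) (n : ℕ) :
    ¬ ∀ m, n ≤ m → (ρ.agr m a).stable ≠ .idle := by
  intro hb
  rcases hst : (ρ.agr n a).stable with _ | ⟨s, l⟩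
  · exact hb n le_rfl hst
  · obtain ⟨m, hm, hi, hst'⟩ := h.stable_returns ha hst
    refine hb (m + 1) (by omega) ?_
    rw [(h.agr_some ha hi).2, agr_step_stableFinish _ _ hst']

/-- An agreement checkpoint that is stable at one correct replica (or a newer one) becomes stable
at all of them. -/
theorem agr_stable_all (h : Admissible ρ app F) {a b : cfg.AgrId} (ha : a ∉ F.agr)
    (hb : b ∉ F.agr) {n s : ℕ} {cp : AgrCp C W} (hi : ρ.agrIn n a = some (.stable s cp)) :
    ∃ k s' cp', s ≤ s' ∧ ρ.agrIn k b = some (.stable s' cp') := by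
  rcases h.comp.agrCheckpoints.liveness n a ha b hb s cp rfl hi with
    ⟨k, hk⟩ | ⟨k, s', cp', hs', hk⟩ | ⟨k, hk⟩
  · exact ⟨k, s, cp, le_rfl, hk⟩
  · exact ⟨k, s', cp', hs'.le, hk⟩
  · exact (h.not_stable_busy hb k hk).elim

/-- All correct agreement replicas obtain this checkpoint or a newer one and ask for a move to at
least `q`, since a history has at most `capC` entries. There are more than `fa` of them, so
IRMC-Liveness III applies. -/
theorem reaches_of_agr_stable (h : Admissible ρ app F) {a : cfg.AgrId} (ha : a ∉ F.agr)
    {n s : ℕ} {cp : AgrCp C W} (hi : ρ.agrIn n a = some (.stable s cp)) {g : cfg.Group}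
    {i : cfg.Member} (hg : i ∉ F.exec g) {q : ℕ} (hq : q + cfg.capC ≤ s + 1) :
    (ρ.commitChannel app g).Reaches i () q := by
  refine (h.comp.commitChannel g).liveness3 () q F.okAgr
    ((by omega : cfg.fa + 1 ≤ 2 * cfg.fa + 1).trans Faults.card_okAgr) (fun b hb => ?_) i hg
  obtain ⟨k, s', cp', hs', hk⟩ := h.agr_stable_all ha (Faults.mem_okAgr.1 hb) hi
  have hlen := (h.agr_stable (Faults.mem_okAgr.1 hb) hk).2.2.2.2.1
  exact ⟨Faults.mem_okAgr.1 hb, k, _, by omega, (stable_outputs hk).2 g⟩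

/-! ### Progress of execution replicas -/

/-- An outstanding `receive` call returns if the channel makes all such calls return. -/
theorem pending_returns (h : Admissible ρ app F) {g : cfg.Group} {i : cfg.Member}
    (hi : i ∉ F.exec g) {n p : ℕ} (hp : (ρ.exec n (g, i)).pending = some p)
    (hret : ∀ k, ρ.ExecOut app k (g, i) (.receive p) →
      ∃ k', k < k' ∧ (ρ.commitChannel app g).RecvRet k' i () p) :
    ∃ k, n ≤ k ∧ (ρ.exec k (g, i)).pending = some p ∧
      ((∃ p', ρ.execIn k (g, i) = some (.tooOld p')) ∨
        ∃ m, ρ.execIn k (g, i) = some (.execute m)) := by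
  obtain ⟨k, hk, ho, -, hno⟩ := h.exec_pending_call (e := (g, i)) hi hp
  obtain ⟨k', hk', hr⟩ := hret k ho
  -- A return before time `n` would have answered the call that is still outstanding at `n`.
  have hge : n ≤ k' := by
    by_contra! hlt
    have hno' := hno k' hk' hlt
    rcases hr with ⟨m, -, hm⟩ | ⟨p', -, hm⟩
    · exact hno'.1 m hm
    · exact hno'.2 p' hm
  rcases hr with ⟨m, hm', hm⟩ | ⟨p', hm', hm⟩
  · exact ⟨k', hge, hm', Or.inr ⟨m, hm⟩⟩
  · exact ⟨k', hge, hm', Or.inl ⟨p', hm⟩⟩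

theorem exec_calls_receive (h : Admissible ρ app F) {e : cfg.ExecId} (he : e.2 ∉ F.exec e.1)
    {n x : ℕ} (hseq : ∀ m, n ≤ m → (ρ.exec m e).seq = x) (hp : (ρ.exec n e).pending = none) :
    ∃ m, n ≤ m ∧ (ρ.exec m e).pending = some (x + 1) := by
  by_contra! hno
  have hstay : ∀ m, n ≤ m → (ρ.exec m e).pending = none := by
    intro m hm
    induction m, hm using Nat.le_induction with
    | base => exact hp
    | succ m hm ih =>
      rcases h.exec_pending_step he m with ⟨h1, -⟩ | ⟨-, -, h1, -⟩ | ⟨-, h1, -⟩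
      · exact h1.trans ih
      · rw [hseq m hm] at h1
        exact (hno (m + 1) (by omega) h1).elim
      · exact h1
  obtain ⟨m, hm, hi⟩ := (h.prot.exec e he).2 .callReceive trivial n hstay
  have h1 := hstay (m + 1) (by omega)
  rw [(h.exec_some he hi).2, exec_step_callReceive] at h1
  simp at h1

/-- If the replica stayed at `x` forever, it would eventually have a `receive(x + 1)` outstanding. A
message as answer raises the sequence number, and TooOld leads to a checkpoint that does. -/
theorem exec_progress (h : Admissible ρ app F) {g : cfg.Group} {i : cfg.Member}
    (hi : i ∉ F.exec g) {n x : ℕ} (hx : x ≤ (ρ.exec n (g, i)).seq)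
    (hret : ∀ k, ρ.ExecOut app k (g, i) (.receive (x + 1)) →
      ∃ k', k < k' ∧ (ρ.commitChannel app g).RecvRet k' i () (x + 1)) :
    ∃ m, x + 1 ≤ (ρ.exec m (g, i)).seq := by
  by_contra! hno
  have hseq : ∀ m, n ≤ m → (ρ.exec m (g, i)).seq = x := fun m hm => by
    have h1 := h.exec_seq_mono (e := (g, i)) hi hm
    have h2 := hno m
    simp only at h1
    omega
  have main : ∀ m, n ≤ m → (ρ.exec m (g, i)).pending = some (x + 1) → False := by
    intro m hm hp
    obtain ⟨k, hk, hpk, ⟨p', ht⟩ | ⟨y, hy⟩⟩ := h.pending_returns hi hp hret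
    -- TooOld carries some `p' > x + 1`, so the fetched checkpoint reaches `p' - 1 ≥ x + 1`.
    · have hlt := ((h.comp.commitChannel g).correctness2 k i hi () _ _ ⟨hpk, ht⟩).1
      obtain ⟨n', hn'⟩ := h.seq_of_tooOld hi ht
      have h1 := hn' n' le_rfl
      have h2 := hno n'
      omega
    · have hs := hseq k (by omega)
      have h1 := (h.exec_some (e := (g, i)) hi hy).2
      have h2 := hno (k + 1)
      rw [← hs] at hpk
      rw [h1, exec_step_execute _ _ _ hpk] at h2
      simp only at h2
      omega
  have idle : ∀ m, n ≤ m → (ρ.exec m (g, i)).pending = none → False := by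
    intro m hm hp
    obtain ⟨k, hk, hpk⟩ := h.exec_calls_receive (e := (g, i)) hi
      (fun k hk => hseq k (hm.trans hk)) hp
    exact main k (by omega) hpk
  rcases hp : (ρ.exec n (g, i)).pending with _ | p
  · exact idle n le_rfl hp
  · have hple := h.exec_pending_le (e := (g, i)) hi hp
    rw [hseq n le_rfl] at hple
    rcases Nat.lt_or_ge x p with hlt | hge
    · have : p = x + 1 := by omega
      exact main n le_rfl (this ▸ hp)
    -- The outstanding call is for a position that a checkpoint has overtaken. The same checkpoint
    -- has moved the replica's own window past it, so the call returns and the loop asks for `x + 1`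
    -- next.
    · obtain ⟨k, s, cp, hst, hps⟩ := h.exec_pending_stale (e := (g, i)) hi hp
        (by rw [hseq n le_rfl]; exact hge)
      obtain ⟨y, q, hq, hw⟩ := h.reaches_of_stable hi hi hst
      obtain ⟨m, hm, hpm, hin⟩ := h.pending_returns hi hp fun k hk =>
        (h.comp.commitChannel g).recv_old k i hi () p hk ⟨y, q, by omega, hw⟩
      refine idle (m + 1) (by omega) ?_
      rcases h.exec_pending_step (e := (g, i)) hi m with ⟨-, h1, h2⟩ | ⟨-, h1, -⟩ | ⟨-, h1, -⟩
      · rcases hin with ⟨p', hin⟩ | ⟨z, hin⟩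
        · exact (h2 _ hin).elim
        · exact (h1 _ hin).elim
      · simp [hpm] at h1
      · exact h1

theorem receive_returns_of_agr_stable (h : Admissible ρ app F) {a : cfg.AgrId} (ha : a ∉ F.agr)
    {n s : ℕ} {cp : AgrCp C W} (hi : ρ.agrIn n a = some (.stable s cp)) {g : cfg.Group}
    {i : cfg.Member} (hg : i ∉ F.exec g) {p : ℕ} (hp : p + cfg.capC ≤ s) {k : ℕ}
    (hk : ρ.ExecOut app k (g, i) (.receive p)) :
    ∃ k', k < k' ∧ (ρ.commitChannel app g).RecvRet k' i () p :=
  (h.comp.commitChannel g).recv_old k i hg () p hk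
    (h.reaches_of_agr_stable ha hi hg (by omega))

/-- The dropped positions are crossed one by one, since every `receive` call below the moved windows
returns. The alternative `x = 0` serves the truncated difference `s - capC` when `s < capC`. -/
theorem exec_reaches_of_agr_stable (h : Admissible ρ app F) {a : cfg.AgrId} (ha : a ∉ F.agr)
    {n s : ℕ} {cp : AgrCp C W} (hi : ρ.agrIn n a = some (.stable s cp)) {g : cfg.Group}
    {i : cfg.Member} (hg : i ∉ F.exec g) (x : ℕ) (hx : x = 0 ∨ x + cfg.capC ≤ s) :
    ∃ k, x ≤ (ρ.exec k (g, i)).seq := by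
  induction x with
  | zero => exact ⟨0, by omega⟩
  | succ x ih =>
    obtain ⟨k, hk⟩ := ih (by omega)
    exact h.exec_progress hg hk fun k hk =>
      h.receive_returns_of_agr_stable ha hi hg (by omega) hk

/-! ### Execution groups follow `fa + 1` correct agreement replicas -/

/-- Once all correct replicas of a group have reached `x`, the `send` calls for positions up to
`x + 1` return. -/
theorem commitSend_returns (h : Admissible ρ app F) {g : cfg.Group} {x : ℕ}
    (hx : ∀ i, i ∉ F.exec g → ∃ k, x ≤ (ρ.exec k (g, i)).seq) {a : cfg.AgrId} (ha : a ∉ F.agr)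
    {n p : ℕ} {m : Execute C W} (hc : ρ.AgrOut n a (.commitSend g p m)) (hp : p ≤ x + 1) :
    ∃ k, ρ.agrIn k a = some (.executeSent g p) := by
  have hke := cfg.ke_pos
  have hkc := cfg.ke_le
  have hmod := Nat.div_add_mod x cfg.ke
  have hlt := Nat.mod_lt x hke
  -- The last checkpoint position up to `x`. From `x < y + ke` and `ke ≤ capC` follows `x + 1 ≤ y +
  -- capC`, so a checkpoint for `y` opens the window far enough; for `y = 0` the initial window
  -- does.
  set y := cfg.ke * (x / cfg.ke) with hy
  refine h.commitSend_returns_of_stable (s := y) ?_ ha hc (by omega)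
  by_contra! hno
  obtain ⟨hy0, hno⟩ := hno
  have hgen : ∀ i, i ∉ F.exec g →
      ∃ k, ρ.ExecOut app k (g, i) (.genCp y (ρ.execCanon app F y)) := by
    intro i hi
    obtain ⟨k, hk⟩ := hx i hi
    -- Without a stable checkpoint for `y` or more, the replica can get past `y` only by executing
    -- position `y` itself, and then it creates the checkpoint. The checkpoints of all replicas
    -- agree by `exec_genCp`.
    obtain ⟨l, hl1, hl2⟩ := exists_crossing (f := fun n => (ρ.exec n (g, i)).seq) (y := y) (n := k)
      (by simp [h.exec_zero (e := (g, i)) hi, execAutomaton]; omega) (by omega)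
    rcases h.exec_state_step (e := (g, i)) hi l with ⟨h1, -⟩ | ⟨z, h1, h2, h3, h4⟩ | ⟨cp, h1, -⟩
    · omega
    · have hyl : (ρ.exec l (g, i)).seq + 1 = y := by omega
      have ho : ρ.ExecOut app l (g, i) (.genCp y
          (applyRequest app ⟨(ρ.exec l (g, i)).last, (ρ.exec l (g, i)).app⟩ z.req)) := by
        refine ⟨_, h1, ?_⟩
        rw [exec_step_execute _ _ _ h2, hyl]
        exact Or.inr ⟨Dvd.intro _ rfl, rfl⟩
      exact ⟨l, h.exec_genCp (e := (g, i)) hi ho ▸ ho⟩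
    · exact (hno i hi l _ cp hl2 h1).elim
  obtain ⟨j, hj, hjg, hget⟩ := h.comp.execCheckpoints.liveness2 g y (ρ.execCanon app F y)
    ((F.okExec g).map ⟨fun i => (g, i), fun _ _ hij => (Prod.ext_iff.1 hij).2⟩)
    (by rw [Finset.card_map]; exact Faults.card_okExec g) (fun e he => by
      obtain ⟨i, hi, rfl⟩ := Finset.mem_map.1 he
      exact ⟨Faults.mem_okExec.1 hi, rfl, hgen i (Faults.mem_okExec.1 hi)⟩)
  obtain ⟨g', j⟩ := j
  simp only at hjg
  subst hjg
  rcases hget with ⟨k, hk⟩ | ⟨k, s', cp', hs', hk⟩ | ⟨k, hk⟩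
  · exact hno j hj k y _ le_rfl hk
  · exact hno j hj k s' cp' hs'.le hk
  · exact (hk k le_rfl).elim

/-- Induction on `x`, for all groups together. Either some member of `Q` has a stable checkpoint
that drops `x + 1`, and then execution replicas get past this position anyway; or all members have
sent the same message at `x + 1`. In the latter case the induction hypothesis makes these sends
return, and `fa + 1` returned sends make `receive` return. -/
theorem exec_reaches (h : Admissible ρ app F) {Q : Finset cfg.AgrId} (hQ : cfg.fa + 1 ≤ Q.card)
    (hok : ∀ a ∈ Q, a ∉ F.agr) {x : ℕ} (hx : ∀ a ∈ Q, ∃ n, x ≤ (ρ.agr n a).seq) :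
    ∀ (g : cfg.Group) (i : cfg.Member), i ∉ F.exec g → ∃ k, x ≤ (ρ.exec k (g, i)).seq := by
  induction x with
  | zero => exact fun _ _ _ => ⟨0, Nat.zero_le _⟩
  | succ x ih =>
    have ih := ih fun a ha => (hx a ha).imp fun n hn => by omega
    intro g i hi
    by_cases hst : ∃ a ∈ Q, ∃ k s cp, ρ.agrIn k a = some (.stable s cp) ∧ x + 1 + cfg.capC ≤ s
    · obtain ⟨a, ha, k, s, cp, hk, hs⟩ := hst
      exact h.exec_reaches_of_agr_stable (hok a ha) hk hi (x + 1) (Or.inr hs)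
    · have hsend : ∀ a ∈ Q, ∃ k m, ρ.AgrOut k a (.commitSend g (x + 1) m) := fun a ha => by
        obtain ⟨n, hn⟩ := hx a ha
        rcases h.commitSend_of_le_seq (hok a ha) (by omega) hn with h1 | h1
        · exact (hst ⟨a, ha, h1⟩).elim
        · exact h1 g
      obtain ⟨a₀, ha₀⟩ := Finset.card_pos.1 (by omega : 0 < Q.card)
      obtain ⟨k₀, m₀, hm₀⟩ := hsend a₀ ha₀
      have heq : ∀ a ∈ Q, ∀ k m, ρ.AgrOut k a (.commitSend g (x + 1) m) → m = m₀ := by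
        intro a ha k m hm
        obtain ⟨h1, h2⟩ := h.commitSend_eq (hok a ha) hm
        obtain ⟨h3, h4⟩ := h.commitSend_eq (hok a₀ ha₀) hm₀
        cases m
        cases m₀
        simp_all
      obtain ⟨n, hn⟩ := ih g i hi
      refine h.exec_progress hi hn fun k hk => ?_
      refine (h.comp.commitChannel g).liveness1 () (x + 1) m₀ Q hQ (fun a ha => ?_) k i hi hk
      obtain ⟨k', m, hm⟩ := hsend a ha
      exact ⟨hok a ha, ⟨k', heq a ha k' m hm ▸ hm⟩,
        h.commitSend_returns (ih g) (hok a ha) hm le_rfl⟩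

end Admissible
end Run
end Spider

/-! ### Agreement replicas do not block: windows, `deliver` calls and decisions. -/

namespace Spider

universe u v w x

namespace Run

variable {C : Type u} {W : Type v} {S : Type w} {U : Type x} {cfg : Config C}
  {ρ : Run W S U cfg} {app : App W S U} {F : Faults cfg}

namespace Admissible

/-! ### The agreement window -/

/-- The bound for a sleeping `stable_cp` guarantees that its end does not lower the window; it holds
because checkpoints become stable in increasing order. The first half also shows that the window
starts just after a multiple of `ka`. -/
theorem winLo_inv (h : Admissible ρ app F) {a : cfg.AgrId} (ha : a ∉ F.agr) (n : ℕ) :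
    ((ρ.agr n a).winLo = 1 ∨
      ∃ k s cp, k < n ∧ ρ.agrIn k a = some (.stable s cp) ∧ (ρ.agr n a).winLo = s + 1) ∧
    ∀ s l, (ρ.agr n a).stable = .atSend s l → (ρ.agr n a).winLo ≤ s + 1 := by
  induction n with
  | zero => simp [h.agr_zero ha, agrAutomaton]
  | succ n ih =>
    obtain ⟨ih1, ih2⟩ := ih
    rcases h.agr_stable_step ha n with ⟨h1, h2⟩ | ⟨s, cp, hi, -, ⟨l, h1, -, h2⟩ | ⟨h1, h2⟩⟩ |
      ⟨s, l, -, h0, h1, h2⟩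
    · rw [h1, h2]
      refine ⟨ih1.imp_right ?_, ih2⟩
      rintro ⟨k, s, cp, hk, h3⟩
      exact ⟨k, s, cp, by omega, h3⟩
    · rw [h1, h2]
      constructor
      · refine ih1.imp_right ?_
        rintro ⟨k, s, cp, hk, h3⟩
        exact ⟨k, s, cp, by omega, h3⟩
      · rintro s' l' ⟨⟩
        rcases ih1 with h3 | ⟨k, s', cp', hk, h3, h4⟩
        · omega
        · have := h.comp.agrCheckpoints.increasing k n a ha _ _ _ _ hk h3 hi
          omega
    · rw [h1, h2]
      exact ⟨Or.inr ⟨n, s, cp, by omega, hi, rfl⟩, by simp⟩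
    · obtain ⟨k, cp, hk, hi, -⟩ := h.stable_call_info ha h0
      rw [h1, h2]
      exact ⟨Or.inr ⟨k, s, cp, by omega, hi, rfl⟩, by simp⟩

theorem winLo_mono (h : Admissible ρ app F) {a : cfg.AgrId} (ha : a ∉ F.agr) :
    Monotone fun n => (ρ.agr n a).winLo := by
  refine monotone_nat_of_le_succ fun n => ?_
  obtain ⟨h1, h2⟩ := h.winLo_inv ha n
  rcases h.agr_stable_step ha n with ⟨-, h3⟩ | ⟨s, cp, hi, -, ⟨l, -, -, h3⟩ | ⟨-, h3⟩⟩ |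
      ⟨s, l, -, h0, -, h3⟩
  · exact h3.ge
  · exact h3.ge
  · rw [h3]
    rcases h1 with h4 | ⟨k, s', cp', hk, h4, h5⟩
    · omega
    · have := h.comp.agrCheckpoints.increasing k n a ha _ _ _ _ hk h4 hi
      omega
  · rw [h3]
    exact h2 s l h0

theorem winLo_of_stable (h : Admissible ρ app F) {a : cfg.AgrId} (ha : a ∉ F.agr) {n s : ℕ}
    {cp : AgrCp C W} (hi : ρ.agrIn n a = some (.stable s cp)) :
    ∃ m, (ρ.agr m a).winLo = s + 1 := by
  have hs := (h.agr_some ha hi).2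
  by_cases hlt : (ρ.agr n a).seq < s
  · have hst : (ρ.agr (n + 1) a).stable =
        .atSend s (cp.hist.filter (fun m => decide ((ρ.agr n a).seq < m.seq))) := by
      rw [hs, agr_step_stable _ _ _ hlt]
    obtain ⟨m, -, hm, hst'⟩ := h.stable_returns ha hst
    exact ⟨m + 1, by rw [(h.agr_some ha hm).2, agr_step_stableFinish _ _ hst']⟩
  · exact ⟨n + 1, by rw [hs, agr_step_stable_old _ _ _ hlt]⟩

/-! ### `deliver` calls of agreement replicas -/

theorem commitSend_of_atSend (h : Admissible ρ app F) {a : cfg.AgrId} (ha : a ∉ F.agr) {n s : ℕ}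
    {cp : AgrCp C W} (hd : (ρ.agr n a).deliver = .atSend s cp) (g : cfg.Group) :
    ∃ k m, ρ.AgrOut k a (.commitSend g s m) := by
  induction n with
  | zero => simp [h.agr_zero ha, agrAutomaton] at hd
  | succ n ih =>
    rcases h.agr_deliver_step ha n with h1 | ⟨s', r', -, -, h1⟩ | ⟨s', r', h0, hlt, hs, h1⟩ |
        ⟨s', r', -, -, h1⟩ | ⟨s', cp, -, -, h1⟩
    · exact ih (h1 ▸ hd)
    · simp [h1] at hd
    · rw [h1] at hd
      cases hd
      rcases h.agr_state_step ha n with ⟨h2, -⟩ | ⟨r, -, -, -, -, -, h3⟩ | ⟨cp, h2, -⟩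
      · omega
      · exact ⟨n, _, hs ▸ h3 g⟩
      · have := (h.agr_some ha h2).2
        rw [this] at h1
        by_cases hlt : (ρ.agr n a).seq < (ρ.agr (n + 1) a).seq
        · simp [agr_step_stable _ _ _ hlt, h0] at h1
        · omega
    all_goals simp [h1] at hd

/-- Once every correct execution replica has reached `s`, the sends at `s` return for all groups,
which is more than the `ne - z` for which the call waits. -/
theorem deliver_returns (h : Admissible ρ app F) {a : cfg.AgrId} (ha : a ∉ F.agr) {n s : ℕ}
    {cp : AgrCp C W} (hd : (ρ.agr n a).deliver = .atSend s cp)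
    (hreach : ∀ (g : cfg.Group) (i : cfg.Member), i ∉ F.exec g →
      ∃ k, s ≤ (ρ.exec k (g, i)).seq) :
    ∃ m, n ≤ m ∧ ρ.agrIn m a = some .finish ∧ (ρ.agr m a).deliver = .atSend s cp := by
  by_contra! hno
  have hstay : ∀ m, n ≤ m → (ρ.agr m a).deliver = .atSend s cp := by
    intro m hm
    induction m, hm using Nat.le_induction with
    | base => exact hd
    | succ m hm ih =>
      rcases h.agr_deliver_step ha m with h1 | ⟨s', r', -, h1, -⟩ | ⟨s', r', h1, -⟩ |
        ⟨s', r', h1, -⟩ | ⟨s', cp', h1, -, -⟩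
      · exact h1.trans ih
      · simp [ih] at h1
      · simp [ih] at h1
      · simp [ih] at h1
      · exact (hno m hm h1 ih).elim
  obtain ⟨N, hN⟩ := h.exists_sent_groups ha (G := Set.univ) (l := [s]) fun g _ p hp => by
    obtain rfl := List.mem_singleton.1 hp
    obtain ⟨k, m, hm⟩ := h.commitSend_of_atSend ha hd g
    exact h.commitSend_returns (hreach g) ha hm (Nat.le_succ _)
  obtain ⟨m, hm, hfin⟩ := (h.prot.agr a ha).2 .finish trivial (max n N) fun m hm => by
    refine ⟨s, cp, hstay m (le_of_max_le_left hm), ?_⟩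
    have hall : {g : cfg.Group | s ∈ (ρ.agr m a).sent g} = Set.univ :=
      Set.eq_univ_of_forall fun g =>
        hN m (le_of_max_le_right hm) (Set.mem_univ g) s (List.mem_singleton.2 rfl)
    rw [hall]
    simp [Set.ncard_univ]
  exact hno m (le_of_max_le_left hm) hfin (hstay m (le_of_max_le_left hm))

/-- If `fa + 1` correct agreement replicas get beyond `w + ka`, where `w` is a multiple of `ka`,
then an agreement checkpoint beyond `w` becomes stable. -/
theorem exists_stable_of_reaches (h : Admissible ρ app F) {Q : Finset cfg.AgrId}
    (hQ : cfg.fa + 1 ≤ Q.card) (hok : ∀ a ∈ Q, a ∉ F.agr) {w : ℕ} (hw : cfg.ka ∣ w)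
    (hx : ∀ a ∈ Q, ∃ n, w + cfg.ka ≤ (ρ.agr n a).seq) :
    ∃ b, b ∉ F.agr ∧ ∃ n s cp, w < s ∧ ρ.agrIn n b = some (.stable s cp) := by
  by_contra! hno
  have hka := cfg.ka_pos
  have hreach := h.exec_reaches hQ hok hx
  have hgen : ∀ b ∈ Q, ∃ k, ρ.AgrOut k b (.genCp (w + cfg.ka) (ρ.agrCanon F (w + cfg.ka))) := by
    intro b hb
    obtain ⟨n, hn⟩ := hx b hb
    -- A checkpoint beyond `w` is excluded by assumption, so `w + ka` is passed by processing
    -- exactly that decision. Its `deliver` call returns and creates the canonical checkpoint.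
    obtain ⟨l, hl1, hl2⟩ := exists_crossing (f := fun n => (ρ.agr n b).seq) (n := n)
      (y := w + cfg.ka) (by simp [h.agr_zero (hok b hb), agrAutomaton]; omega) hn
    rcases h.agr_state_step (hok b hb) l with ⟨h1, -⟩ | ⟨r, h1, -, -, -, h2, -⟩ | ⟨cp, h1, -⟩
    · omega
    · have hle := (h.agr_atWindow (hok b hb) h1).2.1
      have hs : (ρ.agr (l + 1) b).seq = w + cfg.ka := by omega
      rw [hs] at h2
      obtain ⟨m, -, hfin, hd⟩ := h.deliver_returns (hok b hb) h2 hreach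
      have ho := finish_outputs hfin hd (Dvd.dvd.add hw dvd_rfl)
      exact ⟨m, (h.agr_genCp (hok b hb) ho).2.1 ▸ ho⟩
    · exact (hno b (hok b hb) l _ cp (by omega) h1).elim
  obtain ⟨j, hj, -, ⟨k, hk⟩ | ⟨k, s', cp', hs', hk⟩ | ⟨k, hk⟩⟩ :=
    h.comp.agrCheckpoints.liveness2 () _ _ Q hQ fun b hb => ⟨hok b hb, rfl, hgen b hb⟩
  · exact hno j hj k _ _ (by omega) hk
  · exact hno j hj k s' cp' (by omega) hk
  · exact h.not_stable_busy hj k hk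

/-- Some replica of a finite set is slowest: the others reach every sequence number it reaches. -/
theorem exists_slowest {Q : Finset cfg.AgrId} (hQ : Q.Nonempty) :
    ∃ a ∈ Q, ∀ x, (∃ n, x ≤ (ρ.agr n a).seq) → ∀ b ∈ Q, ∃ n, x ≤ (ρ.agr n b).seq := by
  -- Sequence numbers may be unbounded, so the suprema are compared in `ℕ∞`.
  obtain ⟨a, ha, hmin⟩ := Q.exists_min_image (fun a => ⨆ n, ((ρ.agr n a).seq : ℕ∞)) hQ
  refine ⟨a, ha, fun x ⟨n, hn⟩ b hb => ?_⟩
  cases x with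
  | zero => exact ⟨0, Nat.zero_le _⟩
  | succ x =>
    have h1 : ((x : ℕ) : ℕ∞) < ⨆ n, ((ρ.agr n b).seq : ℕ∞) := by
      refine lt_of_lt_of_le ?_ (hmin b hb)
      refine lt_of_lt_of_le ?_ (le_iSup (fun n => ((ρ.agr n a).seq : ℕ∞)) n)
      exact_mod_cast hn
    obtain ⟨m, hm⟩ := lt_iSup_iff.1 h1
    exact ⟨m, by exact_mod_cast hm⟩

/-- Whatever number the slowest member has reached, all of `Q` reach, and so do all execution
groups. Hence a call in `atSend` returns. A call in `atWindow` that never wakes would see its window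
start at arbitrarily large positions, which is absurd. -/
theorem not_deliver_busy (h : Admissible ρ app F) {Q : Finset cfg.AgrId}
    (hQ : cfg.fa + 1 ≤ Q.card) (hok : ∀ a ∈ Q, a ∉ F.agr) {a : cfg.AgrId} (haQ : a ∈ Q)
    (hmin : ∀ x, (∃ n, x ≤ (ρ.agr n a).seq) → ∀ b ∈ Q, ∃ n, x ≤ (ρ.agr n b).seq) (n : ℕ) :
    ¬ ∀ m, n ≤ m → (ρ.agr m a).deliver ≠ .idle := by
  intro hb
  have ha := hok a haQ
  have hsend : ∀ m, n ≤ m → ∀ s cp, (ρ.agr m a).deliver ≠ .atSend s cp := by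
    intro m hm s cp hd
    have hs := ((h.agr_inv m a ha).atSend s cp hd).2.1
    obtain ⟨k, hk, hfin, hd'⟩ :=
      h.deliver_returns ha hd (h.exec_reaches hQ hok (hmin s ⟨m, hs⟩))
    refine hb (k + 1) (by omega) ?_
    rw [(h.agr_some ha hfin).2, agr_step_finish _ _ _ hd']
  obtain ⟨s, r, hd⟩ : ∃ s r, (ρ.agr n a).deliver = .atWindow s r := by
    rcases hd : (ρ.agr n a).deliver with _ | ⟨s, r⟩ | ⟨s, cp⟩
    · exact (hb n le_rfl hd).elim
    · exact ⟨s, r, rfl⟩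
    · exact (hsend n le_rfl s cp hd).elim
  have hstay : ∀ m, n ≤ m → (ρ.agr m a).deliver = .atWindow s r := by
    intro m hm
    induction m, hm using Nat.le_induction with
    | base => exact hd
    | succ m hm ih =>
      rcases h.agr_deliver_step ha m with h1 | ⟨s', r', -, h1, -⟩ | ⟨s', r', -, -, -, h1⟩ |
        ⟨s', r', -, -, h1⟩ | ⟨s', cp', -, -, h1⟩
      · exact h1.trans ih
      · simp [ih] at h1
      · exact (hsend _ (by omega) _ _ h1).elim
      · exact (hb _ (by omega) h1).elim
      · exact (hb _ (by omega) h1).elim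
  have hwin : ∀ m, (ρ.agr m a).winLo + cfg.agWin ≤ s := by
    intro m
    by_contra! hlt
    obtain ⟨k, hk, hi⟩ := (h.prot.agr a ha).2 .proceed trivial (max n m) fun k hk => by
      have := h.winLo_mono ha (le_of_max_le_right hk)
      exact ⟨s, r, hstay k (le_of_max_le_left hk),
        lt_of_lt_of_le hlt (Nat.add_le_add_right this _)⟩
    have hk' := hstay k (le_of_max_le_left hk)
    have h1 := hstay (k + 1) ((le_of_max_le_left hk).trans (Nat.le_succ k))
    rw [(h.agr_some ha hi).2] at h1
    by_cases hlt : (ρ.agr k a).seq < s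
    · simp [agr_step_proceed _ _ _ hk' hlt] at h1
    · simp [agr_step_proceed_drop _ _ _ hk' hlt] at h1
  have hgrow : ∀ j, ∃ m, j ≤ (ρ.agr m a).winLo := by
    intro j
    induction j with
    | zero => exact ⟨0, Nat.zero_le _⟩
    | succ j ih =>
      obtain ⟨m, hm⟩ := ih
      obtain ⟨w, hw, hdvd⟩ : ∃ w, (ρ.agr m a).winLo = w + 1 ∧ cfg.ka ∣ w := by
        rcases (h.winLo_inv ha m).1 with h1 | ⟨k, t, cp, -, hi, h1⟩
        · exact ⟨0, h1, dvd_zero _⟩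
        · exact ⟨t, h1, (h.agr_stable ha hi).2.2.1⟩
      have hle := (h.agr_atWindow ha hd).2.1
      have hwm := hwin m
      have hka := cfg.ka_le
      -- With the window starting at `w + 1`, the waiting call has `w + 1 + agWin ≤ s ≤ seq + 1`, so
      -- `ka ≤ agWin` gives `w + ka ≤ seq`. A checkpoint beyond `w` therefore becomes stable and
      -- moves the window on.
      obtain ⟨b, hb, k, t, cp, ht, hi⟩ := h.exists_stable_of_reaches hQ hok hdvd
        (hmin (w + cfg.ka) ⟨n, by omega⟩)
      obtain ⟨k', t', cp', ht', hi'⟩ := h.agr_stable_all hb ha hi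
      obtain ⟨l, hl⟩ := h.winLo_of_stable ha hi'
      exact ⟨l, by omega⟩
  obtain ⟨m, hm⟩ := hgrow (s + 1)
  have := hwin m
  omega

/-- A request that all correct agreement replicas receive is decided, and all correct execution
replicas reach its sequence number. -/
theorem exists_decision (h : Admissible ρ app F) {r : Request C W}
    (hr : ∀ a, a ∉ F.agr →
      (∃ n, ρ.AgrOut n a (.order r)) ∨ ρ.agreement.Passes {a | a ∉ F.agr} a r) :
    ∃ s, 1 ≤ s ∧ ρ.decision F s = some r ∧
      ∀ (g : cfg.Group) (i : cfg.Member), i ∉ F.exec g → ∃ k, s ≤ (ρ.exec k (g, i)).seq := by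
  obtain ⟨Q, hQ, hok⟩ := h.comp.agreement.liveness r F.okAgr Faults.card_okAgr fun a ha =>
    ⟨Faults.mem_okAgr.1 ha, hr a (Faults.mem_okAgr.1 ha)⟩
  obtain ⟨a, haQ, hmin⟩ := exists_slowest (ρ := ρ) (Finset.card_pos.1 (by omega : 0 < Q.card))
  have ha := (hok a haQ).1
  have hbusy := h.not_deliver_busy hQ (fun b hb => (hok b hb).1) haQ hmin
  have hpass := (hok a haQ).2.resolve_right fun ⟨n, hn⟩ => hbusy n hn
  obtain ⟨s, hs1, hs, hreach⟩ : ∃ s, 1 ≤ s ∧ ρ.decision F s = some r ∧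
      ∃ n, s ≤ (ρ.agr n a).seq := by
    rcases hpass with ⟨n, s, hd⟩ | ⟨n, s, s', hgc, hlt, b, hb, k, hd⟩
    · refine ⟨s, h.comp.agreement.first a ha _ _ _ hd, h.decision_eq ha hd, ?_⟩
      by_contra! hno
      -- If the replica never reached `s`, the call would stay in `atWindow` from time `n + 1` on.
      refine hbusy (n + 1) fun m hm => ?_
      rcases h.delivered_le_seq ha hd hm with h1 | h1
      · exact (not_lt.2 h1 (hno m)).elim
      · simp [h1]
    · refine ⟨s, h.comp.agreement.first b hb _ _ _ hd, h.decision_eq hb hd, ?_⟩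
      obtain ⟨t, cp, hi, rfl⟩ := h.agrOut_gc ha hgc
      exact ⟨n + 1, (Nat.lt_succ_iff.1 hlt).trans (h.agr_seq_stable ha hi (Nat.lt_succ_self n))⟩
  exact ⟨s, hs1, hs, h.exec_reaches hQ (fun b hb => (hok b hb).1) (hmin s hreach)⟩

end Admissible
end Run
end Spider

/-! ### Clients, request channels and E-Liveness. -/

namespace Spider

universe u v w x

namespace Run

variable {C : Type u} {W : Type v} {S : Type w} {U : Type x} {cfg : Config C}
  {ρ : Run W S U cfg} {app : App W S U} {F : Faults cfg}

/-! ### Clients -/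

section

variable (st : ClientState W U (2 * cfg.fe + 1)) (c : C) (op : W) (i : Fin (2 * cfg.fe + 1))
  (val : U) (t : ℕ)

theorem client_step_write : (clientAutomaton W U cfg c).step st (.write op) =
    ({ ctr := st.ctr + 1, pending := some op, replies := fun _ => none }, ∅) := rfl

theorem client_step_resend : (clientAutomaton W U cfg c).step st .resend =
    (st, {o | ∃ op, st.pending = some op ∧ o = .broadcast ⟨op, c, st.ctr⟩}) := rfl

open Classical in
theorem client_step_accept (h1 : st.pending ≠ none ∧ t = st.ctr ∧ st.replies i = none)
    (h2 : cfg.fe + 1 ≤ Set.ncard {j | Function.update st.replies i (some val) j = some val}) :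
    (clientAutomaton W U cfg c).step st (.reply i val t) =
      ({ st with pending := none, replies := Function.update st.replies i (some val) },
        {.result st.ctr val}) := by
  unfold clientAutomaton
  simp only [h1, ne_eq, not_false_eq_true, and_self, if_true]
  exact if_pos h2

open Classical in
theorem client_step_store (h1 : st.pending ≠ none ∧ t = st.ctr ∧ st.replies i = none)
    (h2 : ¬ cfg.fe + 1 ≤ Set.ncard {j | Function.update st.replies i (some val) j = some val}) :
    (clientAutomaton W U cfg c).step st (.reply i val t) =
      ({ st with replies := Function.update st.replies i (some val) }, ∅) := by
  unfold clientAutomaton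
  simp only [h1, ne_eq, not_false_eq_true, and_self, if_true]
  exact if_neg h2

theorem client_step_ignore (h1 : ¬ (st.pending ≠ none ∧ t = st.ctr ∧ st.replies i = none)) :
    (clientAutomaton W U cfg c).step st (.reply i val t) = (st, ∅) := by
  unfold clientAutomaton
  exact if_neg h1

end

namespace Admissible

theorem client_some (h : Admissible ρ app F) {c : C} (hc : c ∉ F.client) {n : ℕ}
    {i : ClientInput W U (2 * cfg.fe + 1)} (hi : ρ.clientIn n c = some i) :
    (clientAutomaton W U cfg c).enabled (ρ.client n c) i ∧
      ρ.client (n + 1) c = ((clientAutomaton W U cfg c).step (ρ.client n c) i).1 :=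
  ((h.prot.client c hc).1.2 n).2 i hi

-- The extra clause of the first case says that a reply to the current request is ignored only if
-- its sender has answered before. This is how arriving replies are shown to be stored.
open Classical in
theorem client_step (h : Admissible ρ app F) {c : C} (hc : c ∉ F.client) (n : ℕ) :
    (ρ.client (n + 1) c = ρ.client n c ∧
      ∀ i val, (ρ.client n c).pending ≠ none →
        ρ.clientIn n c = some (.reply i val (ρ.client n c).ctr) →
        (ρ.client n c).replies i ≠ none) ∨
    (∃ op, (ρ.client n c).pending = none ∧ ρ.client (n + 1) c =
      { ctr := (ρ.client n c).ctr + 1, pending := some op, replies := fun _ => none }) ∨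
    (∃ i val, ρ.clientIn n c = some (.reply i val (ρ.client n c).ctr) ∧
      (ρ.client n c).pending ≠ none ∧ (ρ.client n c).replies i = none ∧
      Set.ncard {j | Function.update (ρ.client n c).replies i (some val) j = some val} ≤ cfg.fe ∧
      ρ.client (n + 1) c = { ρ.client n c with
        replies := Function.update (ρ.client n c).replies i (some val) }) ∨
    (∃ val, ρ.ClientOut n c (.result (ρ.client n c).ctr val) ∧
      (ρ.client (n + 1) c).pending = none ∧
      (ρ.client (n + 1) c).ctr = (ρ.client n c).ctr) := by
  rcases hi : ρ.clientIn n c with _ | i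
  · exact Or.inl ⟨((h.prot.client c hc).1.2 n).1 hi, by simp⟩
  obtain ⟨hen, hs⟩ := h.client_some hc hi
  cases i with
  | write op => exact Or.inr (Or.inl ⟨op, hen, by rw [hs, client_step_write]⟩)
  | resend => exact Or.inl ⟨by rw [hs, client_step_resend], by simp⟩
  | reply i val t =>
    by_cases h1 : (ρ.client n c).pending ≠ none ∧ t = (ρ.client n c).ctr ∧
        (ρ.client n c).replies i = none
    · obtain ⟨hp, rfl, hr⟩ := h1
      by_cases h2 : cfg.fe + 1 ≤
          Set.ncard {j | Function.update (ρ.client n c).replies i (some val) j = some val}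
      · refine Or.inr (Or.inr (Or.inr ⟨val, ⟨_, hi, ?_⟩, ?_⟩))
        · rw [client_step_accept _ _ _ _ _ ⟨hp, rfl, hr⟩ h2]
          rfl
        · rw [hs, client_step_accept _ _ _ _ _ ⟨hp, rfl, hr⟩ h2]
          exact ⟨rfl, rfl⟩
      · refine Or.inr (Or.inr (Or.inl ⟨i, val, rfl, hp, hr, by omega, ?_⟩))
        rw [hs, client_step_store _ _ _ _ _ ⟨hp, rfl, hr⟩ h2]
    · refine Or.inl ⟨by rw [hs, client_step_ignore _ _ _ _ _ h1], ?_⟩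
      rintro i' val' hp ⟨⟩ hr
      exact h1 ⟨hp, rfl, hr⟩

theorem clientOut_broadcast {c : C} {n : ℕ} {r : Request C W}
    (ho : ρ.ClientOut n c (.broadcast r)) :
    r.client = c ∧ r.ctr = (ρ.client n c).ctr ∧ (ρ.client n c).pending = some r.op := by
  classical
  obtain ⟨i, hi, ho⟩ := ho
  cases i with
  | write op => simp [client_step_write] at ho
  | resend =>
    rw [client_step_resend] at ho
    obtain ⟨op, hop, ho⟩ := ho
    cases ho
    exact ⟨rfl, rfl, hop⟩
  | reply i val t =>
    by_cases h1 : (ρ.client n c).pending ≠ none ∧ t = (ρ.client n c).ctr ∧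
        (ρ.client n c).replies i = none
    · by_cases h2 : cfg.fe + 1 ≤
          Set.ncard {j | Function.update (ρ.client n c).replies i (some val) j = some val}
      · rw [client_step_accept _ _ _ _ _ h1 h2] at ho
        cases ho
      · rw [client_step_store _ _ _ _ _ h1 h2] at ho
        cases ho
    · rw [client_step_ignore _ _ _ _ _ h1] at ho
      cases ho

theorem client_ctr_mono (h : Admissible ρ app F) {c : C} (hc : c ∉ F.client) :
    Monotone fun n => (ρ.client n c).ctr := by
  refine monotone_nat_of_le_succ fun n => ?_
  rcases h.client_step hc n with ⟨h1, -⟩ | ⟨op, -, h1⟩ | ⟨i, val, -, -, -, -, h1⟩ | ⟨val, -, -, h1⟩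
  · rw [h1]
  · rw [h1]
    exact Nat.le_succ _
  · rw [h1]
  · exact h1.ge

/-- A new operation always raises the counter, so a counter value determines the operation. -/
theorem client_pending_of_ctr_eq (h : Admissible ρ app F) {c : C} (hc : c ∉ F.client) {n m : ℕ}
    (hnm : n ≤ m) (hctr : (ρ.client n c).ctr = (ρ.client m c).ctr) {op : W}
    (hp : (ρ.client m c).pending = some op) : (ρ.client n c).pending = some op := by
  induction m, hnm using Nat.le_induction with
  | base => exact hp
  | succ m hm ih =>
    have h1 : (ρ.client n c).ctr ≤ (ρ.client m c).ctr := h.client_ctr_mono hc hm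
    rcases h.client_step hc m with ⟨h2, -⟩ | ⟨op, -, h2⟩ | ⟨i, val, -, -, -, -, h2⟩ |
      ⟨val, -, h2, -⟩
    · rw [h2] at hctr hp
      exact ih hctr hp
    · rw [h2] at hctr
      simp only at hctr
      omega
    · rw [h2] at hctr hp
      exact ih hctr hp
    · simp [h2] at hp

/-- The replies that a waiting client has stored: no value has `fe + 1` of them, and those of
correct replicas were sent. -/
theorem client_inv (h : Admissible ρ app F) {c : C} (hc : c ∉ F.client) (n : ℕ)
    (hp : (ρ.client n c).pending ≠ none) :
    1 ≤ (ρ.client n c).ctr ∧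
    (∀ val, Set.ncard {j | (ρ.client n c).replies j = some val} ≤ cfg.fe) ∧
    ∀ j val, j ∉ F.exec (cfg.home c) → (ρ.client n c).replies j = some val →
      ∃ k, ρ.ExecOut app k (cfg.home c, j) (.reply c val (ρ.client n c).ctr) := by
  classical
  induction n with
  | zero =>
    have h0 := (h.prot.client c hc).1.1
    simp only at h0
    rw [h0] at hp
    exact (hp rfl).elim
  | succ n ih =>
    rcases h.client_step hc n with ⟨h1, -⟩ | ⟨op, -, h1⟩ | ⟨i, val, hi, hpn, hnone, hcard, h1⟩ |
      ⟨val, -, h1, -⟩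
    · rw [h1] at hp ⊢
      exact ih hp
    · rw [h1]
      refine ⟨Nat.le_add_left _ _, fun val => ?_, ?_⟩ <;> simp
    · obtain ⟨ih1, ih2, ih3⟩ := ih hpn
      rw [h1]
      refine ⟨ih1, fun v => ?_, fun j v hj hv => ?_⟩
      · by_cases hv : v = val
        · exact hv ▸ hcard
        · refine le_trans (Set.ncard_le_ncard (fun j hj => ?_) (Set.toFinite _)) (ih2 v)
          by_cases hji : j = i
          · subst hji
            have hj' : Function.update (ρ.client n c).replies j (some val) j = some v := hj
            rw [Function.update_self] at hj'
            exact (hv (Option.some.inj hj').symm).elim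
          · have hj' : Function.update (ρ.client n c).replies i (some val) j = some v := hj
            rwa [Function.update_of_ne hji] at hj'
      · simp only at hv
        by_cases hji : j = i
        · subst hji
          rw [Function.update_self] at hv
          cases hv
          obtain ⟨k, -, hk⟩ := h.net.reply_auth n c hc j hj val _ hi
          exact ⟨k, hk⟩
        · rw [Function.update_of_ne hji] at hv
          exact ih3 j v hj hv
    · exact (hp h1).elim

end Admissible

/-- From time `N` on, the client of `r` waits for a reply to `r` in vain. -/
structure Waiting (ρ : Run W S U cfg) (F : Faults cfg) (r : Request C W) (N : ℕ) : Prop where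
  client : r.client ∉ F.client
  pending : ∀ n, N ≤ n → (ρ.client n r.client).pending = some r.op
  ctr : ∀ n, N ≤ n → (ρ.client n r.client).ctr = r.ctr

/-- The last reply in an execution checkpoint belongs to a decided request. -/
theorem exists_decision_of_execCanon_last {s t : ℕ} {c : C} {val : U}
    (hl : (ρ.execCanon app F s).last c = some (val, t)) :
    ∃ p r, ρ.decision F p = some r ∧ r.client = c ∧ r.ctr = t := by
  classical
  induction s with
  | zero => simp [execCanon] at hl
  | succ s ih =>
    rcases hr : ρ.decision F (s + 1) with _ | r
    · rw [execCanon] at hl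
      simp only [hr] at hl
      exact ih hl
    · rw [execCanon_succ hr] at hl
      unfold applyRequest at hl
      split at hl
      · by_cases hc : c = r.client
        · subst hc
          simp only [Function.update_self, Option.some.injEq, Prod.mk.injEq] at hl
          exact ⟨s + 1, r, hr, rfl, hl.2⟩
        · simp only [Function.update_of_ne hc] at hl
          exact ih hl
      · exact ih hl

/-- Either the request is executed at `s`, or it is not fresh; then the table already holds a
counter at least as large. -/
theorem execCanon_last_of_decision {s : ℕ} (hs : 1 ≤ s) {r : Request C W}
    (hr : ρ.decision F s = some r) :
    ∃ val t, (ρ.execCanon app F s).last r.client = some (val, t) ∧ r.ctr ≤ t := by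
  classical
  obtain ⟨s, rfl⟩ := Nat.exists_eq_add_of_le' hs
  rw [execCanon_succ hr]
  unfold applyRequest
  split
  · exact ⟨(app.exec (ρ.execCanon app F s).app r.op).2, r.ctr, by simp, le_rfl⟩
  · next hf =>
    unfold Fresh at hf
    push Not at hf
    exact hf

/-- Overwriting an entry requires a strictly larger counter, and `t` bounds all decided counters of
the client. -/
theorem execCanon_last_stable {c : C} {t : ℕ}
    (ht : ∀ p r, ρ.decision F p = some r → r.client = c → r.ctr ≤ t) {s s' : ℕ} (hss : s ≤ s')
    {val : U} (hl : (ρ.execCanon app F s).last c = some (val, t)) :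
    (ρ.execCanon app F s').last c = some (val, t) := by
  classical
  induction s', hss using Nat.le_induction with
  | base => exact hl
  | succ s' hs ih =>
    rcases hr : ρ.decision F (s' + 1) with _ | r
    · rw [execCanon]
      simp only [hr]
      exact ih
    · rw [execCanon_succ hr]
      unfold applyRequest
      split
      · next hf =>
        by_cases hc : c = r.client
        · subst hc
          have h1 := hf _ _ ih
          have h2 := ht _ _ hr rfl
          omega
        · simp only [Function.update_of_ne hc]
          exact ih
      · exact ih

namespace Admissible

section

variable {r : Request C W} {N : ℕ}

theorem waiting_ctr_pos (h : Admissible ρ app F) (hw : ρ.Waiting F r N) : 1 ≤ r.ctr := by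
  have := (h.client_inv hw.client N (by simp [hw.pending N le_rfl])).1
  rwa [hw.ctr N le_rfl] at this

/-- The client's counter is monotone and stays at that of `r` from `N` on, so `r` has the largest
counter ever broadcast and is the only request that carries it. The following lemmas transfer this
to decisions, received requests and window moves. -/
theorem waiting_broadcast (h : Admissible ρ app F) (hw : ρ.Waiting F r N) {n : ℕ}
    {r' : Request C W} (ho : ρ.ClientOut n r.client (.broadcast r')) :
    r'.ctr ≤ r.ctr ∧ (r.ctr ≤ r'.ctr → r' = r) := by
  obtain ⟨h1, h2, h3⟩ := clientOut_broadcast ho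
  have hmono : (ρ.client n r.client).ctr ≤ (ρ.client (max n N) r.client).ctr :=
    h.client_ctr_mono hw.client (le_max_left n N)
  have hctr := hw.ctr (max n N) (le_max_right n N)
  have hpend := hw.pending (max n N) (le_max_right n N)
  refine ⟨by omega, fun hge => ?_⟩
  have h4 := h.client_pending_of_ctr_eq hw.client (le_max_left n N) (by omega) hpend
  rw [h3] at h4
  cases r
  cases r'
  simp_all
  omega

theorem waiting_decision (h : Admissible ρ app F) (hw : ρ.Waiting F r N) {p : ℕ}
    {r' : Request C W} (hd : ρ.decision F p = some r') (hc : r'.client = r.client) :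
    r'.ctr ≤ r.ctr ∧ (r.ctr ≤ r'.ctr → r' = r) := by
  obtain ⟨a, ha, n, hn⟩ := decided_of_decision hd
  obtain ⟨k, -, hk⟩ := h.comp.agreement.validity a ha n p r' hn (hc ▸ hw.client)
  exact h.waiting_broadcast hw (hc ▸ hk)

theorem waiting_request (h : Admissible ρ app F) (hw : ρ.Waiting F r N) {n : ℕ}
    {e : cfg.ExecId} (he : e.2 ∉ F.exec e.1) {r' : Request C W}
    (hi : ρ.execIn n e = some (.request r')) (hc : r'.client = r.client) :
    r'.ctr ≤ r.ctr ∧ (r.ctr ≤ r'.ctr → r' = r) := by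
  obtain ⟨-, k, -, hk⟩ := h.net.request_auth n e he r' (hc ▸ hw.client) hi
  exact h.waiting_broadcast hw (hc ▸ hk)

/-- Move requests come from received requests or from the reply table of a checkpoint, which
contains counters of decided requests only. So windows of this subchannel never pass the position of
`r`. -/
theorem waiting_requestMove (h : Admissible ρ app F) (hw : ρ.Waiting F r N) {n p : ℕ}
    {e : cfg.ExecId} (he : e.2 ∉ F.exec e.1)
    (ho : ρ.ExecOut app n e (.requestMove r.client p)) : p ≤ r.ctr := by
  rcases execOut_requestMove ho with ⟨r', hi, hc, rfl⟩ | ⟨s, cp, val, hi, hl⟩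
  · exact (h.waiting_request hw he hi hc).1
  · rw [h.exec_stable he hi] at hl
    obtain ⟨q, r', hd, hc, rfl⟩ := exists_decision_of_execCanon_last hl
    exact (h.waiting_decision hw hd hc).1

theorem waiting_received (h : Admissible ρ app F) (hw : ρ.Waiting F r N) {i : cfg.Member}
    (hi : i ∉ F.exec (cfg.home r.client)) (n : ℕ) :
    ∃ m, n ≤ m ∧ ρ.execIn m (cfg.home r.client, i) = some (.request r) := by
  refine h.net.request_fair r.client hw.client i hi r (fun n => ?_) n
  obtain ⟨m, hm, hin⟩ := (h.prot.client _ hw.client).2 .resend trivial (max n N) fun m hm => by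
    change (ρ.client m r.client).pending ≠ none
    simp [hw.pending m (le_of_max_le_right hm)]
  refine ⟨m, le_of_max_le_left hm, _, hin, ?_⟩
  rw [client_step_resend]
  exact ⟨r.op, hw.pending m (le_of_max_le_right hm), by rw [hw.ctr m (le_of_max_le_right hm)]⟩

theorem exec_ctr_mono (h : Admissible ρ app F) {e : cfg.ExecId} (he : e.2 ∉ F.exec e.1) (c : C) :
    Monotone fun n => (ρ.exec n e).ctr c := by
  refine monotone_nat_of_le_succ fun n => ?_
  rcases h.exec_ctr_step he n c with h1 | ⟨r, -, -, h1, h2, -⟩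
  · exact h1.ge
  · rw [h1]
    exact h2.le

theorem exec_ctr_source (h : Admissible ρ app F) {e : cfg.ExecId} (he : e.2 ∉ F.exec e.1) (c : C)
    (n : ℕ) : (ρ.exec n e).ctr c = 0 ∨ ∃ k r, ρ.execIn k e = some (.request r) ∧ r.client = c ∧
      r.ctr = (ρ.exec n e).ctr c ∧ ρ.ExecOut app k e (.requestMove c r.ctr) ∧
      ρ.ExecOut app k e (.requestSend c r.ctr r) := by
  induction n with
  | zero => simp [h.exec_zero he, execAutomaton]
  | succ n ih =>
    rcases h.exec_ctr_step he n c with h1 | ⟨r, h1, h2, h3, -, h4, h5⟩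
    · rwa [h1]
    · exact Or.inr ⟨n, r, h1, h2, h3.symm, h4, h5⟩

/-- Every correct replica of the client's group eventually forwards the request. -/
theorem waiting_forwarded (h : Admissible ρ app F) (hw : ρ.Waiting F r N) {i : cfg.Member}
    (hi : i ∉ F.exec (cfg.home r.client)) :
    ∃ n, r.ctr ≤ (ρ.exec n (cfg.home r.client, i)).ctr r.client ∧
      (∃ k, ρ.ExecOut app k (cfg.home r.client, i) (.requestMove r.client r.ctr)) ∧
      ∃ k, ρ.ExecOut app k (cfg.home r.client, i) (.requestSend r.client r.ctr r) := by
  have hpos := h.waiting_ctr_pos hw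
  suffices hex : ∃ n, r.ctr ≤ (ρ.exec n (cfg.home r.client, i)).ctr r.client by
    obtain ⟨n, hn⟩ := hex
    refine ⟨n, hn, ?_⟩
    -- The counter has reached that of `r`; the request that set it came from the client and can
    -- only be `r`.
    rcases h.exec_ctr_source (e := (cfg.home r.client, i)) hi r.client n with
      h0 | ⟨k, r', h1, h2, h3, h4, h5⟩
    · omega
    · obtain rfl := (h.waiting_request hw (e := (cfg.home r.client, i)) hi h1 h2).2 (by omega)
      exact ⟨⟨k, h4⟩, k, h5⟩
  obtain ⟨n, -, hn⟩ := h.waiting_received hw hi 0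
  by_cases hlt : (ρ.exec n (cfg.home r.client, i)).ctr r.client < r.ctr
  · refine ⟨n + 1, ?_⟩
    rw [(h.exec_some (e := (cfg.home r.client, i)) hi hn).2, exec_step_request _ _ _ hlt]
    simp
  · exact ⟨n, not_lt.1 hlt⟩

/-- `receive` calls of agreement replicas for positions up to that of the request return. -/
theorem waiting_receive_returns (h : Admissible ρ app F) (hw : ρ.Waiting F r N) {a : cfg.AgrId}
    (ha : a ∉ F.agr) {n p : ℕ} (hp : p ≤ r.ctr)
    (hc : ρ.AgrOut n a (.receive (cfg.home r.client) r.client p)) :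
    ∃ k, n < k ∧ (ρ.requestChannel app (cfg.home r.client)).RecvRet k a r.client p := by
  have spec := h.comp.requestChannel (cfg.home r.client)
  have hreach : ∀ b, b ∉ F.agr →
      (ρ.requestChannel app (cfg.home r.client)).Reaches b r.client r.ctr := fun b hb =>
    spec.liveness3 r.client r.ctr (F.okExec (cfg.home r.client)) (Faults.card_okExec _)
      (fun i hi => by
        obtain ⟨-, -, ⟨k, hk⟩, -⟩ := h.waiting_forwarded hw (Faults.mem_okExec.1 hi)
        exact ⟨Faults.mem_okExec.1 hi, k, r.ctr, le_rfl, hk⟩) b hb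
  -- Below the position of `r` the moved window answers the call. At the position itself the message
  -- must be sent: `capR ≥ 1` puts it inside a window starting there, so the sends return.
  rcases hp.lt_or_eq with hlt | rfl
  · obtain ⟨k, q, hq, hk⟩ := hreach a ha
    exact spec.recv_old n a ha r.client p hc ⟨k, q, by omega, hk⟩
  · refine spec.liveness1 r.client r.ctr r (F.okExec (cfg.home r.client)) (Faults.card_okExec _)
      (fun i hi => ?_) n a ha hc
    obtain ⟨-, -, -, k, hk⟩ := h.waiting_forwarded hw (Faults.mem_okExec.1 hi)
    have hcap := cfg.capR_pos
    obtain ⟨k', -, hk'⟩ := spec.liveness2 r.client r.ctr F.okAgr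
      ((by omega : cfg.fa + 1 ≤ 2 * cfg.fa + 1).trans Faults.card_okAgr)
      (fun b hb => ⟨Faults.mem_okAgr.1 hb, hreach b (Faults.mem_okAgr.1 hb)⟩) k i
      (Faults.mem_okExec.1 hi) r.ctr r hk (by omega)
    exact ⟨Faults.mem_okExec.1 hi, ⟨k, hk⟩, k', hk'⟩

theorem agr_next_mono (h : Admissible ρ app F) {a : cfg.AgrId} (ha : a ∉ F.agr) (c : C) :
    Monotone fun n => (ρ.agr n a).next c := by
  refine monotone_nat_of_le_succ fun n => ?_
  rcases h.agr_next_step ha n c with h1 | ⟨_, _, _, -, -, h1⟩ | ⟨_, _, -, h1⟩ | ⟨_, _, -, -, h1⟩ |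
    ⟨_, _, -, h1⟩
  · exact h1.ge
  all_goals
    rw [h1]
    exact le_max_left _ _

theorem agr_pending_call (h : Admissible ρ app F) {a : cfg.AgrId} (ha : a ∉ F.agr) {n p : ℕ}
    {g : cfg.Group} {c : C} (hp : (ρ.agr n a).pending g c = some p) :
    ∃ k, k < n ∧ ρ.AgrOut k a (.receive g c p) ∧ (ρ.agr k a).next c = p ∧
      ∀ m, k < m → m < n → (∀ x, ρ.agrIn m a ≠ some (.request g c x)) ∧
        ∀ q, ρ.agrIn m a ≠ some (.tooOld g c q) := by
  induction n with
  | zero => simp [h.agr_zero ha, agrAutomaton] at hp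
  | succ n ih =>
    rcases h.agr_pending_step ha n g c with ⟨h1, h2, h3⟩ | ⟨-, -, h2, h4⟩ | ⟨-, h1, -⟩
    · obtain ⟨k, hk, ho, hs, hm⟩ := ih (h1 ▸ hp)
      refine ⟨k, by omega, ho, hs, fun m hkm hmn => ?_⟩
      rcases Nat.lt_or_ge m n with hlt | hge
      · exact hm m hkm hlt
      · have : m = n := by omega
        subst this
        exact ⟨h2, h3⟩
    · rw [h2] at hp
      cases hp
      exact ⟨n, by omega, h4, rfl, fun m h5 h6 => by omega⟩
    · simp [h1] at hp

/-- An outstanding `receive` call up to the position of the request returns, and `t⁺` gets past its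
position. -/
theorem waiting_pending_returns (h : Admissible ρ app F) (hw : ρ.Waiting F r N) {a : cfg.AgrId}
    (ha : a ∉ F.agr) {n p : ℕ} (hp : p ≤ r.ctr)
    (hpend : (ρ.agr n a).pending (cfg.home r.client) r.client = some p) :
    ∃ k, n ≤ k ∧ (ρ.agr k a).pending (cfg.home r.client) r.client = none ∧
      p + 1 ≤ (ρ.agr k a).next r.client := by
  obtain ⟨k, hk, ho, -, hno⟩ := h.agr_pending_call ha hpend
  obtain ⟨k', hk', hr⟩ := h.waiting_receive_returns hw ha hp ho
  have hge : n ≤ k' := by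
    by_contra! hlt
    have hno' := hno k' hk' hlt
    rcases hr with ⟨m, -, hm⟩ | ⟨p', -, hm⟩
    · exact hno'.1 m hm
    · exact hno'.2 p' hm
  refine ⟨k' + 1, by omega, ?_⟩
  rcases hr with ⟨m, hp', hm⟩ | ⟨p', hp', hm⟩
  · rw [(h.agr_some ha hm).2, agr_step_request]
    simp [hp']
  · have hlt := ((h.comp.requestChannel (cfg.home r.client)).correctness2 k' a ha _ _ _
      ⟨hp', hm⟩).1
    rw [(h.agr_some ha hm).2, agr_step_tooOld]
    simp
    omega

theorem agr_calls_receive (h : Admissible ρ app F) {a : cfg.AgrId} (ha : a ∉ F.agr) {n : ℕ}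
    {g : cfg.Group} {c : C} (hp : (ρ.agr n a).pending g c = none) :
    ∃ m, n ≤ m ∧ (ρ.agr m a).pending g c = some ((ρ.agr m a).next c) := by
  by_contra! hno
  have hcall : ∀ m, n ≤ m → ρ.agrIn m a = some (.callReceive g c) → False := by
    intro m hm hi
    have h1 := (h.agr_some ha hi).2
    rw [agr_step_callReceive] at h1
    refine hno (m + 1) (by omega) ?_
    rw [h1]
    simp
  have hstay : ∀ m, n ≤ m → (ρ.agr m a).pending g c = none := by
    intro m hm
    induction m, hm using Nat.le_induction with
    | base => exact hp
    | succ m hm ih =>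
      rcases h.agr_pending_step ha m g c with ⟨h1, -⟩ | ⟨h1, -⟩ | ⟨-, h1, -⟩
      · exact h1.trans ih
      · exact (hcall m hm h1).elim
      · exact h1
  obtain ⟨m, hm, hi⟩ := (h.prot.agr a ha).2 (.callReceive g c) trivial n hstay
  exact hcall m hm hi

/-- As long as `t⁺` does not exceed the counter of `r`, every `receive` call of the loop for the
client's group returns, and each new call raises `t⁺` by at least one. -/
theorem waiting_next (h : Admissible ρ app F) (hw : ρ.Waiting F r N) {a : cfg.AgrId}
    (ha : a ∉ F.agr) : ∃ n, r.ctr < (ρ.agr n a).next r.client := by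
  by_contra! hno
  have hgrow : ∀ j, ∃ n, j ≤ (ρ.agr n a).next r.client := by
    intro j
    induction j with
    | zero => exact ⟨0, Nat.zero_le _⟩
    | succ j ih =>
      obtain ⟨n, hn⟩ := ih
      have idle : ∀ m, n ≤ m → (ρ.agr m a).pending (cfg.home r.client) r.client = none →
          ∃ k, j + 1 ≤ (ρ.agr k a).next r.client := by
        intro m hm hp
        obtain ⟨k, hk, hpk⟩ := h.agr_calls_receive ha hp
        obtain ⟨l, -, -, hl⟩ := h.waiting_pending_returns hw ha (hno k) hpk
        have hmono : (ρ.agr n a).next r.client ≤ (ρ.agr k a).next r.client :=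
          h.agr_next_mono ha r.client (hm.trans hk)
        exact ⟨l, by omega⟩
      rcases hp : (ρ.agr n a).pending (cfg.home r.client) r.client with _ | p
      · exact idle n le_rfl hp
      -- This call may use an outdated value of `t⁺`, so its return need not bring progress; only
      -- the next call is sure to.
      · obtain ⟨k, -, -, hk, -⟩ := h.agr_pending_call ha hp
        obtain ⟨l, hl, hnone, -⟩ := h.waiting_pending_returns hw ha (hk ▸ hno k) hp
        exact idle l hl hnone
  obtain ⟨n, hn⟩ := hgrow (r.ctr + 1)
  exact not_lt.2 (hno n) hn

/-- An agreement replica whose `t⁺` exceeds the counter of the request has ordered it, delivered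
it, or skipped it. -/
theorem waiting_ordered (h : Admissible ρ app F) (hw : ρ.Waiting F r N) {a : cfg.AgrId}
    (ha : a ∉ F.agr) {n : ℕ} (hn : r.ctr < (ρ.agr n a).next r.client) :
    (∃ n, ρ.AgrOut n a (.order r)) ∨ ρ.agreement.Passes {a | a ∉ F.agr} a r := by
  have hpos := h.waiting_ctr_pos hw
  induction n with
  | zero => simp [h.agr_zero ha, agrAutomaton] at hn; omega
  | succ n ih =>
    rcases h.agr_next_step ha n r.client with h1 | ⟨g, r', p, hi, hp, h1⟩ | ⟨g, p, hi, h1⟩ |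
      ⟨s, r', hd, hc, h1⟩ | ⟨s, cp, hi, h1⟩ <;> rw [h1] at hn
    · exact ih hn
    -- Either `t⁺` was beyond `r` before the step, or the newly taken value lies beyond. In the
    -- second case each source of the value must involve `r` itself, as no correct process uses a
    -- larger counter.
    all_goals rcases lt_max_iff.1 hn with hlt | hlt
    all_goals first | exact ih hlt | skip
    · obtain ⟨⟨k, -, i, hi', hs⟩, -⟩ :=
        (h.comp.requestChannel g).correctness1 n a ha r.client p r' ⟨hp, hi⟩
      obtain ⟨h2, h3, h4⟩ := execOut_requestSend hs
      obtain rfl := (h.waiting_request hw (e := (g, i)) hi' h2 h3).2 (by omega)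
      exact Or.inl ⟨n, request_outputs hi⟩
    · obtain ⟨p₀, hp₀⟩ := Option.ne_none_iff_exists'.1 (h.agr_some ha hi).1
      obtain ⟨-, k, q, -, hq, ⟨i, hi', hm⟩ | ⟨j, -, hm⟩⟩ :=
        (h.comp.requestChannel g).correctness2 n a ha r.client p₀ p ⟨hp₀, hi⟩
      -- TooOld cannot carry `t⁺` past `r`: correct execution replicas ask for no such move, and
      -- agreement replicas call `move_window` on request channels only internally.
      · have := h.waiting_requestMove hw (e := (g, i)) hi' hm
        omega
      · exact hm.elim
    · obtain ⟨-, -, ⟨k, -, hk⟩, hdec⟩ := h.agr_atWindow ha hd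
      obtain rfl := (h.waiting_decision hw hdec hc).2 (by omega)
      exact Or.inr (Or.inl ⟨k, s, hk⟩)
    · obtain ⟨-, hcp, -⟩ := h.agr_stable ha hi
      rw [hcp] at hlt
      obtain ⟨p, r', hp, hps, hdec, hc, hctr⟩ :=
        exists_decision_of_agrCanon_ctr (ρ := ρ) (F := F) (s := s) (c := r.client) (by omega)
      obtain rfl := (h.waiting_decision hw hdec hc).2 (by omega)
      obtain ⟨b, hb, k, hk⟩ := decided_of_decision hdec
      -- The counter in the checkpoint stems from a decision of `r` at some `p ≤ s`, and the
      -- checkpoint has garbage-collected everything below `s + 1`: the replica skips `r`.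
      exact Or.inr (Or.inr ⟨n, p, s + 1, (stable_outputs hi).1, by omega, b, hb, k, hk⟩)

/-- All correct replicas of the client's group eventually store the same reply, and they send no
other one. -/
theorem waiting_reply (h : Admissible ρ app F) (hw : ρ.Waiting F r N) :
    ∃ val, (∀ i, i ∉ F.exec (cfg.home r.client) → ∃ n, ∀ m, n ≤ m →
        (ρ.exec m (cfg.home r.client, i)).last r.client = some (val, r.ctr)) ∧
      ∀ i, i ∉ F.exec (cfg.home r.client) → ∀ n val',
        ρ.ExecOut app n (cfg.home r.client, i) (.reply r.client val' r.ctr) → val' = val := by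
  obtain ⟨s, hs1, hs, hreach⟩ := h.exists_decision (r := r) fun a ha => by
    obtain ⟨n, hn⟩ := h.waiting_next hw ha
    exact h.waiting_ordered hw ha hn
  have hbound : ∀ p r', ρ.decision F p = some r' → r'.client = r.client → r'.ctr ≤ r.ctr :=
    fun p r' hd hc => (h.waiting_decision hw hd hc).1
  obtain ⟨val, t, hl, hle⟩ := execCanon_last_of_decision (app := app) hs1 hs
  obtain rfl : t = r.ctr := by
    obtain ⟨p, r', hd, hc, rfl⟩ := exists_decision_of_execCanon_last hl
    exact le_antisymm (hbound p r' hd hc) hle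
  refine ⟨val, fun i hi => ?_, fun i hi n val' ho => ?_⟩
  · obtain ⟨n, hn⟩ := hreach _ i hi
    refine ⟨n, fun m hm => ?_⟩
    have hseq : (ρ.exec n (cfg.home r.client, i)).seq ≤ (ρ.exec m (cfg.home r.client, i)).seq :=
      h.exec_seq_mono (e := (cfg.home r.client, i)) hi hm
    have hinv := h.exec_inv m (cfg.home r.client, i) hi
    have hst := execCanon_last_stable hbound (hn.trans hseq) hl
    rwa [← hinv] at hst
  · obtain ⟨x, hx⟩ : ∃ x, (ρ.execCanon app F x).last r.client = some (val', r.ctr) := by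
      have hinv := h.exec_inv n (cfg.home r.client, i) hi
      rcases execOut_reply ho with h1 | ⟨m, h1, h2, h3⟩
      · exact ⟨_, by rw [← hinv]; exact h1⟩
      · refine ⟨(ρ.exec n (cfg.home r.client, i)).seq + 1, ?_⟩
        rw [execCanon_succ (h.exec_received hi h1 h2), ← hinv]
        exact h3
    -- Both entries have the maximal counter, so both persist up to `max x s` and coincide there.
    have h1 := execCanon_last_stable hbound (le_max_left x s) hx
    have h2 := execCanon_last_stable hbound (le_max_right x s) hl
    rw [h1] at h2
    cases h2
    rfl

theorem waiting_replies_persist (h : Admissible ρ app F) (hw : ρ.Waiting F r N) {n m : ℕ}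
    (hn : N ≤ n) (hnm : n ≤ m) {i : cfg.Member}
    (hi : (ρ.client n r.client).replies i ≠ none) :
    (ρ.client m r.client).replies i ≠ none := by
  classical
  induction m, hnm using Nat.le_induction with
  | base => exact hi
  | succ m hm ih =>
    rcases h.client_step hw.client m with ⟨h1, -⟩ | ⟨op, h1, -⟩ | ⟨j, val, -, -, -, -, h1⟩ |
      ⟨val, -, h1, -⟩
    · rwa [h1]
    · simp [hw.pending m (by omega)] at h1
    · rw [h1]
      by_cases hij : i = j
      · subst hij
        simp
      · simpa [Function.update_of_ne hij] using ih
    · simp [hw.pending (m + 1) (by omega)] at h1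

/-- Once a replica has seen and executed `r`, every retransmission is a duplicate and makes it send
the stored reply again. Fairness delivers one after `N`, and the client stores the replica's first
answer. -/
theorem waiting_replies (h : Admissible ρ app F) (hw : ρ.Waiting F r N) {i : cfg.Member}
    (hi : i ∉ F.exec (cfg.home r.client)) :
    ∃ n, N ≤ n ∧ (ρ.client n r.client).replies i ≠ none := by
  classical
  obtain ⟨val, hlast, -⟩ := h.waiting_reply hw
  obtain ⟨n₁, hn₁⟩ := hlast i hi
  obtain ⟨n₂, hn₂, -⟩ := h.waiting_forwarded hw hi
  obtain ⟨m, hm, hin⟩ := h.net.reply_fair r.client hw.client i hi val r.ctr (fun n => by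
    obtain ⟨k, hk, hreq⟩ := h.waiting_received hw hi (max n (max n₁ n₂))
    have hold : ¬ (ρ.exec k (cfg.home r.client, i)).ctr r.client < r.ctr := by
      have : (ρ.exec n₂ (cfg.home r.client, i)).ctr r.client ≤
          (ρ.exec k (cfg.home r.client, i)).ctr r.client :=
        h.exec_ctr_mono (e := (cfg.home r.client, i)) hi r.client (by omega)
      omega
    refine ⟨k, by omega, _, hreq, ?_⟩
    rw [exec_step_request_old _ _ _ hold]
    exact ⟨val, hn₁ k (by omega), rfl⟩) N
  refine ⟨m + 1, by omega, ?_⟩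
  have hp := hw.pending m hm
  rw [← hw.ctr m hm] at hin
  rcases h.client_step hw.client m with ⟨h1, h2⟩ | ⟨op, h1, -⟩ | ⟨j, val', h1, -, -, -, h2⟩ |
    ⟨val, -, h1, -⟩
  · rw [h1]
    exact h2 i val (by simp [hp]) hin
  · simp [hp] at h1
  · rw [hin] at h1
    cases h1
    rw [h2]
    simp
  · simp [hw.pending (m + 1) (by omega)] at h1

/-- At a late time every correct replica of the group has an answer stored at the client, all with
the same value. These are at least `fe + 1`, while a waiting client holds at most `fe` equal
answers. -/
theorem not_waiting (h : Admissible ρ app F) : ¬ ρ.Waiting F r N := by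
  intro hw
  obtain ⟨val, -, huniq⟩ := h.waiting_reply hw
  have hex : ∀ i : cfg.Member, ∃ n, i ∉ F.exec (cfg.home r.client) →
      N ≤ n ∧ (ρ.client n r.client).replies i ≠ none := fun i => by
    by_cases hi : i ∈ F.exec (cfg.home r.client)
    · exact ⟨0, fun hn => (hn hi).elim⟩
    · obtain ⟨n, hn⟩ := h.waiting_replies hw hi
      exact ⟨n, fun _ => hn⟩
  choose T hT using hex
  set M := max N (Finset.univ.sup T) with hM
  obtain ⟨-, hcard, hsrc⟩ :=
    h.client_inv hw.client M (by simp [hw.pending M (le_max_left _ _)])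
  rw [hw.ctr M (le_max_left _ _)] at hsrc
  have hsub : ((F.okExec (cfg.home r.client) : Finset cfg.Member) : Set cfg.Member) ⊆
      {j | (ρ.client M r.client).replies j = some val} := by
    intro i hi
    have hi := Faults.mem_okExec.1 hi
    have hle : T i ≤ M := (Finset.le_sup (Finset.mem_univ i)).trans (le_max_right _ _)
    obtain ⟨v, hv⟩ := Option.ne_none_iff_exists'.1
      (h.waiting_replies_persist hw (hT i hi).1 hle (hT i hi).2)
    obtain ⟨k, hk⟩ := hsrc i v hi hv
    exact huniq i hi k v hk ▸ hv
  have h1 := Set.ncard_le_ncard hsub (Set.toFinite _)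
  rw [Set.ncard_coe_finset] at h1
  have h2 := Faults.card_okExec (F := F) (cfg.home r.client)
  exact absurd (h2.trans (h1.trans (hcard val))) (Nat.not_succ_le_self _)

end

theorem eLiveness (h : Admissible ρ app F) : ρ.ELiveness F := by
  intro c hc n op hp
  by_contra! hno
  refine h.not_waiting (r := ⟨op, c, (ρ.client n c).ctr⟩) (N := n) ?_
  have hstay : ∀ m, n ≤ m → (ρ.client m c).pending = some op ∧
      (ρ.client m c).ctr = (ρ.client n c).ctr := by
    intro m hm
    induction m, hm using Nat.le_induction with
    | base => exact ⟨hp, rfl⟩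
    | succ m hm ih =>
      rcases h.client_step hc m with ⟨h1, -⟩ | ⟨op, h1, -⟩ | ⟨j, val, -, -, -, -, h1⟩ |
        ⟨val, h1, -⟩
      · rwa [h1]
      · simp [ih.1] at h1
      · rw [h1]
        exact ih
      · rw [ih.2] at h1
        exact (hno m val hm h1).elim
  exact ⟨hc, fun m hm => (hstay m hm).1, fun m hm => (hstay m hm).2⟩

end Admissible
end Run
end Spider

theorem mainTheorem4 {C W S U : Type*} (cfg : Spider.Config C) (app : Spider.App W S U)
    (F : Spider.Faults cfg) (ρ : Spider.Run W S U cfg)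
    (hprot : ρ.FollowsProtocol app F) (hnet : ρ.Network app F) (hcomp : ρ.Components app F) :
    -- every correct client eventually gets a reply
    ρ.ELiveness F ∧
    -- a correct execution replica that is notified by `⟨TooOld, p⟩` finds a checkpoint that covers
    -- all skipped positions in its own group or in `ne - z` groups, obtains such a checkpoint
    -- and catches up
    (∀ (g : cfg.Group) (i : cfg.Member), i ∉ F.exec g →
      ∀ n p, ρ.execIn n (g, i) = some (.tooOld p) →
        (ρ.HasCheckpoint F n g (p - 1) ∨
          cfg.ne - cfg.z ≤ Set.ncard {g' : cfg.Group | ρ.HasCheckpoint F n g' (p - 1)}) ∧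
        (∃ n' s cp, p - 1 ≤ s ∧ ρ.execIn n' (g, i) = some (.stable s cp)) ∧
        ∃ n', ∀ k, n' ≤ k → p - 1 ≤ (ρ.exec k (g, i)).seq) ∧
    -- once an agreement checkpoint is stable, a `receive` call that is outstanding at a position
    -- that the checkpoint drops returns, and every correct execution replica gets past these
    -- positions
    (∀ a, a ∉ F.agr → ∀ n s cp, ρ.agrIn n a = some (.stable s cp) →
      ∀ (g : cfg.Group) (i : cfg.Member), i ∉ F.exec g →
        (∀ k p, (ρ.exec k (g, i)).pending = some p → p + cfg.capC ≤ s →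
          ∃ k', k ≤ k' ∧ (ρ.exec k' (g, i)).pending = some p ∧
            ((∃ p', ρ.execIn k' (g, i) = some (.tooOld p')) ∨
              ∃ m, ρ.execIn k' (g, i) = some (.execute m))) ∧
        ∃ k, ∀ k', k ≤ k' → s ≤ (ρ.exec k' (g, i)).seq + cfg.capC) := by
  have h : Spider.Run.Admissible ρ app F := ⟨hprot, hnet, hcomp⟩
  refine ⟨h.eLiveness, fun g i hi n p ht => ?_, fun a ha n s cp hs g i hi => ⟨?_, ?_⟩⟩
  · exact ⟨h.hasCheckpoint_of_tooOld hi ht, h.stable_of_tooOld hi ht, h.seq_of_tooOld hi ht⟩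
  · exact fun k p hp hle => h.pending_returns hi hp fun l hl =>
      h.receive_returns_of_agr_stable ha hs hi hle hl
  -- The subtraction is truncated; for `s ≤ capC` the target is `0` and nothing has to be reached.
  · obtain ⟨k, hk⟩ := h.exec_reaches_of_agr_stable ha hs hi (s - cfg.capC) (by omega)
    refine ⟨k, fun l hl => ?_⟩
    have hmono : (ρ.exec k (g, i)).seq ≤ (ρ.exec l (g, i)).seq :=
      h.exec_seq_mono (e := (g, i)) hi hl
    omega
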